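/- Strings are over $\{0,1\}$. A zero-error probabilistic machine for a language $L$ is a probabilistic Turing machine (with a fair coin in each step) that answers "$x\in L$?" correctly whenever it halts. Let $\mathrm{ZTIME}(t(n))$ be the class of languages $L$ that have a zero-error probabilistic machine whose expected running time on every input of length $n$ is at most $\tau(n)$, for some $\tau:\mathbb{N}\to\mathbb{N}$ with $\tau(n)=O(t(n))$. Put $\mathrm{ZPP}=\bigcup_{c\ge1}\mathrm{ZTIME}(n^c)$ and $\mathrm{ZTIME}(2^{O(n)})=\bigcup_{c\ge1}\mathrm{ZTIME}(2^{cn})$. For functions $d,g:\mathbb{N}\to\mathbb{N}$ let $\mathrm{TALLY}(d(n),g(n))$ be the class of all $T\subseteq\{1\}^*$ such that for every $n$ at most $d(n)$ strings in $T$ have length at most $n$, and such that $g(n)<m$ for any two strings $1^n,1^m\in T$ with $n<m$. Call $g$ padding stable if $g(2^n+n)<2^{g(n)}+g(n)$ for all $n>1$. Lemma. Let $d,g:\mathbb{N}\to\mathbb{N}$ be nondecreasing unbounded functions such that $d$ is computable and $g$ is padding stable. Then there is a language $A$ with $A\in\mathrm{ZTIME}(2^{O(n)})\cap\mathrm{TALLY}(d(n),g(n))$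 and $A\notin\mathrm{ZPP}$. -/

import Mathlib

open MeasureTheory Asymptotics
open scoped ENNReal

/-- A probabilistic Turing machine: a finite control with finitely many stacks over finite alphabets
(Mathlib's `Turing.TM2` machines; two stacks are one tape, so these are the multitape Turing
machines), and two transition programs `prog false`, `prog true`. In every step a fair coin is
tossed and the program that it selects is used. The machine accepts or rejects according to its
internal state when it halts. -/
structure ProbTM where
  /-- index set of the stacks -/
  K : Type
  [decEqK : DecidableEq K]
  [finK : Finite K]
  /-- stack alphabets -/
  Γ : K → Type
  [finΓ : ∀ k, Finite (Γ k)]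
  /-- program labels -/
  Λ : Type
  [finΛ : Finite Λ]
  /-- internal states -/
  σ : Type
  [finσ : Finite σ]
  /-- the stack that holds the input, first letter on top -/
  input : K
  /-- the letters that represent the two input bits -/
  letter : Bool ↪ Γ input
  /-- initial label -/
  main : Λ
  /-- initial internal state -/
  init : σ
  /-- the two transition programs -/
  prog : Bool → Λ → Turing.TM2.Stmt Γ Λ σ
  /-- the accepting internal states -/
  accept : σ → Bool

namespace ProbTM

attribute [instance] decEqK finK finΓ finΛ finσ

/-- The configurations of the machine; the label `none` means that it has halted. -/
abbrev Cfg (M : ProbTM) : Type := Turing.TM2.Cfg M.Γ M.Λ M.σ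

/-- The initial configuration on input `w`: all stacks but the input stack are empty. -/
def start (M : ProbTM) (w : List Bool) : M.Cfg where
  l := some M.main
  var := M.init
  stk := Function.update (fun _ => []) M.input (w.map M.letter)

/-- The configuration after `t` steps on input `w`, where `ω i` is the coin of step `i`. A halted
machine stays as it is. -/
def run (M : ProbTM) (w : List Bool) (ω : ℕ → Bool) : ℕ → M.Cfg
  | 0 => M.start w
  | t + 1 => (Turing.TM2.step (M.prog (ω t)) (M.run w ω t)).getD (M.run w ω t)

/-- The machine has halted after `t` steps. -/
def HaltedAt (M : ProbTM) (w : List Bool) (ω : ℕ → Bool) (t : ℕ) : Prop :=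
  (M.run w ω t).l = none

/-- The running time on input `w` with coins `ω`: the least number of steps after which the machine
has halted, and `∞` if it never halts. -/
noncomputable def time (M : ProbTM) (w : List Bool) (ω : ℕ → Bool) : ℝ≥0∞ :=
  ⨅ (t : ℕ) (_ : M.HaltedAt w ω t), (t : ℝ≥0∞)

/-- The law of an infinite sequence of independent fair coins. -/
noncomputable def coins : Measure (ℕ → Bool) :=
  Measure.infinitePi fun _ => (PMF.uniformOfFintype Bool).toMeasure

/-- The expected running time on input `w`. -/
noncomputable def expectedTime (M : ProbTM) (w : List Bool) : ℝ≥0∞ :=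
  ∫⁻ ω, M.time w ω ∂coins

/-- Zero error: whenever the machine halts, its answer to `w ∈ L` is right. -/
def ZeroError (M : ProbTM) (L : Language Bool) : Prop :=
  ∀ w ω t, M.HaltedAt w ω t → (M.accept (M.run w ω t).var = true ↔ w ∈ L)

end ProbTM

/-- `ZTIME(t(n))`: the languages that have a zero-error probabilistic machine whose expected running
time on inputs of length `n` is at most some `τ(n) = O(t(n))`. (As `τ(n)` is finite, the machine
halts with probability one on every input.) -/
def ZTIME (t : ℕ → ℕ) : Set (Language Bool) :=
  {L | ∃ (M : ProbTM) (τ : ℕ → ℕ), M.ZeroError L ∧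
    (∀ w : List Bool, M.expectedTime w ≤ (τ w.length : ℝ≥0∞)) ∧
    (fun n => (τ n : ℝ)) =O[Filter.atTop] (fun n => (t n : ℝ))}

/-- `ZPP`, the union of the classes `ZTIME(n^c)` over `c ≥ 1`. -/
def ZPP : Set (Language Bool) := ⋃ (c : ℕ) (_ : 1 ≤ c), ZTIME fun n => n ^ c

/-- `ZTIME(2^{O(n)})`, the union of the classes `ZTIME(2^{cn})` over `c ≥ 1`. -/
def ZTIMEExpLinear : Set (Language Bool) := ⋃ (c : ℕ) (_ : 1 ≤ c), ZTIME fun n => 2 ^ (c * n)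

/-- The string `1^n`. -/
def ones (n : ℕ) : List Bool := List.replicate n true

/-- `TALLY(d(n), g(n))`: the languages `T ⊆ {1}^*` with at most `d(n)` strings of length at most `n`
for every `n`, and with `g(n) < m` for any two strings `1^n`, `1^m` in `T` with `n < m`. -/
def TALLY (d g : ℕ → ℕ) : Set (Language Bool) :=
  {T | (∀ w ∈ T, ∃ n, w = ones n) ∧
    (∀ n, {w : List Bool | w ∈ T ∧ w.length ≤ n}.encard ≤ d n) ∧
    ∀ n m, ones n ∈ T → ones m ∈ T → n < m → g n < m}

/-- The function `g` is padding stable. -/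
def PaddingStable (g : ℕ → ℕ) : Prop :=
  ∀ n, 1 < n → g (2 ^ n + n) < 2 ^ g n + g n

/-!
The proof is a delayed diagonalization along a sequence of tower-sized input lengths, combined with
a case distinction between a language and its padded version.

*Lengths.* Write `tower 0 = 0` and `tower (s + 1) = 2 ^ tower s`. Comparing a padding stable
function `g` with the iterates of `n ↦ 2 ^ n + n` shows that `g (tower a) < tower (a + c)` for some
constant `c` and all `a` (`PaddingStable.exists_tower`). A rank `r` is called active if `c ∣ r` and
fewer than `d r` ranks have been active before (`isActive`). As `d` is computable, one code computes
the data of rank `r + 1` from those of rank `r`; evaluating it over and over gives a process that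
reaches rank `r` after `t (r + 1)` steps, with `t` strictly increasing (`exists_procTimes`).
Languages whose strings have lengths `tower (s r)` for active ranks `r` and a strictly increasing
`s` belong to `TALLY d g` (`mem_TALLY_of_active`). Using the running time `t (r + 1)` itself as
height of the tower makes the valid lengths easy to recognize: it suffices to take iterated
logarithms and to run the process for as many steps as there were logarithms (`diag_tower`,
`diag_proc`).

*The diagonalizing machine.* The machine `diag` works on `1 ^ (2 ^ n)`. After the test whether
`2 ^ n` is a valid length, of rank `r`, it simulates a machine assigned to `r` on the input `1 ^ n`, for
all finite coin sequences in the order of their length, and gives the opposite of the answer of the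
first halting run (`diag_search`, `diag_spec`). The simulated machines are *table machines*: two
stacks of natural numbers, controlled by a finite table that is coded by a single number. Every
probabilistic machine is represented by a table machine with quadratic loss of time
(`ProbTM.exists_table`), by interleaving its stacks in one of the two stacks. Since every machine is
assigned to infinitely many active ranks (`exists_numActive_eq`), it is contradicted at infinitely
many lengths.

*The two languages.* Let `A₁` consist of the inputs `1 ^ m` that `diag` accepts within `2 ^ m`
steps, and let `A₀ = {1 ^ n | 1 ^ (2 ^ n) ∈ A₁}`. A clock puts `A₁` into `ZTIME(2 ^ O(n))`
(`ProbTM.clocked_mem_ZTIMEExpLinear`). A machine that decides `A₀` without error in expected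
polynomial time has, on `1 ^ n`, a halting run with polynomially many coins
(`ProbTM.exists_haltedAt`). Because of zero error its answer is right, and so is the answer of any
halting run that `diag` finds earlier. The search takes time `2 ^ poly(n)`, which is less than
`2 ^ (2 ^ n)` for large `n` (`exists_search_time_le`), so `diag` finishes within its clock and
contradicts the machine. Hence `A₀ ∉ ZPP` (`notMem_ZPP_of_diagonal`). If `A₀ ∈ ZTIME(2 ^ O(n))`,
then `A₀` is as required. Otherwise `A₁` is: from `A₁ ∈ ZPP` it would follow that
`A₀ ∈ ZTIME(2 ^ O(n))`, since `1 ^ (2 ^ n)` can be written down in time `O(2 ^ n)`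
(`ProbTM.unpad_mem_ZTIMEExpLinear`).
-/

open Turing

/-! ### Runs from an arbitrary configuration -/

section CoinRun

variable {K : Type} [DecidableEq K] {Γ : K → Type} {Λ σ : Type}
  (p : Bool → Λ → TM2.Stmt Γ Λ σ)

/-- One step with coin `b`; a halted configuration stays as it is. -/
def coinStep (b : Bool) (c : TM2.Cfg Γ Λ σ) : TM2.Cfg Γ Λ σ := (TM2.step (p b) c).getD c

/-- The configuration that is reached from `c` in a given number of steps with coins `ω`. -/
def coinRun (c : TM2.Cfg Γ Λ σ) (ω : ℕ → Bool) : ℕ → TM2.Cfg Γ Λ σ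
  | 0 => c
  | t + 1 => coinStep p (ω t) (coinRun c ω t)

theorem ProbTM.run_eq_coinRun (M : ProbTM) (w : List Bool) (ω : ℕ → Bool) (t : ℕ) :
    M.run w ω t = coinRun M.prog (M.start w) ω t := by
  induction t with
  | zero => rfl
  | succ t ih => simp only [run, coinRun, coinStep, ih]

theorem coinRun_add (c : TM2.Cfg Γ Λ σ) (ω : ℕ → Bool) (s t : ℕ) :
    coinRun p c ω (s + t) = coinRun p (coinRun p c ω s) (fun i => ω (s + i)) t := by
  induction t with
  | zero => rfl
  | succ t ih =>
    show coinStep p _ (coinRun p c ω (s + t)) = _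
    rw [ih]; rfl

theorem coinRun_succ' (c : TM2.Cfg Γ Λ σ) (ω : ℕ → Bool) (t : ℕ) :
    coinRun p c ω (t + 1) = coinRun p (coinStep p (ω 0) c) (fun i => ω (i + 1)) t := by
  rw [add_comm, coinRun_add]
  simp [coinRun, add_comm]

theorem coinStep_of_halted {c : TM2.Cfg Γ Λ σ} (h : c.l = none) (b : Bool) :
    coinStep p b c = c := by
  obtain ⟨l, v, S⟩ := c
  obtain rfl : l = none := h
  rfl

@[simp] theorem coinStep_some (b : Bool) (l : Λ) (v : σ) (S : ∀ k, List (Γ k)) :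
    coinStep p b ⟨some l, v, S⟩ = TM2.stepAux (p b l) v S := rfl

theorem coinRun_of_halted {c : TM2.Cfg Γ Λ σ} (h : c.l = none) (ω : ℕ → Bool) (t : ℕ) :
    coinRun p c ω t = c := by
  induction t with
  | zero => rfl
  | succ t ih => simp only [coinRun, ih, coinStep_of_halted p h]

theorem coinRun_stable {c : TM2.Cfg Γ Λ σ} {ω : ℕ → Bool} {s t : ℕ} (hst : s ≤ t)
    (h : (coinRun p c ω s).l = none) : coinRun p c ω t = coinRun p c ω s := by
  obtain ⟨u, rfl⟩ := Nat.exists_eq_add_of_le hst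
  rw [coinRun_add, coinRun_of_halted p h]

theorem coinRun_congr {c : TM2.Cfg Γ Λ σ} {ω ω' : ℕ → Bool} {t : ℕ} (h : ∀ i < t, ω i = ω' i) :
    coinRun p c ω t = coinRun p c ω' t := by
  induction t with
  | zero => rfl
  | succ t ih =>
    simp only [coinRun]
    rw [ih fun i hi => h i (hi.trans (Nat.lt_succ_self t)), h t (Nat.lt_succ_self t)]

/-- From label `l` and stacks `S`, whatever the internal state and the coins, the machine gets
within `B` steps into a configuration (the same for all coins) that satisfies `P`. -/
def Leads (B : ℕ) (l : Λ) (S : ∀ k, List (Γ k)) (P : TM2.Cfg Γ Λ σ → Prop) : Prop :=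
  ∀ v, ∃ t ≤ B, ∃ c', (∀ ω, coinRun p ⟨some l, v, S⟩ ω t = c') ∧ P c'

/-- The configurations at label `l` with stacks `S`. -/
def At (l : Λ) (S : ∀ k, List (Γ k)) (c : TM2.Cfg Γ Λ σ) : Prop := c.l = some l ∧ c.stk = S

/-- The halted configurations with answer `b`. -/
def Answers (acc : σ → Bool) (b : Bool) (c : TM2.Cfg Γ Λ σ) : Prop :=
  c.l = none ∧ acc c.var = b

variable {p}

theorem Leads.mono {B B' : ℕ} {l : Λ} {S : ∀ k, List (Γ k)} {P : TM2.Cfg Γ Λ σ → Prop}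
    (h : Leads p B l S P) (hB : B ≤ B') : Leads p B' l S P := fun v => by
  obtain ⟨t, ht, h⟩ := h v
  exact ⟨t, ht.trans hB, h⟩

theorem Leads.refl (l : Λ) (S : ∀ k, List (Γ k)) : Leads p 0 l S (At l S) :=
  fun v => ⟨0, le_rfl, ⟨some l, v, S⟩, fun _ => rfl, rfl, rfl⟩

/-- A step into an explicit configuration, from which the run is known. -/
theorem Leads.of_run {B : ℕ} {l : Λ} {S : ∀ k, List (Γ k)} {P : TM2.Cfg Γ Λ σ → Prop}
    (h : ∀ v, ∃ c, (∀ b, TM2.stepAux (p b l) v S = c) ∧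
      ∃ t ≤ B, ∃ c', (∀ ω, coinRun p c ω t = c') ∧ P c') :
    Leads p (B + 1) l S P := fun v => by
  obtain ⟨c, hc, t, ht, c', hc', hP⟩ := h v
  refine ⟨t + 1, by omega, c', fun ω => ?_, hP⟩
  rw [coinRun_succ', coinStep_some, hc, hc']

/-- A step from a label to a label, followed by a run that is known already. -/
theorem Leads.head {B : ℕ} {l l' : Λ} {S S' : ∀ k, List (Γ k)} {P : TM2.Cfg Γ Λ σ → Prop}
    (h' : Leads p B l' S' P)
    (h : ∀ v, ∃ v', ∀ b, TM2.stepAux (p b l) v S = ⟨some l', v', S'⟩) :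
    Leads p (B + 1) l S P := .of_run fun v => by
  obtain ⟨v', hv'⟩ := h v
  exact ⟨_, hv', h' v'⟩

theorem Leads.halts {l : Λ} {S : ∀ k, List (Γ k)} {acc : σ → Bool} {a : Bool}
    (h : ∀ v, ∃ v' S', acc v' = a ∧ ∀ b, TM2.stepAux (p b l) v S = ⟨none, v', S'⟩) :
    Leads p 1 l S (Answers acc a) := Leads.of_run (B := 0) fun v => by
  obtain ⟨v', S', ha, hv'⟩ := h v
  exact ⟨_, hv', 0, le_rfl, _, fun _ => rfl, rfl, ha⟩

theorem Leads.trans {B B' : ℕ} {l l' : Λ} {S S' : ∀ k, List (Γ k)} {P : TM2.Cfg Γ Λ σ → Prop}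
    (h : Leads p B l S (At l' S')) (h' : Leads p B' l' S' P) : Leads p (B + B') l S P :=
  fun v => by
  obtain ⟨t, ht, ⟨_, v', _⟩, hc, rfl, rfl⟩ := h v
  obtain ⟨t', ht', c', hc', hP⟩ := h' v'
  refine ⟨t + t', by omega, c', fun ω => ?_, hP⟩
  rw [coinRun_add, hc, hc']

end CoinRun

/-! ### Embedding the code of one machine into another -/

section Lift

variable {K E : Type} {Γ : K → Type} {ΓE : E → Type} {Λ Λ' σ τ : Type}

/-- The alphabets of a family of stacks `K`, extended by stacks `E`. -/
abbrev JoinΓ (Γ : K → Type) (ΓE : E → Type) : K ⊕ E → Type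
  | .inl k => Γ k
  | .inr e => ΓE e

/-- The stacks `S`, together with additional stacks `T`. -/
def joinStk (S : ∀ k, List (Γ k)) (T : ∀ e, List (ΓE e)) :
    ∀ k : K ⊕ E, List (JoinΓ Γ ΓE k)
  | .inl k => S k
  | .inr e => T e

@[simp] theorem joinStk_inl (S : ∀ k, List (Γ k)) (T : ∀ e, List (ΓE e)) (k : K) :
    joinStk S T (.inl k) = S k := rfl

@[simp] theorem joinStk_inr (S : ∀ k, List (Γ k)) (T : ∀ e, List (ΓE e)) (e : E) :
    joinStk S T (.inr e) = T e := rfl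

variable [DecidableEq K] [DecidableEq E]

@[simp] theorem update_joinStk_inl (S : ∀ k, List (Γ k)) (T : ∀ e, List (ΓE e)) (k : K)
    (x : List (Γ k)) :
    Function.update (joinStk S T) (.inl k) x = joinStk (Function.update S k x) T := by
  funext j
  rcases j with j | j
  · by_cases h : j = k
    · subst h; simp
    · rw [Function.update_of_ne (by simpa using h), joinStk_inl, joinStk_inl,
        Function.update_of_ne h]
  · rw [Function.update_of_ne (by simp), joinStk_inr, joinStk_inr]

@[simp] theorem update_joinStk_inr (S : ∀ k, List (Γ k)) (T : ∀ e, List (ΓE e)) (e : E)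
    (x : List (ΓE e)) :
    Function.update (joinStk S T) (.inr e) x = joinStk S (Function.update T e x) := by
  funext j
  rcases j with j | j
  · rw [Function.update_of_ne (by simp), joinStk_inl, joinStk_inl]
  · by_cases h : j = e
    · subst h; simp
    · rw [Function.update_of_ne (by simpa using h), joinStk_inr, joinStk_inr,
        Function.update_of_ne h]

/-- A statement, read as a statement for more stacks, with an additional component `τ` of the
internal state. The labels are renamed by `f`, and instead of halting it goes on with `e`. -/
def liftStmt (f : Λ → Λ') (e : TM2.Stmt (JoinΓ Γ ΓE) Λ' (σ × τ)) :
    TM2.Stmt Γ Λ σ → TM2.Stmt (JoinΓ Γ ΓE) Λ' (σ × τ)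
  | .push k g q => .push (.inl k) (fun v => g v.1) (liftStmt f e q)
  | .peek k g q => .peek (.inl k) (fun v s => (g v.1 s, v.2)) (liftStmt f e q)
  | .pop k g q => .pop (.inl k) (fun v s => (g v.1 s, v.2)) (liftStmt f e q)
  | .load g q => .load (fun v => (g v.1, v.2)) (liftStmt f e q)
  | .branch g q q' => .branch (fun v => g v.1) (liftStmt f e q) (liftStmt f e q')
  | .goto l => .goto fun v => f (l v.1)
  | .halt => e

/-- A lifted statement acts on the stacks and the internal state of the original statement, and
leaves everything else as it is. -/
theorem stepAux_liftStmt (f : Λ → Λ') (e : TM2.Stmt (JoinΓ Γ ΓE) Λ' (σ × τ))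
    (q : TM2.Stmt Γ Λ σ) (v : σ) (t : τ) (S : ∀ k, List (Γ k)) (T : ∀ e, List (ΓE e)) :
    TM2.stepAux (liftStmt f e q) (v, t) (joinStk S T) =
      match TM2.stepAux q v S with
      | ⟨some l, v', S'⟩ => ⟨some (f l), (v', t), joinStk S' T⟩
      | ⟨none, v', S'⟩ => TM2.stepAux e (v', t) (joinStk S' T) := by
  induction q generalizing v S with
  | push k g q ih =>
    simp only [liftStmt, TM2.stepAux, update_joinStk_inl, joinStk_inl]; exact ih _ _
  | peek k g q ih => simp only [liftStmt, TM2.stepAux, joinStk_inl]; exact ih _ _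
  | pop k g q ih =>
    simp only [liftStmt, TM2.stepAux, update_joinStk_inl, joinStk_inl]; exact ih _ _
  | load g q ih => simp only [liftStmt, TM2.stepAux]; exact ih _ _
  | branch g q q' ih ih' =>
    simp only [liftStmt, TM2.stepAux]
    cases g v
    · exact ih' _ _
    · exact ih _ _
  | goto l => rfl
  | halt => rfl

end Lift

/-! ### The exponential preprocessor -/

namespace ProbTM

/-- The additional stacks of the preprocessor: the input, two stacks for a unary number that is
doubled over and over, and a copy of the input. -/
inductive PreStk | inp | cnt | tmp | keep
  deriving DecidableEq

/-- The labels of the preprocessor: `boot` starts the doubled number at one, `read` takes the next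
input letter, `dbl` and `back` double the number, and `fill` prepares the input stack of the main
machine. -/
inductive PreLab | boot | read | dbl | back | fill

instance : Finite PreStk :=
  Finite.of_surjective (fun i : Fin 4 => match i with
    | 0 => PreStk.inp | 1 => .cnt | 2 => .tmp | 3 => .keep)
    fun k => by cases k; exacts [⟨0, rfl⟩, ⟨1, rfl⟩, ⟨2, rfl⟩, ⟨3, rfl⟩]

instance : Finite PreLab :=
  Finite.of_surjective (fun i : Fin 5 => match i with
    | 0 => PreLab.boot | 1 => .read | 2 => .dbl | 3 => .back | 4 => .fill)
    fun k => by cases k; exacts [⟨0, rfl⟩, ⟨1, rfl⟩, ⟨2, rfl⟩, ⟨3, rfl⟩, ⟨4, rfl⟩]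

variable (M : ProbTM)

/-- The statements of the preprocessor. On an input `1^n` it puts `1^(2^n)` on the stack `cnt` and
`1^n` on the stack `keep`. With `clk = false` it then runs `M` on `1^(2^n)`. With `clk = true` it
runs `M` on `1^n` and takes one letter from `cnt` in every step of `M`; it rejects when `cnt` is
empty. It rejects all inputs outside `1^*`. The second component of the internal state is the last
letter that was taken from an additional stack. -/
def preStmt (clk : Bool) (b : Bool) :
    PreLab ⊕ M.Λ → TM2.Stmt (JoinΓ M.Γ fun _ : PreStk => Bool) (PreLab ⊕ M.Λ) (M.σ × Option Bool)
  | .inl .boot => .push (.inr .cnt) (fun _ => true) (.goto fun _ => .inl .read)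
  | .inl .read => .pop (.inr .inp) (fun v s => (v.1, s)) <|
      .branch (fun v => v.2.isNone) (.goto fun _ => .inl .fill) <|
      .branch (fun v => v.2 == some true)
        (.push (.inr .keep) (fun _ => true) (.goto fun _ => .inl .dbl))
        (.load (fun v => (v.1, none)) .halt)
  | .inl .dbl => .pop (.inr .cnt) (fun v s => (v.1, s)) <|
      .branch (fun v => v.2.isNone) (.goto fun _ => .inl .back)
        (.push (.inr .tmp) (fun _ => true) <| .push (.inr .tmp) (fun _ => true) <|
          .goto fun _ => .inl .dbl)
  | .inl .back => .pop (.inr .tmp) (fun v s => (v.1, s)) <|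
      .branch (fun v => v.2.isNone) (.goto fun _ => .inl .read)
        (.push (.inr .cnt) (fun _ => true) (.goto fun _ => .inl .back))
  | .inl .fill => .pop (.inr (cond clk .keep .cnt)) (fun v s => (v.1, s)) <|
      .branch (fun v => v.2.isNone)
        (.load (fun _ => (M.init, some true)) (.goto fun _ => .inr M.main))
        (.push (.inl M.input) (fun _ => M.letter true) (.goto fun _ => .inl .fill))
  | .inr l => cond clk
      (.pop (.inr .cnt) (fun v s => (v.1, s)) <|
        .branch (fun v => v.2.isNone) .halt (liftStmt .inr .halt (M.prog b l)))
      (liftStmt .inr .halt (M.prog b l))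

/-- Rejecting halts of the preprocessor and of the clock leave `none` in the second component. -/
def preAccept (v : M.σ × Option Bool) : Bool := M.accept v.1 && v.2.isSome

/-- The preprocessor, followed by the machine `M`; see `preStmt`. -/
def pre (clk : Bool) : ProbTM where
  K := M.K ⊕ PreStk
  Γ := JoinΓ M.Γ fun _ => Bool
  finΓ := by rintro (k | k) <;> simp only [JoinΓ] <;> infer_instance
  Λ := PreLab ⊕ M.Λ
  σ := M.σ × Option Bool
  input := .inr .inp
  letter := .refl _
  main := .inl .boot
  init := (M.init, none)
  prog := M.preStmt clk
  accept := M.preAccept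

/-- The contents of the additional stacks. -/
def preStk (inp cnt tmp keep : List Bool) : PreStk → List Bool
  | .inp => inp
  | .cnt => cnt
  | .tmp => tmp
  | .keep => keep

section
variable (inp cnt tmp keep x : List Bool)
@[simp] theorem preStk_inp : preStk inp cnt tmp keep .inp = inp := rfl
@[simp] theorem preStk_cnt : preStk inp cnt tmp keep .cnt = cnt := rfl
@[simp] theorem preStk_tmp : preStk inp cnt tmp keep .tmp = tmp := rfl
@[simp] theorem preStk_keep : preStk inp cnt tmp keep .keep = keep := rfl
@[simp] theorem update_preStk_inp :
    Function.update (preStk inp cnt tmp keep) .inp x = preStk x cnt tmp keep := by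
  funext k; cases k <;> rfl
@[simp] theorem update_preStk_cnt :
    Function.update (preStk inp cnt tmp keep) .cnt x = preStk inp x tmp keep := by
  funext k; cases k <;> rfl
@[simp] theorem update_preStk_tmp :
    Function.update (preStk inp cnt tmp keep) .tmp x = preStk inp cnt x keep := by
  funext k; cases k <;> rfl
@[simp] theorem update_preStk_keep :
    Function.update (preStk inp cnt tmp keep) .keep x = preStk inp cnt tmp x := by
  funext k; cases k <;> rfl
end

variable {M} {clk : Bool} {S : ∀ k, List (M.Γ k)}

/-- The first half of doubling: every letter of `cnt` becomes two letters of `tmp`. -/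
theorem pre_dbl (a b : ℕ) (inp keep : List Bool) :
    Leads (M.preStmt clk) (a + 1) (.inl .dbl)
      (joinStk S (preStk inp (List.replicate a true) (List.replicate b true) keep))
      (At (.inl .back)
        (joinStk S (preStk inp [] (List.replicate (b + 2 * a) true) keep))) := by
  induction a generalizing b with
  | zero =>
    refine .head (.refl _ _) fun v => ⟨(v.1, none), fun c => ?_⟩
    simp [preStmt]
  | succ a ih =>
    have := ih (b + 2)
    rw [show b + 2 + 2 * a = b + 2 * (a + 1) by ring] at this
    refine this.head fun v => ⟨(v.1, some true), fun c => ?_⟩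
    simp [preStmt, List.replicate_succ]

/-- The second half of doubling: the letters of `tmp` are moved back to `cnt`. -/
theorem pre_back (a b : ℕ) (inp keep : List Bool) :
    Leads (M.preStmt clk) (b + 1) (.inl .back)
      (joinStk S (preStk inp (List.replicate a true) (List.replicate b true) keep))
      (At (.inl .read)
        (joinStk S (preStk inp (List.replicate (a + b) true) [] keep))) := by
  induction b generalizing a with
  | zero =>
    refine .head (.refl _ _) fun v => ⟨(v.1, none), fun c => ?_⟩
    simp [preStmt]
  | succ b ih =>
    have := ih (a + 1)
    rw [show a + 1 + b = a + (b + 1) by ring] at this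
    refine this.head fun v => ⟨(v.1, some true), fun c => ?_⟩
    simp [preStmt, List.replicate_succ]

theorem pre_read_true (w : List Bool) (a k : ℕ) :
    Leads (M.preStmt clk) (3 * a + 3) (.inl .read)
      (joinStk S (preStk (true :: w) (List.replicate a true) [] (List.replicate k true)))
      (At (.inl .read)
        (joinStk S (preStk w (List.replicate (2 * a) true) [] (List.replicate (k + 1) true)))) := by
  have h := (pre_dbl (M := M) (clk := clk) (S := S) a 0 w (List.replicate (k + 1) true)).trans
    (pre_back 0 _ _ _)
  rw [Nat.zero_add, Nat.zero_add] at h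
  have h' : Leads (M.preStmt clk) (a + 1 + (2 * a + 1) + 1) (.inl .read)
      (joinStk S (preStk (true :: w) (List.replicate a true) [] (List.replicate k true))) _ :=
    h.head fun v => ⟨(v.1, some true), fun c => by simp [preStmt, List.replicate_succ]⟩
  exact h'.mono (by omega)

theorem pre_read_ones (n a k : ℕ) :
    Leads (M.preStmt clk) (3 * a * (2 ^ n - 1) + 3 * n + 1) (.inl .read)
      (joinStk S (preStk (ones n) (List.replicate a true) [] (List.replicate k true)))
      (At (.inl .fill)
        (joinStk S (preStk [] (List.replicate (a * 2 ^ n) true) [] (List.replicate (k + n) true))))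
    := by
  induction n generalizing a k with
  | zero =>
    refine (Leads.head (.refl _ _) fun v => ⟨(v.1, none), fun c => ?_⟩).mono (by omega)
    simp [preStmt, ones]
  | succ n ih =>
    have := (pre_read_true (M := M) (clk := clk) (S := S) (ones n) a k).trans (ih (2 * a) (k + 1))
    have e : a * 2 ^ (n + 1) = 2 * a * 2 ^ n := by ring
    have e' : 2 ^ (n + 1) - 1 = 2 * (2 ^ n - 1) + 1 := by
      have := Nat.one_le_two_pow (n := n)
      omega
    rw [e, show k + (n + 1) = k + 1 + n by ring]
    refine Leads.mono this ?_
    rw [e']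
    apply le_of_eq
    ring

theorem pre_read_reject (w : List Bool) (hw : false ∈ w) (a k : ℕ) :
    Leads (M.preStmt clk) (3 * a * (2 ^ w.length - 1) + 3 * w.length + 1) (.inl .read)
      (joinStk S (preStk w (List.replicate a true) [] (List.replicate k true)))
      (Answers M.preAccept false) := by
  induction w generalizing a k with
  | nil => simp at hw
  | cons x w ih =>
    cases x with
    | false =>
      refine Leads.mono (B := 1) (.halts fun v => ⟨(v.1, none),
        joinStk S (preStk w (List.replicate a true) [] (List.replicate k true)), ?_, fun c => ?_⟩)
        (by omega)
      · simp [preAccept]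
      · simp [preStmt]
    | true =>
      have := (pre_read_true (M := M) (clk := clk) (S := S) w a k).trans
        (ih (by simpa using hw) (2 * a) (k + 1))
      have e' : 2 ^ (w.length + 1) - 1 = 2 * (2 ^ w.length - 1) + 1 := by
        have := Nat.one_le_two_pow (n := w.length)
        omega
      refine Leads.mono this ?_
      rw [List.length_cons, e']
      apply le_of_eq
      ring

theorem eq_ones_or_false_mem (w : List Bool) : w = ones w.length ∨ false ∈ w := by
  by_cases h : false ∈ w
  · exact .inr h
  · refine .inl (List.eq_replicate_of_mem fun b hb => ?_)
    cases b
    · exact absurd hb h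
    · rfl

/-- The initial configuration of the preprocessor. -/
def preStart (M : ProbTM) (w : List Bool) :
    TM2.Cfg (JoinΓ M.Γ fun _ : PreStk => Bool) (PreLab ⊕ M.Λ) (M.σ × Option Bool) :=
  ⟨some (.inl .boot), (M.init, none), joinStk (fun _ => []) (preStk w [] [] [])⟩

theorem pre_start (w : List Bool) : (M.pre clk).start w = M.preStart w := by
  have : Function.update (joinStk (fun _ : M.K => []) (preStk [] [] [] [])) (.inr .inp) w =
      joinStk (Γ := M.Γ) (fun _ => []) (preStk w [] [] []) := by simp
  unfold preStart
  rw [← this]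
  unfold start
  congr 1
  have e : joinStk (Γ := M.Γ) (fun _ : M.K => []) (preStk [] [] [] []) = fun _ => [] := by
    funext k
    rcases k with k | k
    · rfl
    · cases k <;> rfl
  rw [e]
  exact congrArg (Function.update (fun _ => []) _) (List.map_id w)

/-- The stacks with which `M` is started after the preprocessing of `1^n`. -/
def preDone (M : ProbTM) (clk : Bool) (n : ℕ) : ∀ k, List (JoinΓ M.Γ (fun _ : PreStk => Bool) k) :=
  joinStk (Function.update (fun _ => []) M.input
    ((ones (cond clk n (2 ^ n))).map M.letter))
    (preStk [] (cond clk (ones (2 ^ n)) []) [] (cond clk [] (ones n)))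

/-- The last phase of the preprocessor moves the prepared input to the input stack of `M`. -/
theorem pre_fill (n j : ℕ) (T T' : PreStk → List Bool)
    (hT : T (cond clk .keep .cnt) = List.replicate n true)
    (hT' : T' = Function.update T (cond clk .keep .cnt) []) (v : M.σ × Option Bool) :
    ∃ t ≤ n + 1, ∀ ω, coinRun (M.preStmt clk) ⟨some (.inl .fill), v, joinStk
        (Function.update (fun _ => []) M.input (List.replicate j (M.letter true))) T⟩ ω t =
      ⟨some (.inr M.main), (M.init, some true), joinStk
        (Function.update (fun _ => []) M.input (List.replicate (j + n) (M.letter true))) T'⟩ := by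
  induction n generalizing j T v with
  | zero =>
    refine ⟨1, le_rfl, fun ω => ?_⟩
    rw [coinRun_succ', coinStep_some]
    simp [preStmt, coinRun, hT, hT']
  | succ n ih =>
    obtain ⟨t, ht, h⟩ := ih (j + 1)
      (Function.update T (cond clk .keep .cnt) (List.replicate n true)) (by simp)
      (by simpa using hT') (v.1, some true)
    refine ⟨t + 1, by omega, fun ω => ?_⟩
    rw [coinRun_succ', coinStep_some]
    rw [← show j + 1 + n = j + (n + 1) by ring, ← h fun i => ω (i + 1)]
    congr 1
    simp [preStmt, hT, List.replicate_succ]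

/-- The preprocessor needs time `O(2^n)` on an input `1^n`. -/
theorem pre_ones (n : ℕ) : ∃ t ≤ 10 * 2 ^ n, ∀ ω,
    coinRun (M.preStmt clk) (M.preStart (ones n)) ω t =
      ⟨some (.inr M.main), (M.init, some true), preDone M clk n⟩ := by
  have h1 : Leads (M.preStmt clk) (3 * 2 ^ n + 3 * n + 2) (.inl .boot)
      (joinStk (fun _ => []) (preStk (ones n) [] [] []))
      (At (.inl .fill) (joinStk (fun _ => []) (preStk [] (List.replicate (1 * 2 ^ n) true) []
        (List.replicate (0 + n) true)))) := by
    refine ((pre_read_ones (S := fun _ => []) n 1 0).head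
      fun v => ⟨v, fun c => by simp [preStmt]⟩).mono ?_
    have := Nat.one_le_two_pow (n := n)
    omega
  obtain ⟨t, ht, c, hc, hl, hS⟩ := h1 (M.init, none)
  obtain ⟨l, v, S⟩ := c
  obtain rfl : l = some _ := hl
  obtain rfl : S = _ := hS
  have e : (fun _ => [] : ∀ k, List (M.Γ k)) =
      Function.update (fun _ => []) M.input (List.replicate 0 (M.letter true)) := by simp
  have hn : n < 2 ^ n := Nat.lt_two_pow_self
  obtain ⟨t', ht', h'⟩ := pre_fill (M := M) (clk := clk) (cond clk n (2 ^ n)) 0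
    (preStk [] (List.replicate (1 * 2 ^ n) true) [] (List.replicate (0 + n) true))
    (preStk [] (cond clk (ones (2 ^ n)) []) [] (cond clk [] (ones n)))
    (by cases clk <;> simp) (by cases clk <;> simp [ones]) v
  refine ⟨t + t', ?_, fun ω => ?_⟩
  · have : cond clk n (2 ^ n) ≤ 2 ^ n := by cases clk <;> simp [hn.le]
    omega
  · rw [preStart, coinRun_add, hc, e, h']
    simp [preDone, ones]

/-- The preprocessor rejects all inputs that are not in `1^*`, in exponential time. -/
theorem pre_reject (w : List Bool) (hw : false ∈ w) : ∃ t ≤ 10 * 2 ^ w.length, ∃ c, (∀ ω,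
    coinRun (M.preStmt clk) (M.preStart w) ω t = c) ∧ Answers M.preAccept false c := by
  have h1 : Leads (M.preStmt clk) (3 * 2 ^ w.length + 3 * w.length + 2) (.inl .boot)
      (joinStk (fun _ => []) (preStk w [] [] [])) (Answers M.preAccept false) := by
    refine ((pre_read_reject (S := fun _ => []) w hw 1 0).head
      fun v => ⟨v, fun c => by simp [preStmt]⟩).mono ?_
    have := Nat.one_le_two_pow (n := w.length)
    omega
  have hn : w.length < 2 ^ w.length := Nat.lt_two_pow_self
  exact h1.mono (by omega) _

end ProbTM

/-! ### Expected running times -/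

namespace ProbTM

instance : IsProbabilityMeasure coins := by unfold coins; infer_instance

/-- Forgetting the first `k` coins does not change the law of the coins. -/
theorem measurePreserving_shift (k : ℕ) :
    MeasurePreserving (fun (ω : ℕ → Bool) i => ω (k + i)) coins coins := by
  have hm : Measurable fun (ω : ℕ → Bool) i => ω (k + i) := by fun_prop
  refine ⟨hm, ?_⟩
  unfold coins
  refine Measure.eq_infinitePi _ fun s t ht => ?_
  rw [Measure.map_apply hm (.pi s.countable_toSet fun i hi => ht i)]
  classical
  have : (fun (ω : ℕ → Bool) i => ω (k + i)) ⁻¹' (Set.pi s t) =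
      Set.pi (s.map (addLeftEmbedding k)) fun i => t (i - k) := by
    ext ω
    simp [Set.mem_pi]
  rw [this, Measure.infinitePi_pi _ fun i hi => ht _]
  simp

variable (M : ProbTM) (w : List Bool)

theorem measurableSet_haltedAt (t : ℕ) : MeasurableSet {ω | M.HaltedAt w ω t} := by
  let π : (ℕ → Bool) → Fin t → Bool := fun ω i => ω i
  have hπ : Measurable π := by fun_prop
  have : {ω | M.HaltedAt w ω t} =
      π ⁻¹' {f | M.HaltedAt w (fun i => if h : i < t then f ⟨i, h⟩ else false) t} := by
    ext ω
    simp only [HaltedAt, Set.mem_ofPred_eq, Set.mem_preimage, run_eq_coinRun]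
    rw [coinRun_congr (ω' := fun i => if h : i < t then π ω ⟨i, h⟩ else false)]
    intro i hi
    simp [π, hi]
  rw [this]
  exact hπ (Set.toFinite _).measurableSet

theorem measurable_time : Measurable (M.time w) := by
  unfold time
  refine .iInf fun t => ?_
  classical
  simp only [iInf_eq_if]
  exact .ite (M.measurableSet_haltedAt w t) measurable_const measurable_const

variable {M w}

theorem time_le {ω : ℕ → Bool} {t : ℕ} (h : M.HaltedAt w ω t) : M.time w ω ≤ t :=
  iInf₂_le t h

/-- Some coins achieve a running time that is not above the expected running time. -/
theorem exists_haltedAt {τ : ℕ} (h : M.expectedTime w ≤ τ) : ∃ ω, ∃ t ≤ τ, M.HaltedAt w ω t := by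
  by_contra! hc
  have h1 : ∀ ω, (τ + 1 : ℝ≥0∞) ≤ M.time w ω := fun ω => by
    refine le_iInf₂ fun t ht => ?_
    by_contra! hlt
    exact hc ω t (by have : t < τ + 1 := by exact_mod_cast hlt
                     omega) ht
  have h2 : (τ + 1 : ℝ≥0∞) ≤ τ := by
    calc (τ + 1 : ℝ≥0∞) = ∫⁻ _, (τ + 1 : ℝ≥0∞) ∂coins := by simp
      _ ≤ M.expectedTime w := lintegral_mono h1
      _ ≤ τ := h
  exact absurd h2 (by exact_mod_cast Nat.not_succ_le_self τ)

theorem expectedTime_le_of_haltedAt {t : ℕ} (h : ∀ ω, M.HaltedAt w ω t) :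
    M.expectedTime w ≤ t := by
  calc M.expectedTime w ≤ ∫⁻ _, (t : ℝ≥0∞) ∂coins := lintegral_mono fun ω => time_le (h ω)
    _ = t := by simp

/-- If `N` on `u` halts as soon as `M` on `w` does when it is started `k` steps later with the coins
that are left, then it loses at most `k` steps of expected time. -/
theorem expectedTime_le_add {N : ProbTM} {u : List Bool} {k : ℕ}
    (h : ∀ ω t, M.HaltedAt w (fun i => ω (k + i)) t → N.HaltedAt u ω (k + t)) :
    N.expectedTime u ≤ k + M.expectedTime w := by
  have h1 : ∀ ω, N.time u ω ≤ k + M.time w (fun i => ω (k + i)) := fun ω => by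
    unfold time
    simp only [ENNReal.add_iInf]
    refine le_iInf₂ fun t ht => ?_
    exact_mod_cast time_le (h ω t ht)
  calc N.expectedTime u ≤ ∫⁻ ω, (k + M.time w (fun i => ω (k + i))) ∂coins := lintegral_mono h1
    _ = k + ∫⁻ ω, M.time w (fun i => ω (k + i)) ∂coins := by
      rw [lintegral_add_left measurable_const]; simp
    _ = k + M.expectedTime w := by
      rw [(measurePreserving_shift k).lintegral_comp (M.measurable_time w)]; rfl

theorem run_eq_of_haltedAt {ω : ℕ → Bool} {s t : ℕ} (hs : M.HaltedAt w ω s)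
    (ht : M.HaltedAt w ω t) : M.run w ω s = M.run w ω t := by
  simp only [HaltedAt, run_eq_coinRun] at *
  rcases le_total s t with h | h
  · exact (coinRun_stable _ h hs).symm
  · exact coinRun_stable _ h ht

theorem run_eq_of_le {ω : ℕ → Bool} {s t : ℕ} (h : s ≤ t) (hs : M.HaltedAt w ω s) :
    M.run w ω t = M.run w ω s := by
  simp only [HaltedAt, run_eq_coinRun] at *
  exact coinRun_stable _ h hs

/-! ### Unpadding and clocks -/

theorem ones_injective : Function.Injective ones := fun m n h => by
  simpa [ones] using congrArg List.length h

@[simp] theorem length_ones (n : ℕ) : (ones n).length = n := by simp [ones]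

/-- The configuration of the preprocessor while it runs `M`. -/
def preCfg (c : M.Cfg) (T : PreStk → List Bool) :
    TM2.Cfg (JoinΓ M.Γ fun _ : PreStk => Bool) (PreLab ⊕ M.Λ) (M.σ × Option Bool) :=
  ⟨c.l.map .inr, (c.var, some true), joinStk c.stk T⟩

theorem coinRun_preCfg (c : M.Cfg) (T : PreStk → List Bool) (ω : ℕ → Bool) (t : ℕ) :
    coinRun (M.preStmt false) (preCfg c T) ω t = preCfg (coinRun M.prog c ω t) T := by
  induction t with
  | zero => rfl
  | succ t ih =>
    simp only [coinRun, ih]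
    obtain ⟨_ | l, v, S⟩ := coinRun M.prog c ω t
    · rfl
    · simp only [preCfg, Option.map_some, coinStep_some, preStmt, cond_false, stepAux_liftStmt]
      rcases TM2.stepAux (M.prog (ω t) l) v S with ⟨_ | l', v', S'⟩ <;> rfl

/-- On the input `1^n` the preprocessor without clock behaves, after a preparation that does not
depend on the coins, like `M` on the input `1^(2^n)`. -/
theorem pre_run_ones (n : ℕ) : ∃ k ≤ 10 * 2 ^ n, ∀ ω t,
    ((M.pre false).HaltedAt (ones n) ω (k + t) ↔
      M.HaltedAt (ones (2 ^ n)) (fun i => ω (k + i)) t) ∧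
    (M.pre false).accept ((M.pre false).run (ones n) ω (k + t)).var =
      M.accept (M.run (ones (2 ^ n)) (fun i => ω (k + i)) t).var := by
  obtain ⟨k, hk, h⟩ := pre_ones (M := M) (clk := false) n
  refine ⟨k, hk, fun ω t => ?_⟩
  have : (M.pre false).run (ones n) ω (k + t) =
      preCfg (M.run (ones (2 ^ n)) (fun i => ω (k + i)) t) (preStk [] [] [] (ones n)) := by
    rw [run_eq_coinRun, run_eq_coinRun, ← coinRun_preCfg, pre_start]
    exact (coinRun_add (M.preStmt false) _ _ _ _).trans (by rw [h]; rfl)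
  unfold HaltedAt
  rw [this]
  exact ⟨Option.map_eq_none_iff, Bool.and_true _⟩

theorem pre_run_reject {clk : Bool} {w : List Bool} (hw : false ∈ w) : ∃ k ≤ 10 * 2 ^ w.length,
    ∀ ω, (M.pre clk).HaltedAt w ω k ∧ (M.pre clk).accept ((M.pre clk).run w ω k).var = false := by
  obtain ⟨k, hk, c, h, hc⟩ := pre_reject (M := M) (clk := clk) w hw
  refine ⟨k, hk, fun ω => ?_⟩
  unfold HaltedAt
  rw [run_eq_coinRun, pre_start]
  rw [show coinRun (M.pre clk).prog (M.preStart w) ω k = c from h ω]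
  exact hc

theorem false_notMem_ones (n : ℕ) : false ∉ ones n := by simp [ones]

/-- A language in `ZPP` can be decided in linear exponential time after unpadding. -/
theorem unpad_mem_ZTIMEExpLinear {L : Language Bool} (hL : L ∈ ZPP) :
    ({w | ∃ n, w = ones n ∧ ones (2 ^ n) ∈ L} : Language Bool) ∈ ZTIMEExpLinear := by
  simp only [ZPP, Set.mem_iUnion] at hL
  obtain ⟨c, hc, M, τ, hM, hτ, hO⟩ := hL
  refine Set.mem_iUnion₂.2 ⟨c, hc, M.pre false, fun n => 10 * 2 ^ n + τ (2 ^ n), ?_, ?_, ?_⟩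
  · intro w ω t ht
    rcases eq_ones_or_false_mem w with hw | hw
    · set n := w.length
      obtain ⟨k, -, hk⟩ := pre_run_ones (M := M) n
      have h1 := run_eq_of_le (Nat.le_add_left t k) ht
      rw [← h1]
      have h2 : (M.pre false).HaltedAt w ω (k + t) := by
        unfold HaltedAt; rw [h1]; exact ht
      rw [hw] at h2 ⊢
      rw [(hk ω t).2, hM _ _ _ ((hk ω t).1.1 h2)]
      exact ⟨fun h => ⟨n, rfl, h⟩, fun ⟨m, hm, h⟩ => by rwa [ones_injective hm]⟩
    · obtain ⟨k, -, hk⟩ := pre_run_reject (M := M) (clk := false) hw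
      rw [run_eq_of_haltedAt ht (hk ω).1, (hk ω).2]
      simp only [Bool.false_eq_true, false_iff]
      rintro ⟨n, rfl, -⟩
      exact false_notMem_ones n hw
  · intro w
    rcases eq_ones_or_false_mem w with hw | hw
    · set n := w.length
      obtain ⟨k, hk, h⟩ := pre_run_ones (M := M) n
      have h1 : (M.pre false).expectedTime w ≤ k + M.expectedTime (ones (2 ^ n)) := by
        refine expectedTime_le_add fun ω t ht => ?_
        rw [hw]
        exact (h ω t).1.2 ht
      have h2 := hτ (ones (2 ^ n))
      rw [length_ones] at h2
      refine h1.trans ?_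
      push_cast
      gcongr
      exact_mod_cast hk
    · obtain ⟨k, hk, h⟩ := pre_run_reject (M := M) (clk := false) hw
      refine (expectedTime_le_of_haltedAt fun ω => (h ω).1).trans ?_
      exact_mod_cast hk.trans (Nat.le_add_right _ _)
  · have h1 : (fun n : ℕ => (τ (2 ^ n) : ℝ)) =O[Filter.atTop] fun n => ((2 ^ (c * n) : ℕ) : ℝ) := by
      have := hO.comp_tendsto (tendsto_pow_atTop_atTop_of_one_lt one_lt_two)
      refine this.congr (fun _ => rfl) fun n => ?_
      simp only [Function.comp]
      push_cast
      rw [← pow_mul, mul_comm]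
    have h2 : (fun n : ℕ => (10 * 2 ^ n : ℝ)) =O[Filter.atTop]
        fun n => ((2 ^ (c * n) : ℕ) : ℝ) := by
      refine .of_bound 10 (.of_forall fun n => ?_)
      rw [Real.norm_of_nonneg (by positivity), Real.norm_of_nonneg (by positivity)]
      push_cast
      gcongr
      · norm_num
      · exact Nat.le_mul_of_pos_left n hc
    refine (h2.add h1).congr (fun n => ?_) fun _ => rfl
    push_cast
    ring

/-- The clocked run: with `k` letters in its clock the preprocessor halts within `k + 1` steps, and
it accepts if and only if `M` does so within `k` steps. -/
theorem pre_clock (hM : ∀ b, M.prog b = M.prog false) (k : ℕ) (T : PreStk → List Bool)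
    (hT : T .cnt = List.replicate k true) (l : M.Λ) (v : M.σ) (x : Option Bool)
    (S : ∀ k, List (M.Γ k)) :
    ∃ t ≤ k + 1, ∃ c', (∀ ω, coinRun (M.preStmt true) ⟨some (.inr l), (v, x), joinStk S T⟩ ω t = c')
      ∧ c'.l = none ∧ (M.preAccept c'.var = true ↔
        ∃ s ≤ k, Answers M.accept true (coinRun M.prog ⟨some l, v, S⟩ (fun _ => false) s)) := by
  induction k generalizing T l v x S with
  | zero =>
    refine ⟨1, le_rfl, ⟨none, (v, none), joinStk S T⟩, fun ω => ?_, rfl, ?_⟩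
    · have : Function.update T .cnt [] = T := by
        rw [Function.update_eq_self_iff]; simpa using hT.symm
      rw [coinRun_succ', coinStep_some]
      simp [coinRun, preStmt, hT, this]
    · simp [preAccept, Answers, coinRun]
  | succ k ih =>
    have hstep : ∀ b, TM2.stepAux (M.preStmt true b (.inr l)) (v, x) (joinStk S T) =
        TM2.stepAux (liftStmt .inr .halt (M.prog false l)) (v, some true)
          (joinStk S (Function.update T .cnt (List.replicate k true))) := fun b => by
      simp [preStmt, hT, List.replicate_succ, hM b]
    have hrun : ∀ s, coinRun M.prog ⟨some l, v, S⟩ (fun _ => false) (s + 1) =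
        coinRun M.prog (TM2.stepAux (M.prog false l) v S) (fun _ => false) s := fun s => by
      rw [coinRun_succ', coinStep_some]
    have hex : (∃ s ≤ k + 1, Answers M.accept true
          (coinRun M.prog ⟨some l, v, S⟩ (fun _ => false) s)) ↔
        ∃ s ≤ k, Answers M.accept true
          (coinRun M.prog (TM2.stepAux (M.prog false l) v S) (fun _ => false) s) := by
      constructor
      · rintro ⟨_ | s, hs, h⟩
        · simp [Answers, coinRun] at h
        · exact ⟨s, by omega, by rwa [hrun] at h⟩
      · rintro ⟨s, hs, h⟩
        exact ⟨s + 1, by omega, by rwa [hrun]⟩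
    rw [hex]
    have key := stepAux_liftStmt (E := PreStk) (ΓE := fun _ => Bool) (Λ' := PreLab ⊕ M.Λ) .inr .halt
      (M.prog false l) v (some true) S (Function.update T .cnt (List.replicate k true))
    rcases hc : TM2.stepAux (M.prog false l) v S with ⟨_ | l', v', S'⟩
    · rw [hc] at key
      refine ⟨1, by omega, ⟨none, (v', some true),
        joinStk S' (Function.update T .cnt (List.replicate k true))⟩, fun ω => ?_, rfl, ?_⟩
      · rw [coinRun_succ', coinStep_some, hstep, key]; rfl
      · have : ∀ s, coinRun M.prog ⟨none, v', S'⟩ (fun _ => false) s = ⟨none, v', S'⟩ :=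
          fun s => coinRun_of_halted _ rfl _ _
        simp only [this, Answers, preAccept]
        simp only [Option.isSome_some, Bool.and_true, true_and]
        exact ⟨fun h => ⟨0, Nat.zero_le _, h⟩, fun ⟨_, _, h⟩ => h⟩
    · rw [hc] at key
      obtain ⟨t, ht, c', hc', h1, h2⟩ := ih (Function.update T .cnt (List.replicate k true))
        (by simp) l' v' (some true) S'
      refine ⟨t + 1, by omega, c', fun ω => ?_, h1, h2⟩
      rw [coinRun_succ', coinStep_some, hstep, key]
      exact hc' _

/-- The inputs `1^n` that a machine accepts within `2^n` steps, if it ignores its coins, form a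
language in linear exponential time. -/
theorem clocked_mem_ZTIMEExpLinear (hM : ∀ b, M.prog b = M.prog false) :
    ({w | ∃ n, w = ones n ∧ ∃ t ≤ 2 ^ n, Answers M.accept true (M.run w (fun _ => false) t)} :
      Language Bool) ∈ ZTIMEExpLinear := by
  have key : ∀ w : List Bool, ∃ t ≤ 12 * 2 ^ w.length, ∀ ω, (M.pre true).HaltedAt w ω t ∧
      ((M.pre true).accept ((M.pre true).run w ω t).var = true ↔ ∃ n, w = ones n ∧
        ∃ t ≤ 2 ^ n, Answers M.accept true (M.run w (fun _ => false) t)) := fun w => by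
    rcases eq_ones_or_false_mem w with hw | hw
    · set n := w.length
      obtain ⟨k, hk, h⟩ := pre_ones (M := M) (clk := true) n
      obtain ⟨t, ht, c', hc', h1, h2⟩ := pre_clock hM (2 ^ n) (preStk [] (ones (2 ^ n)) [] [])
        rfl M.main M.init (some true)
        (Function.update (fun _ => []) M.input ((ones n).map M.letter))
      have h3 : ∀ ω, (M.pre true).run w ω (k + t) = c' := fun ω => by
        rw [run_eq_coinRun, pre_start, hw]
        exact (coinRun_add (M.preStmt true) _ _ _ _).trans (by rw [h]; exact hc' _)
      refine ⟨k + t, ?_, fun ω => ⟨?_, ?_⟩⟩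
      · have := Nat.one_le_two_pow (n := n)
        omega
      · unfold HaltedAt; rw [h3]; exact h1
      · rw [h3]
        refine h2.trans ?_
        constructor
        · rintro ⟨s, hs, h⟩
          refine ⟨n, hw, s, hs, ?_⟩
          rw [run_eq_coinRun, hw]; exact h
        · rintro ⟨m, hm, s, hs, h⟩
          obtain rfl : n = m := ones_injective (hw.symm.trans hm)
          refine ⟨s, hs, ?_⟩
          rw [run_eq_coinRun, hw] at h; exact h
    · obtain ⟨k, hk, h⟩ := pre_run_reject (M := M) (clk := true) hw
      refine ⟨k, by omega, fun ω => ⟨(h ω).1, ?_⟩⟩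
      rw [(h ω).2]
      simp only [Bool.false_eq_true, false_iff]
      rintro ⟨n, rfl, -⟩
      exact false_notMem_ones n hw
  refine Set.mem_iUnion₂.2 ⟨1, le_rfl, M.pre true, fun n => 12 * 2 ^ n, ?_, ?_, ?_⟩
  · intro w ω t ht
    obtain ⟨s, -, hs⟩ := key w
    rw [run_eq_of_haltedAt ht (hs ω).1]
    exact (hs ω).2
  · intro w
    obtain ⟨s, hs', hs⟩ := key w
    refine (expectedTime_le_of_haltedAt fun ω => (hs ω).1).trans ?_
    exact_mod_cast hs'
  · refine .of_bound 12 (.of_forall fun n => ?_)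
    rw [Real.norm_of_nonneg (by positivity), Real.norm_of_nonneg (by positivity)]
    simp

end ProbTM

/-! ### Computable functions as subroutines -/

section Subroutine

open ToPartrec PartrecToTM2

/-- A finite list of computable functions has a code that computes the list of their values. -/
theorem exists_code_list {k : ℕ} (Fs : List (List.Vector ℕ k → ℕ))
    (h : ∀ F ∈ Fs, Computable F) :
    ∃ c : Code, ∀ v : List.Vector ℕ k, c.eval v.1 = pure (Fs.map fun F => F v) := by
  induction Fs with
  | nil => exact ⟨Code.nil, fun v => by simp⟩
  | cons F Fs ih =>
    obtain ⟨c, hc⟩ := ih fun G hG => h G (List.mem_cons_of_mem _ hG)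
    obtain ⟨d, hd⟩ := Code.exists_code
      (Nat.Partrec'.part_iff.2 (show Partrec (F : List.Vector ℕ k →. ℕ) from
        h F List.mem_cons_self))
    refine ⟨Code.cons d c, fun v => ?_⟩
    simp only [Code.cons_eval, hc, hd]
    simp

/-- A list of computable functions of three arguments has a code that computes the list of their
values. -/
theorem exists_code₃ (Fs : List (ℕ → ℕ → ℕ → ℕ))
    (h : ∀ F ∈ Fs, Computable fun x : ℕ × ℕ × ℕ => F x.1 x.2.1 x.2.2) :
    ∃ c : Code, ∀ x y z, c.eval [x, y, z] = pure (Fs.map fun F => F x y z) := by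
  obtain ⟨c, hc⟩ := exists_code_list (k := 3)
    (Fs.map fun F v => F (v.get 0) (v.get 1) (v.get 2)) (by
      intro F hF
      obtain ⟨G, hG, rfl⟩ := List.mem_map.1 hF
      have e (i : Fin 3) : Computable fun v : List.Vector ℕ 3 => v.get i :=
        Computable.vector_get.comp .id (.const i)
      exact (h G hG).comp ((e 0).pair ((e 1).pair (e 2))))
  refine ⟨c, fun x y z => ?_⟩
  have := hc ⟨[x, y, z], rfl⟩
  rw [List.map_map] at this
  exact this

/-- The configurations of the machine that evaluates codes. -/
abbrev CodeCfg := TM2.Cfg (fun _ : K' => Γ') Λ' (Option Γ')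

/-- One step of the machine that evaluates codes. -/
def codeStep (c : CodeCfg) : CodeCfg := (TM2.step tr c).getD c

/-- The initial configuration for the evaluation of a code. -/
def codeInit (c : Code) (v : List ℕ) : CodeCfg :=
  ⟨some (trNormal c Cont'.halt), none, K'.elim (trList v) [] [] []⟩

/-- The final configuration of an evaluation. -/
def codeHalt (v : List ℕ) : CodeCfg := ⟨none, none, K'.elim (trList v) [] [] []⟩

/-- The evaluation of `c` on `v` takes `T` steps and yields `w`. -/
def EvalsIn (c : Code) (v w : List ℕ) (T : ℕ) : Prop :=
  codeStep^[T] (codeInit c v) = codeHalt w ∧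
    ∀ i < T, ∃ l ∈ codeSupp c Cont'.halt, (codeStep^[i] (codeInit c v)).l = some l

/-- The evaluation of a code takes some finite time, during which the machine stays inside the
finite set of labels that belongs to the code. -/
theorem exists_evalsIn {c : Code} {v w : List ℕ} (h : c.eval v = pure w) :
    ∃ T, EvalsIn c v w T := by
  have hmem : codeHalt w ∈ StateTransition.eval (TM2.step tr) (codeInit c v) := by
    have := tr_eval c v
    rw [h] at this
    change codeHalt w ∈ StateTransition.eval (TM2.step tr) (PartrecToTM2.init c v)
    rw [this]
    exact (Part.mem_map_iff _).2 ⟨w, Part.mem_some _, rfl⟩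
  obtain ⟨hr, -⟩ := StateTransition.mem_eval.1 hmem
  have hs := @tr_supports c Cont'.halt
  have hl : (codeInit c v).l ∈ Finset.insertNone (codeSupp c Cont'.halt) :=
    Finset.some_mem_insertNone.2 hs.1
  unfold EvalsIn
  generalize codeInit c v = a at hr hl
  induction hr using Relation.ReflTransGen.head_induction_on with
  | refl => exact ⟨0, rfl, fun i hi => absurd hi (Nat.not_lt_zero i)⟩
  | @head a b hab _ ih =>
    have hb := @TM2.step_supports _ _ _ _ ⟨trNormal c Cont'.halt⟩ _ tr _ hs _ _ hab hl
    obtain ⟨T, hT, hT'⟩ := ih hb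
    have hab' : codeStep a = b := by
      rw [codeStep, show TM2.step tr a = some b from hab]; rfl
    refine ⟨T + 1, by rw [Function.iterate_succ_apply, hab', hT], fun i hi => ?_⟩
    rcases i with _ | i
    · rcases a with ⟨_ | l, va, Sa⟩
      · cases hab
      · exact ⟨l, Finset.some_mem_insertNone.1 hl, rfl⟩
    · rw [Function.iterate_succ_apply, hab']
      exact hT' i (by omega)

end Subroutine

/-! ### The diagonalizing machine -/

section Diag

open ToPartrec PartrecToTM2

/-- The stacks of the diagonalizing machine besides those of the evaluation of codes: `x`, `y`, `z`
for the iterated logarithm of the input length, whose number of iterations is counted on `s`; `n`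
and `n2` for the logarithm of the input length; `st` for the two stacks of the simulated table
machine; `coin` and `used` for the coins that are left and the coins that have been used. -/
inductive OwnStk | x | y | z | s | n | n2 | st (b : Bool) | used | coin
  deriving DecidableEq, Fintype

/-- The labels of the diagonalizing machine outside its subroutines. -/
inductive OwnLab
  | start (f : Bool) | half (f : Bool) | half' (f : Bool) | odd (f : Bool) | refill (f : Bool)
  | log (f : Bool) | beep | flag | drop | clear (b : Bool) | copy | uncopy | inc | inc0 | inner
  | fin | ans | op | side (b : Bool) | mv (b : Bool) | pp (b : Bool)
  deriving Fintype

/-- The subroutines of the diagonalizing machine: `nxt` is the step of the process that produces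
the valid lengths, `ctl` the control of the simulated machine, `rst` resets the simulation. -/
inductive Site | nxt | ctl | rst

instance : Finite Site :=
  Finite.of_surjective (fun i : Fin 3 => match i with
    | 0 => Site.nxt | 1 => .ctl | 2 => .rst)
    fun k => by cases k; exacts [⟨0, rfl⟩, ⟨1, rfl⟩, ⟨2, rfl⟩]

variable (code : Site → Code)

/-- The labels of the diagonalizing machine. -/
abbrev DiagLab := OwnLab ⊕ Σ s : Site, {l // l ∈ codeSupp (code s) Cont'.halt}

/-- The alphabets of the diagonalizing machine. -/
abbrev DiagΓ := JoinΓ (fun _ : K' => Γ') fun _ : OwnStk => Γ'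

/-- The statements of the diagonalizing machine. The first component of the internal state is the
letter that was read last. -/
abbrev DiagStmt := TM2.Stmt DiagΓ (DiagLab code) (Option Γ' × Bool)

/-- The label of a subroutine. -/
def subLab (s : Site) (l : Λ') : DiagLab code :=
  if h : l ∈ codeSupp (code s) Cont'.halt then .inr ⟨s, l, h⟩ else .inl (.start true)

/-- The label at which the machine goes on after a subroutine. -/
def retLab : Site → OwnLab
  | .nxt => .beep
  | .ctl => .fin
  | .rst => .clear true

namespace DiagCmd

variable {code}

/-- Go on at one of the own labels. -/
def go (l : OwnLab) : DiagStmt code := .goto fun _ => .inl l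

/-- Halt with the given answer. -/
def answer (b : Bool) : DiagStmt code := .load (fun _ => (none, b)) .halt

/-- Take a letter from a stack. -/
def pop (k : K' ⊕ OwnStk) (q : DiagStmt code) : DiagStmt code :=
  match k with
  | .inl k => TM2.Stmt.pop (.inl k) (fun v a => (a, v.2)) q
  | .inr k => TM2.Stmt.pop (.inr k) (fun v a => (a, v.2)) q

/-- Put a letter on a stack. -/
def push (k : K' ⊕ OwnStk) (a : Γ') (q : DiagStmt code) : DiagStmt code :=
  match k with
  | .inl k => TM2.Stmt.push (.inl k) (fun _ => a) q
  | .inr k => TM2.Stmt.push (.inr k) (fun _ => a) q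

/-- Put the letter that was read last on a stack. -/
def put (k : K' ⊕ OwnStk) (q : DiagStmt code) : DiagStmt code :=
  match k with
  | .inl k => TM2.Stmt.push (.inl k) (fun v => v.1.getD .cons) q
  | .inr k => TM2.Stmt.push (.inr k) (fun v => v.1.getD .cons) q

/-- Branch on the letter that was read last. -/
def ifRead (a : Option Γ') (q q' : DiagStmt code) : DiagStmt code :=
  .branch (fun v => v.1 == a) q q'

/-- Call a subroutine. -/
def call (s : Site) : DiagStmt code :=
  .load (fun v => (none, v.2)) <| .goto fun _ => subLab code s (trNormal (code s) Cont'.halt)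

end DiagCmd

open DiagCmd

/-- The program of the diagonalizing machine. -/
def diagStmt : DiagLab code → DiagStmt code
  -- replace the number on `x` by its logarithm, until it is zero; reject if there is none
  | .inl (.start f) => .peek (.inr .x) (fun v a => (a, v.2)) <| ifRead none
      (push (.inl .main) .cons <| push (.inl .main) .cons <| push (.inl .main) .cons <| go .beep)
      (go (.half f))
  | .inl (.half f) => pop (.inr .x) <| ifRead none
      (push (.inr .y) .bit1 <| go (.refill f)) (go (.half' f))
  | .inl (.half' f) => pop (.inr .x) <| ifRead none
      (go (.odd f)) (push (.inr .z) .bit1 <| go (.half f))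
  | .inl (.odd f) => .peek (.inr .z) (fun v a => (a, v.2)) <| ifRead none
      (push (.inr .s) .bit1 <| go (.log f)) (answer false)
  | .inl (.refill f) => pop (.inr .z) <| ifRead none
      (go (.half f)) (push (.inr .x) .bit1 <| go (.refill f))
  | .inl (.log f) => pop (.inr .y) <| ifRead none (go (.start false)) <|
      push (.inr .x) .bit1 <| cond f (push (.inr .n) .bit1 <| go (.log f)) (go (.log f))
  -- run the process that produces the valid lengths, for as many steps as there are letters on `s`
  | .inl .beep => .pop (.inr .s) (fun v a => (v.1, a.isSome)) <|
      .branch (fun v => v.2) (call .nxt) (go .flag)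
  | .inr ⟨.nxt, l⟩ => .pop (.inr .s) (fun v a => (v.1, a.isSome)) <|
      .branch (fun v => v.2) (liftStmt (subLab code .nxt) (go .beep) (tr l)) (answer false)
  | .inl .flag => pop (.inl .main) <| ifRead (some .cons) (answer false)
      (pop (.inl .main) <| go .drop)
  | .inl .drop => pop (.inl .main) <| ifRead (some .cons)
      (push (.inl .main) .cons <| push (.inl .main) .cons <| call .rst) (go .drop)
  -- restart the simulated machine with the next coin sequence
  | .inr ⟨.rst, l⟩ => liftStmt (subLab code .rst) (go (retLab .rst)) (tr l)
  | .inl (.clear b) => pop (.inr (.st b)) <| ifRead none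
      (go (cond b (.clear false) .copy)) (go (.clear b))
  | .inl .copy => pop (.inr .n) <| ifRead none (go .uncopy)
      (push (.inr .n2) .bit1 <| push (.inr (.st true)) .cons <| push (.inr (.st true)) .bit1 <|
        go .copy)
  | .inl .uncopy => pop (.inr .n2) <| ifRead none (go .inc) (push (.inr .n) .bit1 <| go .uncopy)
  | .inl .inc => pop (.inr .used) <| ifRead none (push (.inr .coin) .bit0 <| go .inner) <|
      ifRead (some .bit1) (push (.inr .coin) .bit0 <| go .inc)
        (push (.inr .coin) .bit1 <| go .inc0)
  | .inl .inc0 => pop (.inr .used) <| ifRead none (go .inner) (put (.inr .coin) <| go .inc0)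
  -- one step of the simulated machine
  | .inl .inner => pop (.inr .coin) <| ifRead none (push (.inl .main) .cons <| call .rst) <|
      put (.inr .used) <| push (.inl .main) .cons <|
        ifRead (some .bit1) (push (.inl .main) .bit1 <| call .ctl) (call .ctl)
  | .inr ⟨.ctl, l⟩ => liftStmt (subLab code .ctl) (go (retLab .ctl)) (tr l)
  | .inl .fin => pop (.inl .main) <| ifRead (some .cons) (go .op) (pop (.inl .main) <| go .ans)
  | .inl .ans => pop (.inl .main) <| ifRead (some .cons) (answer true) (answer false)
  | .inl .op => pop (.inl .main) <| ifRead (some .cons) (go (.side false))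
      (pop (.inl .main) <| go (.side true))
  | .inl (.side false) => pop (.inl .main) <| ifRead (some .cons)
      (push (.inr (.st false)) .cons <| go (.mv false))
      (pop (.inl .main) <| push (.inr (.st true)) .cons <| go (.mv true))
  | .inl (.side true) => pop (.inl .main) <| ifRead (some .cons)
      (go (.pp false)) (pop (.inl .main) <| go (.pp true))
  | .inl (.mv b) => pop (.inl .main) <| ifRead (some .cons)
      (push (.inl .main) .cons <| go .inner) (put (.inr (.st b)) <| go (.mv b))
  | .inl (.pp b) => pop (.inr (.st b)) <| ifRead none (go .inner) <| ifRead (some .cons)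
      (go .inner) (put (.inl .main) <| go (.pp b))

/-- The diagonalizing machine. It ignores its coins. -/
def diag : ProbTM where
  K := K' ⊕ OwnStk
  finK := by
    have : Finite K' := Finite.of_surjective (fun i : Fin 4 => match i with
      | 0 => K'.main | 1 => .rev | 2 => .aux | 3 => .stack)
      fun k => by cases k; exacts [⟨0, rfl⟩, ⟨1, rfl⟩, ⟨2, rfl⟩, ⟨3, rfl⟩]
    infer_instance
  Γ := DiagΓ
  finΓ := by rintro (k | k) <;> exact inferInstanceAs (Finite Γ')
  Λ := DiagLab code
  σ := Option Γ' × Bool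
  input := .inr .x
  letter := ⟨fun b => cond b .bit1 .bit0, fun a b => by cases a <;> cases b <;> simp⟩
  main := .inl (.start true)
  init := (none, false)
  prog _ := diagStmt code
  accept v := v.2

/-- The contents of the stacks of the diagonalizing machine outside its subroutines. -/
structure DiagMem where
  main : List Γ' := []
  x : List Γ' := []
  y : List Γ' := []
  z : List Γ' := []
  s : List Γ' := []
  n : List Γ' := []
  n2 : List Γ' := []
  st : Bool → List Γ' := fun _ => []
  used : List Γ' := []
  coin : List Γ' := []

namespace DiagMem

/-- The own stacks. -/
def own (m : DiagMem) : OwnStk → List Γ'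
  | .x => m.x
  | .y => m.y
  | .z => m.z
  | .s => m.s
  | .n => m.n
  | .n2 => m.n2
  | .st b => m.st b
  | .used => m.used
  | .coin => m.coin

/-- All stacks. -/
def stk (m : DiagMem) : ∀ k, List (DiagΓ k) := joinStk (K'.elim m.main [] [] []) m.own

variable (m : DiagMem) (v : List Γ')

@[simp] theorem stk_main : m.stk (.inl .main) = m.main := rfl
@[simp] theorem stk_x : m.stk (.inr .x) = m.x := rfl
@[simp] theorem stk_y : m.stk (.inr .y) = m.y := rfl
@[simp] theorem stk_z : m.stk (.inr .z) = m.z := rfl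
@[simp] theorem stk_s : m.stk (.inr .s) = m.s := rfl
@[simp] theorem stk_n : m.stk (.inr .n) = m.n := rfl
@[simp] theorem stk_n2 : m.stk (.inr .n2) = m.n2 := rfl
@[simp] theorem stk_st (b : Bool) : m.stk (.inr (.st b)) = m.st b := rfl
@[simp] theorem stk_used : m.stk (.inr .used) = m.used := rfl
@[simp] theorem stk_coin : m.stk (.inr .coin) = m.coin := rfl

theorem update_stk_inl : Function.update m.stk (.inl .main) v = {m with main := v}.stk := by
  rw [stk, update_joinStk_inl, K'.elim_update_main]; rfl

theorem update_stk_inr {k : OwnStk} {m' : DiagMem} (hm : m'.main = m.main)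
    (h : Function.update m.own k v = m'.own) : Function.update m.stk (.inr k) v = m'.stk := by
  rw [stk, update_joinStk_inr, h, ← hm]; rfl

@[simp] theorem update_main : Function.update m.stk (.inl .main) v = {m with main := v}.stk :=
  m.update_stk_inl v
@[simp] theorem update_x : Function.update m.stk (.inr .x) v = {m with x := v}.stk :=
  m.update_stk_inr v rfl (by funext k; cases k <;> rfl)
@[simp] theorem update_y : Function.update m.stk (.inr .y) v = {m with y := v}.stk :=
  m.update_stk_inr v rfl (by funext k; cases k <;> rfl)
@[simp] theorem update_z : Function.update m.stk (.inr .z) v = {m with z := v}.stk :=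
  m.update_stk_inr v rfl (by funext k; cases k <;> rfl)
@[simp] theorem update_s : Function.update m.stk (.inr .s) v = {m with s := v}.stk :=
  m.update_stk_inr v rfl (by funext k; cases k <;> rfl)
@[simp] theorem update_n : Function.update m.stk (.inr .n) v = {m with n := v}.stk :=
  m.update_stk_inr v rfl (by funext k; cases k <;> rfl)
@[simp] theorem update_n2 : Function.update m.stk (.inr .n2) v = {m with n2 := v}.stk :=
  m.update_stk_inr v rfl (by funext k; cases k <;> rfl)
@[simp] theorem update_used : Function.update m.stk (.inr .used) v = {m with used := v}.stk :=
  m.update_stk_inr v rfl (by funext k; cases k <;> rfl)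
@[simp] theorem update_coin : Function.update m.stk (.inr .coin) v = {m with coin := v}.stk :=
  m.update_stk_inr v rfl (by funext k; cases k <;> rfl)
@[simp] theorem update_st (b : Bool) : Function.update m.stk (.inr (.st b)) v =
    {m with st := Function.update m.st b v}.stk :=
  m.update_stk_inr v rfl (by
    funext k
    cases k with
    | st b' =>
      by_cases h : b' = b
      · subst h; simp [own]
      · rw [Function.update_of_ne (by simpa using h)]; simp [own, h]
    | _ => rfl)

end DiagMem

variable {code}

section
variable (v : Option Γ' × Bool) (S : ∀ k, List (DiagΓ k)) (q q' : DiagStmt code) (a : Γ')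

@[simp] theorem stepAux_go (l : OwnLab) :
    TM2.stepAux (go l : DiagStmt code) v S = ⟨some (.inl l), v, S⟩ := rfl
@[simp] theorem stepAux_answer (b : Bool) :
    TM2.stepAux (answer b : DiagStmt code) v S = ⟨none, (none, b), S⟩ := rfl
@[simp] theorem stepAux_pop_inl (k : K') : TM2.stepAux (pop (.inl k) q) v S =
    TM2.stepAux q ((S (.inl k)).head?, v.2) (Function.update S (.inl k) (S (.inl k)).tail) := rfl
@[simp] theorem stepAux_pop_inr (k : OwnStk) : TM2.stepAux (pop (.inr k) q) v S =
    TM2.stepAux q ((S (.inr k)).head?, v.2) (Function.update S (.inr k) (S (.inr k)).tail) := rfl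
@[simp] theorem stepAux_push_inl (k : K') : TM2.stepAux (push (.inl k) a q) v S =
    TM2.stepAux q v (Function.update S (.inl k) (a :: S (.inl k))) := rfl
@[simp] theorem stepAux_push_inr (k : OwnStk) : TM2.stepAux (push (.inr k) a q) v S =
    TM2.stepAux q v (Function.update S (.inr k) (a :: S (.inr k))) := rfl
@[simp] theorem stepAux_put_inl (k : K') : TM2.stepAux (put (.inl k) q) v S =
    TM2.stepAux q v (Function.update S (.inl k) (v.1.getD .cons :: S (.inl k))) := rfl
@[simp] theorem stepAux_put_inr (k : OwnStk) : TM2.stepAux (put (.inr k) q) v S =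
    TM2.stepAux q v (Function.update S (.inr k) (v.1.getD .cons :: S (.inr k))) := rfl
@[simp] theorem stepAux_ifRead (o : Option Γ') : TM2.stepAux (ifRead o q q') v S =
    cond (v.1 == o) (TM2.stepAux q v S) (TM2.stepAux q' v S) := rfl
@[simp] theorem stepAux_call (s : Site) : TM2.stepAux (call s : DiagStmt code) v S =
    ⟨some (subLab code s (trNormal (code s) Cont'.halt)), (none, v.2), S⟩ := rfl
end

/-- `Leads` for the diagonalizing machine, from one of its own labels. -/
abbrev DLeads (code : Site → Code) (B : ℕ) (l : OwnLab) (m : DiagMem)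
    (P : TM2.Cfg DiagΓ (DiagLab code) (Option Γ' × Bool) → Prop) : Prop :=
  Leads (fun _ => diagStmt code) B (.inl l) m.stk P

/-- The configurations of the diagonalizing machine at one of its own labels. -/
abbrev DAt (code : Site → Code) (l : OwnLab) (m : DiagMem) :
    TM2.Cfg DiagΓ (DiagLab code) (Option Γ' × Bool) → Prop := At (.inl l) m.stk

/-- The halted configurations of the diagonalizing machine with the given answer. -/
abbrev DAns (code : Site → Code) (b : Bool) :
    TM2.Cfg DiagΓ (DiagLab code) (Option Γ' × Bool) → Prop := Answers Prod.snd b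

/-- The unary representation of a number. -/
abbrev un (n : ℕ) : List Γ' := List.replicate n .bit1

theorem DLeads.step {B : ℕ} {l l' : OwnLab} {m m' : DiagMem}
    {P : TM2.Cfg DiagΓ (DiagLab code) (Option Γ' × Bool) → Prop} (h' : DLeads code B l' m' P)
    (h : ∀ v, ∃ v', TM2.stepAux (diagStmt code (.inl l)) v m.stk = ⟨some (.inl l'), v', m'.stk⟩) :
    DLeads code (B + 1) l m P :=
  Leads.head h' fun v => let ⟨v', hv⟩ := h v; ⟨v', fun _ => hv⟩

theorem DLeads.ans {l : OwnLab} {m : DiagMem} {a : Bool}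
    (h : ∀ v, ∃ S', TM2.stepAux (diagStmt code (.inl l)) v m.stk = ⟨none, (none, a), S'⟩) :
    DLeads code 1 l m (DAns code a) :=
  Leads.halts fun v => let ⟨S', hv⟩ := h v; ⟨_, S', rfl, fun _ => hv⟩

/-! ### The iterated logarithm -/

theorem diag_refill (f : Bool) (m : DiagMem) (a b : ℕ) :
    DLeads code (b + 1) (.refill f) {m with x := un a, z := un b}
      (DAt code (.half f) {m with x := un (a + b), z := []}) := by
  induction b generalizing a with
  | zero =>
    refine DLeads.step (.refl _ _) fun v => ⟨(none, v.2), ?_⟩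
    simp [diagStmt]
  | succ b ih =>
    have := ih (a + 1)
    rw [show a + 1 + b = a + (b + 1) by ring] at this
    refine this.step fun v => ⟨(some .bit1, v.2), ?_⟩
    simp [diagStmt, List.replicate_succ]

theorem diag_log (f : Bool) (m : DiagMem) (a b c : ℕ) :
    DLeads code (b + 1) (.log f) {m with x := un a, y := un b, n := un c}
      (DAt code (.start false) {m with x := un (a + b), y := [], n := un (cond f (c + b) c)}) := by
  induction b generalizing a c with
  | zero =>
    refine DLeads.step (.refl _ _) fun v => ⟨(none, v.2), ?_⟩
    simp [diagStmt]
  | succ b ih =>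
    have := ih (a + 1) (cond f (c + 1) c)
    have e : cond f (cond f (c + 1) c + b) (cond f (c + 1) c) = cond f (c + (b + 1)) c := by
      cases f <;> simp; ring
    rw [show a + 1 + b = a + (b + 1) by ring, e] at this
    refine this.step fun v => ⟨(some .bit1, v.2), ?_⟩
    cases f <;> simp [diagStmt, List.replicate_succ]

/-- The tower function: `0, 1, 2, 4, 16, 65536, …` -/
def tower : ℕ → ℕ
  | 0 => 0
  | s + 1 => 2 ^ tower s

/-- Pairs of letters on `x` are replaced by single letters on `z`. -/
theorem diag_halves (f : Bool) (m : DiagMem) (u c e : ℕ) :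
    DLeads code (2 * u) (.half f) {m with x := un (2 * u + e), z := un c}
      (DAt code (.half f) {m with x := un e, z := un (c + u)}) := by
  induction u generalizing c with
  | zero => simpa using Leads.refl _ _
  | succ u ih =>
    have h := ih (c + 1)
    rw [show c + 1 + u = c + (u + 1) by ring] at h
    have h1 : DLeads code (2 * u + 1) (.half' f) {m with x := un (2 * u + e + 1), z := un c} _ :=
      h.step fun v => ⟨(some .bit1, v.2), by simp [diagStmt, List.replicate_succ]⟩
    have h2 : DLeads code (2 * u + 1 + 1) (.half f)
        {m with x := un (2 * u + e + 1 + 1), z := un c} _ :=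
      h1.step fun v => ⟨(some .bit1, v.2), by simp [diagStmt, List.replicate_succ]⟩
    rw [show 2 * (u + 1) + e = 2 * u + e + 1 + 1 by ring]
    exact h2

/-- The memory while a logarithm is computed. -/
def logMem (m : DiagMem) (v y k c : ℕ) : DiagMem :=
  {m with x := un v, y := un y, z := [], s := un k, n := un c}

/-- One logarithm, computed by repeated halving: `y` counts the halvings. Its success depends on
whether `v` is a power of two; otherwise the machine rejects. The flag `f` says that the logarithm
is also recorded on the stack `n`. -/
theorem diag_logs (f : Bool) (m : DiagMem) (v : ℕ) (hv : 0 < v) (y k c : ℕ) :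
    (∀ a, v = 2 ^ a → DLeads code (6 * v + y + 4) (.half f) (logMem m v y k c)
      (DAt code (.start false) (logMem m (a + y) 0 (k + 1) (cond f (c + (a + y)) c)))) ∧
    ((∀ a, v ≠ 2 ^ a) → ∃ B, DLeads code B (.half f) (logMem m v y k c) (DAns code false)) := by
  induction v using Nat.strong_induction_on generalizing y with
  | _ v ih =>
    rcases Nat.even_or_odd' v with ⟨u, rfl | rfl⟩
    · obtain ⟨ih1, ih2⟩ := ih u (by omega) (by omega) (y + 1)
      have hr := fun B (P) (h : DLeads code B (.half f) (logMem m u (y + 1) k c) P) => by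
        have h0 := diag_refill (code := code) f {m with y := un (y + 1), s := un k, n := un c} 0 u
        rw [Nat.zero_add] at h0
        have h1 : DLeads code (u + 1 + B) (.refill f)
          {m with x := [], y := un (y + 1), z := un u, s := un k, n := un c} P := h0.trans h
        have h2 : DLeads code (u + 1 + B + 1) (.half f)
          {m with x := [], y := un y, z := un u, s := un k, n := un c} P :=
          h1.step fun v => ⟨(none, v.2), by simp [diagStmt, List.replicate_succ]⟩
        have h3 := diag_halves (code := code) f {m with y := un y, s := un k, n := un c} u 0 0
        rw [Nat.zero_add] at h3
        exact h3.trans h2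
      constructor
      · intro a ha
        rcases a with _ | a
        · omega
        · have := hr _ _ (ih1 a (by rw [pow_succ] at ha; omega))
          rw [show a + 1 + y = a + (y + 1) by ring]
          exact Leads.mono this (by omega)
      · intro hne
        obtain ⟨B, hB⟩ := ih2 fun a ha => hne (a + 1) (by rw [pow_succ, ha]; ring)
        exact ⟨_, hr _ _ hB⟩
    · have hr := fun B (P) (h : DLeads code B (.odd f)
          {m with x := [], y := un y, z := un u, s := un k, n := un c} P) => by
        have h1 : DLeads code (B + 1) (.half' f)
          {m with x := [], y := un y, z := un u, s := un k, n := un c} P :=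
          h.step fun v => ⟨(none, v.2), by simp [diagStmt]⟩
        have h2 : DLeads code (B + 1 + 1) (.half f)
          {m with x := un 1, y := un y, z := un u, s := un k, n := un c} P :=
          h1.step fun v => ⟨(some .bit1, v.2), by simp [diagStmt]⟩
        have h3 := diag_halves (code := code) f {m with y := un y, s := un k, n := un c} u 0 1
        rw [Nat.zero_add] at h3
        exact h3.trans h2
      rcases Nat.eq_zero_or_pos u with rfl | hu
      · constructor
        · intro a ha
          obtain rfl : a = 0 := by
            rcases a with _ | a
            · rfl
            · rw [pow_succ] at ha; omega
          have h1 := diag_log (code := code) f {m with z := [], s := un (k + 1)} 0 y c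
          have h2 : DLeads code (y + 1 + 1) (.odd f)
              {m with x := [], y := un y, z := un 0, s := un k, n := un c} _ :=
            h1.step fun v => ⟨(none, v.2), by simp [diagStmt, List.replicate_succ]⟩
          have h3 := hr _ _ h2
          simp only [Nat.zero_add] at h3 ⊢
          exact Leads.mono (show DLeads code _ (.half f) (logMem m 1 y k c)
            (DAt code (.start false) (logMem m y 0 (k + 1) (cond f (c + y) c))) from h3) (by omega)
        · intro h
          exact absurd rfl (h 0)
      · constructor
        · intro a ha
          rcases a with _ | a
          · omega
          · rw [pow_succ] at ha; omega
        · intro _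
          refine ⟨_, hr 1 _ (.ans fun v =>
            ⟨{m with x := [], y := un y, z := un u, s := un k, n := un c}.stk, ?_⟩)⟩
          · obtain ⟨u, rfl⟩ := Nat.exists_eq_succ_of_ne_zero hu.ne'
            simp [diagStmt, List.replicate_succ]

/-- The first logarithm that is computed from `tower r`. -/
def firstLog : ℕ → ℕ
  | 0 => 0
  | r + 1 => tower r

/-- The iterated logarithm: on `tower r` the machine ends up with `r` letters on `s`, in linear
time, and it rejects the numbers that are not towers. The three letters on `main` are the list `[0,
0, 0]`, with which the next phase starts. -/
theorem diag_tower (f : Bool) (m : DiagMem) (v k c : ℕ) :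
    (∀ r, v = tower r → DLeads code (24 * v + 6) (.start f) (logMem m v 0 k c)
      (DAt code .beep {logMem m 0 0 (k + r) (cond f (c + firstLog r) c) with
        main := .cons :: .cons :: .cons :: m.main})) ∧
    ((∀ r, v ≠ tower r) → ∃ B, DLeads code B (.start f) (logMem m v 0 k c) (DAns code false)) := by
  induction v using Nat.strong_induction_on generalizing f k c with
  | _ v ih =>
    rcases Nat.eq_zero_or_pos v with rfl | hv
    · constructor
      · intro r hr
        obtain rfl : r = 0 := by
          rcases r with _ | r
          · rfl
          · exact absurd hr (Nat.two_pow_pos _).ne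
        refine Leads.mono (DLeads.step (.refl _ _) fun v => ⟨(none, v.2), ?_⟩)
          (by omega : 0 + 1 ≤ _)
        cases f <;> simp [diagStmt, logMem, firstLog]
      · intro h
        exact absurd rfl (h 0)
    · obtain ⟨hl1, hl2⟩ := diag_logs (code := code) f m v hv 0 k c
      have hs := fun B (P) (h : DLeads code B (.half f) (logMem m v 0 k c) P) =>
        show DLeads code (B + 1) (.start f) (logMem m v 0 k c) P by
        refine h.step fun x => ⟨(some .bit1, x.2), ?_⟩
        obtain ⟨v, rfl⟩ := Nat.exists_eq_succ_of_ne_zero hv.ne'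
        simp [diagStmt, logMem, List.replicate_succ]
      by_cases h : ∃ a, v = 2 ^ a
      · obtain ⟨a, rfl⟩ := h
        have ha : a < 2 ^ a := Nat.lt_two_pow_self
        obtain ⟨ih1, ih2⟩ := ih a ha false (k + 1) (cond f (c + (a + 0)) c)
        constructor
        · intro r hr
          rcases r with _ | r
          · simp [tower] at hr
          · obtain rfl : a = tower r := Nat.pow_right_injective le_rfl hr
            have := hs _ _ ((hl1 _ rfl).trans (ih1 r rfl))
            rw [show k + (r + 1) = k + 1 + r by ring]
            refine Leads.mono this ?_
            have : 2 * tower r ≤ 2 ^ tower r := by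
              rcases tower r with _ | a
              · simp
              · have : a < 2 ^ a := Nat.lt_two_pow_self
                rw [pow_succ]; omega
            omega
        · intro hne
          obtain ⟨B, hB⟩ := ih2 fun r hr => hne (r + 1) (by rw [hr]; rfl)
          exact ⟨_, hs _ _ ((hl1 _ rfl).trans hB)⟩
      · push Not at h
        obtain ⟨B, hB⟩ := hl2 h
        refine ⟨fun r hr => ?_, fun _ => ⟨_, hs _ _ hB⟩⟩
        rcases r with _ | r
        · rw [hr] at hv; simp [tower] at hv
        · exact absurd hr (h _)

/-! ### The process that produces the valid lengths -/

/-- The process that evaluates a code over and over, each time on the last result. Between two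
evaluations there is a configuration without label. -/
def procStep (c : Code) (g : CodeCfg) : CodeCfg :=
  match g.l with
  | none => ⟨some (trNormal c Cont'.halt), none, g.stk⟩
  | some _ => codeStep g

/-- The process is between two evaluations exactly at the times `t 0 < t 1 < …` -/
theorem exists_procTimes {c : Code} {w : ℕ → List ℕ} (hw : ∀ r, c.eval (w r) = pure (w (r + 1))) :
    ∃ t : ℕ → ℕ, StrictMono t ∧
      (∀ r, (procStep c)^[t r] (codeHalt (w 0)) = codeHalt (w r)) ∧
      (∀ k, (∃ r, k = t r) ∨
        ∃ l ∈ codeSupp c Cont'.halt, ((procStep c)^[k] (codeHalt (w 0))).l = some l) := by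
  choose T hT using fun r => exists_evalsIn (hw r)
  let t : ℕ → ℕ := fun r => Nat.rec 0 (fun r k => T r + 1 + k) r
  have ht : ∀ r, t (r + 1) = T r + 1 + t r := fun r => rfl
  have hrun : ∀ r, ∀ i ≤ T r, (procStep c)^[i + 1] (codeHalt (w r)) =
      codeStep^[i] (codeInit c (w r)) := by
    intro r i hi
    induction i with
    | zero => rfl
    | succ i ih =>
      rw [Function.iterate_succ_apply', ih (by omega), Function.iterate_succ_apply']
      obtain ⟨l, -, hl⟩ := (hT r).2 i (by omega)
      simp only [procStep, hl]
  have hmain : ∀ r, (procStep c)^[t r] (codeHalt (w 0)) = codeHalt (w r) := by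
    intro r
    induction r with
    | zero => rfl
    | succ r ih =>
      rw [ht, Function.iterate_add_apply, ih, hrun r _ le_rfl, (hT r).1]
  refine ⟨t, strictMono_nat_of_lt_succ fun r => by rw [ht]; omega, hmain, fun k => ?_⟩
  have hk : ∃ r i, i ≤ T r ∧ k = i + t r := by
    induction k with
    | zero => exact ⟨0, 0, Nat.zero_le _, rfl⟩
    | succ k ih =>
      obtain ⟨r, i, hi, rfl⟩ := ih
      rcases hi.lt_or_eq with h | rfl
      · exact ⟨r, i + 1, h, by ring⟩
      · exact ⟨r + 1, 0, Nat.zero_le _, by rw [ht]; ring⟩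
  obtain ⟨r, i, hi, rfl⟩ := hk
  rcases i with _ | i
  · exact .inl ⟨r, by ring⟩
  · right
    rw [Function.iterate_add_apply, hmain, hrun r i (by omega)]
    exact (hT r).2 i (by omega)

theorem subLab_of_mem {s : Site} {l : Λ'} (h : l ∈ codeSupp (code s) Cont'.halt) :
    subLab code s l = .inr ⟨s, l, h⟩ := dif_pos h

/-- The label of the diagonalizing machine while it runs the process. -/
def procLab (code : Site → Code) : Option Λ' → DiagLab code
  | none => .inl .beep
  | some l => subLab code .nxt l

/-- The stacks `S` of the evaluation of codes together with the own stacks `T`. -/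
def procStk (S : K' → List Γ') (T : OwnStk → List Γ') : ∀ k, List (DiagΓ k) := joinStk S T

theorem stepAux_pop_procStk (k : OwnStk) (f) (q : DiagStmt code) (v : Option Γ' × Bool)
    (S : K' → List Γ') (T : OwnStk → List Γ') :
    TM2.stepAux (TM2.Stmt.pop (.inr k) f q) v (procStk S T) =
      TM2.stepAux q (f v (T k).head?) (procStk S (Function.update T k (T k).tail)) := by
  rw [procStk, procStk, ← update_joinStk_inr]; rfl

theorem DiagMem.update_own_s (m : DiagMem) (a b : List Γ') :
    Function.update {m with s := a}.own .s b = {m with s := b}.own := by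
  funext j; cases j <;> rfl

theorem stepAux_liftStmt_procStk (s : Site) (l : OwnLab)
    (q : TM2.Stmt (fun _ : K' => Γ') Λ' (Option Γ')) (v : Option Γ') (x : Bool)
    (S : K' → List Γ') (T : OwnStk → List Γ') :
    TM2.stepAux (liftStmt (subLab code s) (go l) q) (v, x) (procStk S T) =
      ⟨some (((TM2.stepAux q v S).l.map (subLab code s)).getD (.inl l)),
        ((TM2.stepAux q v S).var, x), procStk (TM2.stepAux q v S).stk T⟩ := by
  rw [procStk, stepAux_liftStmt]
  rcases TM2.stepAux q v S with ⟨_ | l', v', S'⟩ <;> rfl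

theorem stepAux_procLab (g : CodeCfg) (m : DiagMem) (k : ℕ) (x : Bool)
    (hg : ∀ l, g.l = some l → l ∈ codeSupp (code .nxt) Cont'.halt) :
    TM2.stepAux (diagStmt code (procLab code g.l)) (g.var, x)
        (procStk g.stk {m with s := un (k + 1)}.own) =
      ⟨some (procLab code (procStep (code .nxt) g).l), ((procStep (code .nxt) g).var, true),
        procStk (procStep (code .nxt) g).stk {m with s := un k}.own⟩ := by
  obtain ⟨_ | l, v, S⟩ := g
  · simp only [procLab, diagStmt, procStep]
    rw [stepAux_pop_procStk, DiagMem.update_own_s]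
    rfl
  · simp only [procLab, subLab_of_mem (hg l rfl), diagStmt, procStep]
    rw [stepAux_pop_procStk, DiagMem.update_own_s]
    refine (stepAux_liftStmt_procStk (code := code) .nxt .beep (tr l) v true S _).trans ?_
    rw [show codeStep ⟨some l, v, S⟩ = TM2.stepAux (tr l) v S from rfl]
    rcases TM2.stepAux (tr l) v S with ⟨_ | l', v', S'⟩ <;> rfl

/-- Each step of the process consumes one letter from `s`. -/
theorem coinRun_proc (k : ℕ) (g : CodeCfg) (m : DiagMem) (x : Bool)
    (hg : ∀ i l, ((procStep (code .nxt))^[i] g).l = some l →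
      l ∈ codeSupp (code .nxt) Cont'.halt) :
    ∃ x', ∀ ω, coinRun (fun _ => diagStmt code) ⟨some (procLab code g.l), (g.var, x),
        procStk g.stk {m with s := un k}.own⟩ ω k =
      ⟨some (procLab code ((procStep (code .nxt))^[k] g).l),
        (((procStep (code .nxt))^[k] g).var, x'),
        procStk ((procStep (code .nxt))^[k] g).stk {m with s := []}.own⟩ := by
  induction k generalizing g x with
  | zero => exact ⟨x, fun _ => rfl⟩
  | succ k ih =>
    obtain ⟨x', h⟩ := ih (procStep (code .nxt) g) true
      fun i l => by
        rw [← Function.iterate_succ_apply]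
        exact hg (i + 1) l
    refine ⟨x', fun ω => ?_⟩
    rw [coinRun_succ', coinStep_some]
    have := stepAux_procLab g m k x (hg 0)
    rw [this]
    exact h _

/-- The process is run for `k` steps. It has to be between two evaluations then. -/
theorem diag_proc {w : ℕ → List ℕ} (hw : ∀ r, (code .nxt).eval (w r) = pure (w (r + 1))) :
    ∃ t : ℕ → ℕ, StrictMono t ∧ ∀ (m : DiagMem) (k : ℕ),
      (∀ r, k = t r → DLeads code (k + 2) .beep {m with main := trList (w 0), s := un k}
        (DAt code .flag {m with main := trList (w r), s := []})) ∧
      ((∀ r, k ≠ t r) → DLeads code (k + 2) .beep {m with main := trList (w 0), s := un k}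
        (DAns code false)) := by
  obtain ⟨t, ht, h1, h2⟩ := exists_procTimes hw
  refine ⟨t, ht, fun m k => ?_⟩
  have hg : ∀ i l, ((procStep (code .nxt))^[i] (codeHalt (w 0))).l = some l →
      l ∈ codeSupp (code .nxt) Cont'.halt := fun i l hl => by
    rcases h2 i with ⟨r, rfl⟩ | ⟨l', hl', h⟩
    · rw [h1] at hl; cases hl
    · rw [h] at hl; cases hl; exact hl'
  have hrun : ∀ v : Option Γ' × Bool, ∃ v', ∀ ω, coinRun (fun _ => diagStmt code)
      ⟨some (.inl .beep), v, {m with main := trList (w 0), s := un k}.stk⟩ ω k =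
      ⟨some (procLab code ((procStep (code .nxt))^[k] (codeHalt (w 0))).l), v',
        procStk ((procStep (code .nxt))^[k] (codeHalt (w 0))).stk {m with s := []}.own⟩ := by
    rcases k with _ | k
    · exact fun v => ⟨v, fun ω => rfl⟩
    · obtain ⟨x', h⟩ := coinRun_proc (code := code) k (procStep (code .nxt) (codeHalt (w 0))) m true
        fun i l => by
          rw [← Function.iterate_succ_apply]; exact hg (i + 1) l
      intro v
      refine ⟨(((procStep (code .nxt))^[k + 1] (codeHalt (w 0))).var, x'), fun ω => ?_⟩
      rw [coinRun_succ', coinStep_some]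
      -- the call of the subroutine forgets the internal state
      have e := stepAux_pop_procStk (code := code) .s (fun v a => (v.1, a.isSome))
        (.branch (fun v => v.2) (call .nxt) (go .flag)) v (K'.elim (trList (w 0)) [] [] [])
        {m with s := un (k + 1)}.own
      rw [DiagMem.update_own_s] at e
      exact (congrArg (coinRun _ · _ k) e).trans (h _)
  constructor
  · rintro r rfl v
    obtain ⟨v', hv'⟩ := hrun v
    refine ⟨t r + 1, by omega, ⟨some (.inl .flag), (v'.1, false),
      procStk (K'.elim (trList (w r)) [] [] []) {m with s := []}.own⟩, fun ω => ?_, ?_⟩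
    · rw [coinRun, hv', h1]
      have e := stepAux_pop_procStk (code := code) .s (fun v a => (v.1, a.isSome))
        (.branch (fun v => v.2) (call .nxt) (go .flag)) v' (K'.elim (trList (w r)) [] [] [])
        {m with s := []}.own
      rw [DiagMem.update_own_s] at e
      exact e
    · exact ⟨rfl, rfl⟩
  · intro hk v
    obtain ⟨v', hv'⟩ := hrun v
    obtain ⟨r, hr⟩ | ⟨l, hl, hl'⟩ := h2 k
    · exact absurd hr (hk r)
    refine ⟨k + 1, by omega, ⟨none, (none, false),
      procStk ((procStep (code .nxt))^[k] (codeHalt (w 0))).stk {m with s := []}.own⟩,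
      fun ω => ?_, ?_⟩
    · rw [coinRun, hv', hl', procLab, subLab_of_mem hl]
      have e := stepAux_pop_procStk (code := code) .s (fun v a => (v.1, a.isSome))
        (.branch (fun v => v.2) (liftStmt (subLab code .nxt) (go .beep) (tr l)) (answer false))
        v' ((procStep (code .nxt))^[k] (codeHalt (w 0))).stk {m with s := []}.own
      rw [DiagMem.update_own_s] at e
      exact e
    · exact ⟨rfl, rfl⟩

end Diag

/-! ### Table machines -/

/-- An action of a table machine: halt with an answer, push a symbol on one of the two stacks, or
pop one of them, and go on in a new state. -/
inductive TabAct
  | halt (a : Bool)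
  | push (s : Bool) (y q : ℕ)
  | pop (s : Bool) (q : ℕ)

/-- The configurations of a table machine: the state, the symbol that the last step has popped
(`0` if there is none), and the two stacks. -/
@[ext]
structure TabCfg where
  q : ℕ
  p : ℕ
  st : Bool → List ℕ

/-- The action that is encoded by a number. -/
def TabAct.ofNat (e : ℕ) : TabAct :=
  if e.unpair.1 % 2 = 1 then .halt (decide (e.unpair.1 / 2 % 2 = 1))
  else if e.unpair.1 / 2 % 2 = 1 then
    .pop (decide (e.unpair.1 / 4 % 2 = 1)) e.unpair.2.unpair.2
  else .push (decide (e.unpair.1 / 4 % 2 = 1)) e.unpair.2.unpair.1 e.unpair.2.unpair.2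

/-- A number that encodes an action. -/
def TabAct.toNat : TabAct → ℕ
  | .halt a => Nat.pair (1 + 2 * a.toNat) (Nat.pair 0 0)
  | .push s y q => Nat.pair (4 * s.toNat) (Nat.pair y q)
  | .pop s q => Nat.pair (2 + 4 * s.toNat) (Nat.pair 0 q)

theorem TabAct.ofNat_toNat (a : TabAct) : TabAct.ofNat a.toNat = a := by
  rcases a with _ | ⟨s, y, q⟩ | ⟨s, q⟩
  · rename_i a; cases a <;> simp [TabAct.ofNat, TabAct.toNat]
  · cases s <;> simp [TabAct.ofNat, TabAct.toNat]
  · cases s <;> simp [TabAct.ofNat, TabAct.toNat]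

/-- The entry of the table with number `i` for coin `b`, popped symbol `p` and state `q`. -/
def tabEntry (i b p q : ℕ) : ℕ :=
  (Denumerable.ofNat (List ℕ) i).getD (Nat.pair b (Nat.pair p q)) 0

/-- Carry out an action. -/
def TabCfg.act (c : TabCfg) : TabAct → Bool ⊕ TabCfg
  | .halt a => .inl a
  | .push s y q => .inr ⟨q, 0, Function.update c.st s (y :: c.st s)⟩
  | .pop s q => .inr ⟨q, (c.st s).headD 0, Function.update c.st s (c.st s).tail⟩

/-- One step of the table machine with number `i` with coin `b`. -/
def tabStep (i : ℕ) (b : Bool) (c : TabCfg) : Bool ⊕ TabCfg :=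
  c.act (TabAct.ofNat (tabEntry i b.toNat c.p c.q))

/-- The run of a table machine on a finite sequence of coins: its answer, or the configuration that
it has reached. -/
def tabRun (i : ℕ) : List Bool → TabCfg → Bool ⊕ TabCfg
  | [], c => .inr c
  | b :: u, c => match tabStep i b c with
    | .inl a => .inl a
    | .inr c' => tabRun i u c'

/-- The initial configuration of a table machine on input `n`. -/
def tabInit (n : ℕ) : TabCfg := ⟨0, 0, fun s => cond s (List.replicate n 1) []⟩

/-- All numbers in the configuration are less than `N`. -/
def TabCfg.Below (N : ℕ) (c : TabCfg) : Prop :=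
  c.q < N ∧ c.p < N ∧ ∀ s, ∀ y ∈ c.st s, y < N

/-- The numbers that occur in a run of a table machine are bounded in terms of its table. -/
theorem exists_tab_bound (i : ℕ) : ∃ N, 2 ≤ N ∧ ∀ b c c', TabCfg.Below N c →
    tabStep i b c = .inr c' → c'.Below N := by
  let N := 2 + (Denumerable.ofNat (List ℕ) i).sum
  have hN : ∀ j, (Denumerable.ofNat (List ℕ) i).getD j 0 < N := fun j => by
    rw [List.getD_eq_getElem?_getD]
    rcases lt_or_ge j (Denumerable.ofNat (List ℕ) i).length with h | h
    · rw [List.getElem?_eq_getElem h, Option.getD_some]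
      have := List.single_le_sum (l := Denumerable.ofNat (List ℕ) i) (fun _ _ => Nat.zero_le _) _
        (List.getElem_mem h)
      omega
    · rw [List.getElem?_eq_none h, Option.getD_none]; omega
  refine ⟨N, by omega, fun b c c' ⟨hq, hp, hst⟩ h => ?_⟩
  have he := hN (Nat.pair b.toNat (Nat.pair c.p c.q))
  rw [tabStep, tabEntry] at h
  generalize (Denumerable.ofNat (List ℕ) i).getD (Nat.pair b.toNat (Nat.pair c.p c.q)) 0 = e
    at he h
  have h2 : e.unpair.2 < N := (Nat.unpair_right_le e).trans_lt he
  have h21 : e.unpair.2.unpair.1 < N := (Nat.unpair_left_le _).trans_lt h2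
  have h22 : e.unpair.2.unpair.2 < N := (Nat.unpair_right_le _).trans_lt h2
  rw [TabAct.ofNat] at h
  split_ifs at h
  · cases h
  · cases h
    refine ⟨h22, ?_, fun s y hy => ?_⟩
    · rcases hc : c.st (decide (e.unpair.1 / 4 % 2 = 1)) with _ | ⟨y, l⟩
      · show ([] : List ℕ).headD 0 < N
        exact (Nat.zero_le _).trans_lt he
      · exact hst _ y (by rw [hc]; exact List.mem_cons_self)
    · simp only [Function.update_apply] at hy
      split_ifs at hy with hs
      · exact hst _ y (List.mem_of_mem_tail hy)
      · exact hst _ y hy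
  · cases h
    refine ⟨h22, (Nat.zero_le _).trans_lt he, fun s y hy => ?_⟩
    simp only [Function.update_apply] at hy
    split_ifs at hy with hs
    · rcases List.mem_cons.1 hy with rfl | hy
      · exact h21
      · exact hst _ y hy
    · exact hst _ y hy

section Diag

open ToPartrec PartrecToTM2 DiagCmd

variable {code : Site → Code}

/-! ### Subroutine calls -/

/-- While a subroutine runs, the diagonalizing machine imitates the machine that evaluates codes,
and the own stacks do not change. -/
theorem coinRun_sub {s : Site} (hs : s ≠ .nxt) (T : ℕ) (g : CodeCfg) (x : Bool)
    (S : OwnStk → List Γ')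
    (hg : ∀ i < T, ∃ l ∈ codeSupp (code s) Cont'.halt, (codeStep^[i] g).l = some l)
    (ω : ℕ → Bool) :
    coinRun (fun _ => diagStmt code) ⟨some ((g.l.map (subLab code s)).getD (.inl (retLab s))),
        (g.var, x), procStk g.stk S⟩ ω T =
      ⟨some (((codeStep^[T] g).l.map (subLab code s)).getD (.inl (retLab s))),
        ((codeStep^[T] g).var, x), procStk (codeStep^[T] g).stk S⟩ := by
  induction T generalizing g ω with
  | zero => rfl
  | succ T ih =>
    have h := ih (codeStep g)
      (fun i hi => by rw [← Function.iterate_succ_apply]; exact hg (i + 1) (by omega))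
      fun i => ω (i + 1)
    rw [Function.iterate_succ_apply, ← h, coinRun_succ']
    congr 1
    obtain ⟨l, hl, hgl⟩ := hg 0 (by omega)
    obtain ⟨_, v, S'⟩ := g
    obtain rfl := hgl
    have e := stepAux_liftStmt_procStk (code := code) s (retLab s) (tr l) v x S' S
    have hd : diagStmt code (subLab code s l) =
        liftStmt (subLab code s) (go (retLab s)) (tr l) := by
      rw [subLab_of_mem hl]
      cases s with
      | nxt => exact absurd rfl hs
      | ctl => rfl
      | rst => rfl
    simp only [Option.map_some, Option.getD_some, coinStep_some, hd]
    exact e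

/-- The diagonalizing machine calls a subroutine and goes on with its output. -/
theorem DLeads.call {s : Site} (hs : s ≠ .nxt) {v w : List ℕ} {T B : ℕ} {l : OwnLab}
    {m₀ m : DiagMem} {P : TM2.Cfg DiagΓ (DiagLab code) (Option Γ' × Bool) → Prop}
    (h' : DLeads code B (retLab s) {m with main := trList w} P) (hT : EvalsIn (code s) v w T)
    (h : ∀ x, ∃ x', TM2.stepAux (diagStmt code (.inl l)) x m₀.stk =
      ⟨some (subLab code s (trNormal (code s) Cont'.halt)), (none, x'),
        {m with main := trList v}.stk⟩) :
    DLeads code (B + T + 1) l m₀ P := fun x => by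
  obtain ⟨x', hx⟩ := h x
  obtain ⟨t, ht, c', hc', hP⟩ := h' (none, x')
  refine ⟨1 + (T + t), by omega, c', fun ω => ?_, hP⟩
  rw [coinRun_add, coinRun_add]
  have e := coinRun_sub (code := code) hs T (codeInit (code s) v) x' m.own hT.2 fun i => ω (1 + i)
  rw [hT.1] at e
  refine Eq.trans ?_ (hc' fun i => ω (1 + (T + i)))
  refine congrArg (coinRun _ · _ t) (Eq.trans ?_ e)
  refine congrArg (coinRun _ · _ T) ?_
  exact hx

/-! ### Simulation of table machines -/

/-- The letter that stands for a coin. -/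
def bitLetter (b : Bool) : Γ' := cond b .bit1 .bit0

/-- A stack of numbers, as a stack of letters: each number is followed by `cons`. The first digit of
a number lies deepest, so that moving a number between stacks restores its order. -/
def encStack (l : List ℕ) : List Γ' := l.flatMap fun y => (trNat y).reverse ++ [.cons]

theorem encStack_nil : encStack [] = [] := rfl

theorem encStack_cons (y : ℕ) (l : List ℕ) :
    encStack (y :: l) = (trNat y).reverse ++ .cons :: encStack l := by simp [encStack]

/-- The memory of the diagonalizing machine during the simulation of the table machine `i` on
input `n`: the configuration of this machine, and the coins that are left and used. -/
def simMem (n i : ℕ) (c : TabCfg) (coin used : List Bool) : DiagMem where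
  main := trList [c.p, Nat.pair i c.q]
  n := un n
  st s := encStack (c.st s)
  coin := coin.map bitLetter
  used := used.map bitLetter

/-- The output of the subroutine `ctl` for the table entry `e`. -/
def ctlOut (i e : ℕ) : List ℕ :=
  [e.unpair.1 % 2, e.unpair.1 / 2 % 2, e.unpair.1 / 4 % 2,
    if e.unpair.1 / 2 % 2 = 1 then 0 else e.unpair.2.unpair.1, Nat.pair i e.unpair.2.unpair.2]

theorem ne_cons_of_mem_trNat {n : ℕ} {a : Γ'} (h : a ∈ trNat n) : a ≠ .cons := by
  rintro rfl
  simpa [natEnd] using trNat_natEnd n _ h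

/-- The push of the simulated machine: the number on top of `main` is moved to a simulated stack. -/
theorem diag_mv (b : Bool) (m : DiagMem) (l r : List Γ') (hl : ∀ a ∈ l, a ≠ .cons) :
    DLeads code (l.length + 1) (.mv b) {m with main := l ++ .cons :: r}
      (DAt code .inner {m with
        main := .cons :: r
        st := Function.update m.st b (l.reverse ++ m.st b)}) := by
  induction l generalizing m with
  | nil =>
    refine DLeads.step (.refl _ _) fun v => ⟨(some .cons, v.2), ?_⟩
    simp [diagStmt]
  | cons a l ih =>
    have ha := hl a List.mem_cons_self
    have := ih {m with st := Function.update m.st b (a :: m.st b)}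
      fun a' h => hl a' (List.mem_cons_of_mem _ h)
    simp only [Function.update_idem, Function.update_self] at this
    have h2 := DLeads.step (l := .mv b) (m := {m with main := a :: l ++ .cons :: r}) this
      fun v => ⟨(some a, v.2), by simp [diagStmt, beq_false_of_ne ha]⟩
    simpa using h2

/-- The pop of the simulated machine: the topmost number of a simulated stack is moved to `main`. -/
theorem diag_pp (b : Bool) (m : DiagMem) (l r : List Γ') (hl : ∀ a ∈ l, a ≠ .cons)
    (hm : m.st b = l ++ .cons :: r) :
    DLeads code (l.length + 1) (.pp b) m
      (DAt code .inner {m with main := l.reverse ++ m.main, st := Function.update m.st b r}) := by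
  induction l generalizing m with
  | nil =>
    refine DLeads.step (.refl _ _) fun v => ⟨(some .cons, v.2), ?_⟩
    simp [diagStmt, hm]
  | cons a l ih =>
    have ha := hl a List.mem_cons_self
    have := ih {m with main := a :: m.main, st := Function.update m.st b (l ++ .cons :: r)}
      (fun a' h => hl a' (List.mem_cons_of_mem _ h)) (by simp)
    simp only [Function.update_idem] at this
    have h2 := DLeads.step (l := .pp b) (m := m) this
      fun v => ⟨(some a, v.2), by simp [diagStmt, hm, beq_false_of_ne ha]⟩
    simpa using h2

theorem encStack_update (st : Bool → List ℕ) (s : Bool) (l : List ℕ) :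
    (fun s' => encStack (Function.update st s l s')) =
      Function.update (fun s' => encStack (st s')) s (encStack l) := by
  funext s'
  by_cases h : s' = s
  · subst h; simp
  · simp [h]

/-- After the call of `ctl`, the action is carried out. -/
theorem diag_fin {n i N e : ℕ} (c : TabCfg) (coin used : List Bool)
    (hst : ∀ s, ∀ y ∈ c.st s, y < N) (C : ℕ) (hC : ∀ y < N, (trNat y).length ≤ C) :
    (∀ a, c.act (.ofNat e) = .inl a →
      DLeads code (C + 5) .fin {simMem n i c coin used with main := trList (ctlOut i e)}
        (DAns code (!a))) ∧
    ∀ c', c.act (.ofNat e) = .inr c' → (∀ s, ∀ y ∈ c'.st s, y < N) →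
      DLeads code (C + 5) .fin {simMem n i c coin used with main := trList (ctlOut i e)}
        (DAt code .inner (simMem n i c' coin used)) := by
  have hmod : ∀ k, k % 2 = 0 ∨ k % 2 = 1 := fun k => by omega
  have t0 : trNat 0 = [] := by simp [trNat, trNum]
  have t1 : trNat 1 = [.bit1] := rfl
  have hb : (Γ'.bit1 == Γ'.cons) = false := rfl
  constructor
  · intro a ha
    rw [TabAct.ofNat] at ha
    split_ifs at ha with h1 h2
    · cases ha
      refine Leads.mono (B := 1 + 1) (DLeads.step (l' := .ans) (m' := {simMem n i c coin used with
        main := trList (ctlOut i e).tail}) (.ans fun v => ?_) fun v => ⟨(some .cons, v.2), ?_⟩)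
        (by omega)
      · refine ⟨{simMem n i c coin used with main := (trList (ctlOut i e).tail).tail}.stk, ?_⟩
        rcases hmod (e.unpair.1 / 2) with h | h <;> simp [diagStmt, ctlOut, h, t0, t1, hb]
      · simp [diagStmt, ctlOut, h1, t1, hb]
    all_goals cases ha
  · intro c' hc' hst'
    rw [TabAct.ofNat] at hc'
    split_ifs at hc' with h1 h2
    · cases hc'
    · cases hc'
      have h1 : e.unpair.1 % 2 = 0 := by omega
      generalize hs : decide (e.unpair.1 / 4 % 2 = 1) = s at *
      have hpp : DLeads code (C + 1) (.pp s) {simMem n i c coin used with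
          main := .cons :: trList [Nat.pair i e.unpair.2.unpair.2]}
          (DAt code .inner (simMem n i ⟨e.unpair.2.unpair.2, (c.st s).headD 0,
            Function.update c.st s (c.st s).tail⟩ coin used)) := by
        rcases hcs : c.st s with _ | ⟨y, l⟩
        · refine Leads.mono (B := 0 + 1) (DLeads.step (.refl _ _) fun v => ⟨(none, v.2), ?_⟩)
            (by omega)
          simp [diagStmt, simMem, hcs, encStack_nil, encStack_update, t0]
        · have := diag_pp (code := code) s {simMem n i c coin used with
            main := .cons :: trList [Nat.pair i e.unpair.2.unpair.2]} (trNat y).reverse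
            (encStack l) (fun a ha => ne_cons_of_mem_trNat (List.mem_reverse.1 ha))
            (by simp [simMem, hcs, encStack_cons])
          refine Leads.mono ?_ (Nat.succ_le_succ (hC y (hst s y (by simp [hcs]))))
          simpa [simMem, encStack_update] using this
      have h4 : DLeads code (C + 1 + 1) (.side true) {simMem n i c coin used with
          main := trList [e.unpair.1 / 4 % 2, 0, Nat.pair i e.unpair.2.unpair.2]} (DAt code .inner
          (simMem n i ⟨e.unpair.2.unpair.2, (c.st s).headD 0,
            Function.update c.st s (c.st s).tail⟩ coin used)) := by
        cases s
        · have h0 : e.unpair.1 / 4 % 2 = 0 := by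
            have := of_decide_eq_false hs; omega
          exact hpp.step fun v => ⟨(some .cons, v.2), by simp [diagStmt, h0, t0]⟩
        · have h0 : e.unpair.1 / 4 % 2 = 1 := of_decide_eq_true hs
          exact hpp.step fun v => ⟨(some .cons, v.2), by simp [diagStmt, h0, t0, t1, hb]⟩
      have h5 : DLeads code (C + 1 + 1 + 1) .op {simMem n i c coin used with
          main := trList [1, e.unpair.1 / 4 % 2, 0, Nat.pair i e.unpair.2.unpair.2]} _ :=
        h4.step fun v => ⟨(some .cons, v.2), by simp [diagStmt, t0, t1, hb]⟩
      exact Leads.mono (DLeads.step (m := {simMem n i c coin used with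
        main := trList (ctlOut i e)}) h5 fun v => ⟨(some .cons, v.2), by
          simp [diagStmt, ctlOut, h1, h2, t0, t1]⟩) (by omega : C + 1 + 1 + 1 + 1 ≤ _)
    · cases hc'
      have h1 : e.unpair.1 % 2 = 0 := by omega
      have h2 : e.unpair.1 / 2 % 2 = 0 := by omega
      generalize hs : decide (e.unpair.1 / 4 % 2 = 1) = s at *
      generalize hy : e.unpair.2.unpair.1 = y at *
      have hmv := diag_mv (code := code) s {simMem n i c coin used with
        st := Function.update (fun s => encStack (c.st s)) s (.cons :: encStack (c.st s))} (trNat y)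
        (trList [Nat.pair i e.unpair.2.unpair.2]) fun a => ne_cons_of_mem_trNat
      have hmv : DLeads code (C + 1) (.mv s) {simMem n i c coin used with
          main := trList [y, Nat.pair i e.unpair.2.unpair.2]
          st := Function.update (fun s => encStack (c.st s)) s (.cons :: encStack (c.st s))}
          (DAt code .inner (simMem n i ⟨e.unpair.2.unpair.2, 0,
            Function.update c.st s (y :: c.st s)⟩ coin used)) := by
        refine Leads.mono ?_ (Nat.succ_le_succ (hC y (hst' s y (by simp))))
        simpa [simMem, encStack_update, encStack_cons, t0] using hmv
      have h4 : DLeads code (C + 1 + 1) (.side false) {simMem n i c coin used with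
          main := trList [e.unpair.1 / 4 % 2, y, Nat.pair i e.unpair.2.unpair.2]} (DAt code .inner
          (simMem n i ⟨e.unpair.2.unpair.2, 0, Function.update c.st s (y :: c.st s)⟩
            coin used)) := by
        cases s
        · have h0 : e.unpair.1 / 4 % 2 = 0 := by
            have := of_decide_eq_false hs; omega
          exact hmv.step fun v => ⟨(some .cons, v.2), by simp [diagStmt, simMem, h0, t0]⟩
        · have h0 : e.unpair.1 / 4 % 2 = 1 := of_decide_eq_true hs
          exact hmv.step fun v => ⟨(some .cons, v.2), by simp [diagStmt, simMem, h0, t1, hb]⟩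
      have h5 : DLeads code (C + 1 + 1 + 1) .op {simMem n i c coin used with
          main := trList [0, e.unpair.1 / 4 % 2, y, Nat.pair i e.unpair.2.unpair.2]} _ :=
        h4.step fun v => ⟨(some .cons, v.2), by simp [diagStmt, t0]⟩
      exact Leads.mono (DLeads.step (m := {simMem n i c coin used with
        main := trList (ctlOut i e)}) h5 fun v => ⟨(some .cons, v.2), by
          simp [diagStmt, ctlOut, h1, h2, hy, t0]⟩) (by omega : C + 1 + 1 + 1 + 1 ≤ _)

/-- One step of the simulated machine takes a time that depends only on its table. -/
theorem diag_inner (hctl : ∀ b p x, (code .ctl).eval [b, p, x] =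
      pure (ctlOut x.unpair.1 (tabEntry x.unpair.1 b p x.unpair.2))) {i N : ℕ}
    (hN : ∀ b c c', TabCfg.Below N c → tabStep i b c = .inr c' → c'.Below N) :
    ∃ C, ∀ n c b coin used, TabCfg.Below N c →
      (∀ a, tabStep i b c = .inl a →
        DLeads code C .inner (simMem n i c (b :: coin) used) (DAns code (!a))) ∧
      ∀ c', tabStep i b c = .inr c' → DLeads code C .inner (simMem n i c (b :: coin) used)
        (DAt code .inner (simMem n i c' coin (b :: used))) := by
  choose T hT using fun b p x => exists_evalsIn (hctl b p x)
  let D := (Finset.range N).sup fun y => (trNat y).length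
  let E := (Finset.univ : Finset Bool).sup fun b => (Finset.range N).sup fun p =>
    (Finset.range N).sup fun q => T b.toNat p (Nat.pair i q)
  have hD : ∀ y < N, (trNat y).length ≤ D := fun y hy =>
    Finset.le_sup (f := fun y => (trNat y).length) (Finset.mem_range.2 hy)
  have hE : ∀ b : Bool, ∀ p < N, ∀ q < N, T b.toNat p (Nat.pair i q) ≤ E := fun b p hp q hq =>
    ((Finset.le_sup (f := fun q => T b.toNat p (Nat.pair i q)) (Finset.mem_range.2 hq)).trans
      (Finset.le_sup (f := fun p => (Finset.range N).sup fun q => T b.toNat p (Nat.pair i q))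
        (Finset.mem_range.2 hp))).trans
      (Finset.le_sup (f := fun b : Bool => (Finset.range N).sup fun p =>
        (Finset.range N).sup fun q => T b.toNat p (Nat.pair i q)) (Finset.mem_univ b))
  refine ⟨D + 5 + E + 1, fun n c b coin used hc => ?_⟩
  have hcall : ∀ P, DLeads code (D + 5) .fin {simMem n i c coin (b :: used) with
      main := trList (ctlOut i (tabEntry i b.toNat c.p c.q))} P →
      DLeads code (D + 5 + E + 1) .inner (simMem n i c (b :: coin) used) P := fun P h => by
    have ht := hT b.toNat c.p (Nat.pair i c.q)
    rw [Nat.unpair_pair] at ht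
    have h' := DLeads.call (s := .ctl) (by simp) (l := .inner)
      (m₀ := simMem n i c (b :: coin) used) h ht fun x => ⟨x.2, by
        have t0 : trNat 0 = [] := by simp [trNat, trNum]
        have t1 : trNat 1 = [.bit1] := rfl
        have hb : (Γ'.bit0 == Γ'.bit1) = false := rfl
        cases b <;> simp [diagStmt, simMem, bitLetter, t0, t1, hb]⟩
    exact Leads.mono h' (by have := hE b _ hc.2.1 _ hc.1; omega)
  have hfin := diag_fin (code := code) (n := n) (i := i) (e := tabEntry i b.toNat c.p c.q) c coin
    (b :: used) hc.2.2 D hD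
  exact ⟨fun a ha => hcall _ (hfin.1 a ha), fun c' hc' =>
    hcall _ (hfin.2 c' hc' (hN b c c' hc hc').2.2)⟩

end Diag

/-! ### The enumeration of coin sequences -/

/-- The successor of a coin sequence, last coin first: binary increment, which makes a sequence of
ones into a longer sequence of zeros. -/
def incBits : List Bool → List Bool
  | [] => [false]
  | true :: r => false :: incBits r
  | false :: r => true :: r

/-- The position of a coin sequence, last coin first, in the enumeration by `incBits`. -/
def bitsVal : List Bool → ℕ
  | [] => 1
  | b :: r => 2 * bitsVal r + b.toNat

theorem bitsVal_pos (r : List Bool) : 0 < bitsVal r := by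
  induction r with
  | nil => exact Nat.one_pos
  | cons b r ih => simp only [bitsVal]; omega

theorem bitsVal_incBits (r : List Bool) : bitsVal (incBits r) = bitsVal r + 1 := by
  induction r with
  | nil => rfl
  | cons b r ih => cases b <;> simp [incBits, bitsVal, ih]; omega

theorem bitsVal_injective : Function.Injective bitsVal := by
  intro r
  induction r with
  | nil =>
    rintro (_ | ⟨b, r'⟩) h
    · rfl
    · have := bitsVal_pos r'; simp only [bitsVal] at h; omega
  | cons b r ih =>
    have := bitsVal_pos r
    rintro (_ | ⟨b', r'⟩) h
    · simp only [bitsVal] at h; omega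
    · simp only [bitsVal] at h
      have hb : b = b' := by cases b <;> cases b' <;> simp at h ⊢ <;> omega
      subst hb
      rw [ih (a₂ := r') (by omega)]

theorem two_pow_length_le_bitsVal (r : List Bool) : 2 ^ r.length ≤ bitsVal r := by
  induction r with
  | nil => exact le_rfl
  | cons b r ih => simp only [bitsVal, List.length_cons, pow_succ]; omega

theorem bitsVal_lt_two_pow (r : List Bool) : bitsVal r < 2 ^ (r.length + 1) := by
  induction r with
  | nil => exact Nat.one_lt_two
  | cons b r ih =>
    have := b.toNat_lt
    simp only [bitsVal, List.length_cons] at ih ⊢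
    rw [pow_succ]; omega

theorem length_le_of_bitsVal_le {r r' : List Bool} (h : bitsVal r ≤ bitsVal r') :
    r.length ≤ r'.length := by
  have := ((two_pow_length_le_bitsVal r).trans h).trans_lt (bitsVal_lt_two_pow r')
  have := (Nat.pow_lt_pow_iff_right Nat.one_lt_two).1 this
  omega

theorem length_tabStep {i : ℕ} {b : Bool} {c c' : TabCfg} (h : tabStep i b c = .inr c') :
    (c'.st true).length + (c'.st false).length ≤
      (c.st true).length + (c.st false).length + 1 := by
  rw [tabStep] at h
  generalize TabAct.ofNat (tabEntry i b.toNat c.p c.q) = e at h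
  rcases e with a | ⟨s, y, q⟩ | ⟨s, q⟩
  · cases h
  · cases h; cases s <;> simp <;> omega
  · cases h; cases s <;> simp <;> omega

section Diag

open ToPartrec PartrecToTM2 DiagCmd

variable {code : Site → Code}

/-! ### The search for a halting coin sequence -/

theorem diag_clear (b : Bool) (m : DiagMem) (l : List Γ') :
    DLeads code (l.length + 1) (.clear b) {m with st := Function.update m.st b l}
      (DAt code (cond b (.clear false) .copy) {m with st := Function.update m.st b []}) := by
  induction l with
  | nil => exact DLeads.step (.refl _ _) fun v => ⟨(none, v.2), by simp [diagStmt]⟩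
  | cons a l ih => exact ih.step fun v => ⟨(some a, v.2), by simp [diagStmt]⟩

theorem diag_copy (m : DiagMem) (k j : ℕ) (l : List ℕ) :
    DLeads code (k + 1) .copy {m with
      n := un k, n2 := un j, st := Function.update m.st true (encStack l)}
      (DAt code .uncopy {m with
        n := [], n2 := un (j + k),
        st := Function.update m.st true (encStack (List.replicate k 1 ++ l))}) := by
  induction k generalizing j l with
  | zero => exact DLeads.step (.refl _ _) fun v => ⟨(none, v.2), by simp [diagStmt]⟩
  | succ k ih =>
    have t1 : trNat 1 = [.bit1] := rfl
    have := ih (j + 1) (1 :: l)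
    rw [show j + 1 + k = j + (k + 1) by ring, show List.replicate k 1 ++ 1 :: l =
      List.replicate (k + 1) 1 ++ l by rw [List.replicate_succ']; simp] at this
    exact this.step fun v => ⟨(some .bit1, v.2), by
      simp [diagStmt, List.replicate_succ, encStack_cons, t1]⟩

theorem diag_uncopy (m : DiagMem) (k j : ℕ) :
    DLeads code (k + 1) .uncopy {m with n := un j, n2 := un k}
      (DAt code .inc {m with n := un (j + k), n2 := []}) := by
  induction k generalizing j with
  | zero => exact DLeads.step (.refl _ _) fun v => ⟨(none, v.2), by simp [diagStmt]⟩
  | succ k ih =>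
    have := ih (j + 1)
    rw [show j + 1 + k = j + (k + 1) by ring] at this
    exact this.step fun v => ⟨(some .bit1, v.2), by simp [diagStmt, List.replicate_succ]⟩

theorem diag_inc0 (m : DiagMem) (r u : List Bool) :
    DLeads code (r.length + 1) .inc0 {m with
      used := r.map bitLetter, coin := u.map bitLetter}
      (DAt code .inner {m with used := [], coin := (r.reverse ++ u).map bitLetter}) := by
  induction r generalizing u with
  | nil => exact DLeads.step (.refl _ _) fun v => ⟨(none, v.2), by simp [diagStmt]⟩
  | cons b r ih =>
    have := ih (b :: u)
    rw [show r.reverse ++ b :: u = (b :: r).reverse ++ u by simp] at this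
    exact this.step fun v => ⟨(some (bitLetter b), v.2), by simp [diagStmt]⟩

/-- The next coin sequence is computed while the used coins are moved back to `coin`. -/
theorem diag_inc (m : DiagMem) (r u : List Bool) :
    DLeads code (r.length + 1) .inc {m with
      used := r.map bitLetter, coin := u.map bitLetter}
      (DAt code .inner {m with
        used := [], coin := ((incBits r).reverse ++ u).map bitLetter}) := by
  have hb : (Γ'.bit0 == Γ'.bit1) = false := rfl
  induction r generalizing u with
  | nil => exact DLeads.step (.refl _ _) fun v => ⟨(none, v.2), by
      simp [diagStmt, incBits, bitLetter]⟩
  | cons b r ih =>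
    cases b with
    | true =>
      have := ih (false :: u)
      rw [show (incBits r).reverse ++ false :: u = (incBits (true :: r)).reverse ++ u by
        simp [incBits]] at this
      exact this.step fun v => ⟨(some .bit1, v.2), by simp [diagStmt, bitLetter]⟩
    | false =>
      have := diag_inc0 (code := code) m r (true :: u)
      rw [show r.reverse ++ true :: u = (incBits (false :: r)).reverse ++ u by
        simp [incBits]] at this
      exact this.step fun v => ⟨(some .bit0, v.2), by simp [diagStmt, bitLetter, hb]⟩

/-- After the call of `rst`, the simulation starts again with the next coin sequence. -/
theorem diag_restart (n i : ℕ) (S : Bool → List Γ') (r : List Bool) :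
    DLeads code ((S true).length + (S false).length + 2 * n + r.length + 5) (.clear true)
      {main := trList [0, Nat.pair i 0], n := un n, st := S, used := r.map bitLetter}
      (DAt code .inner (simMem n i (tabInit n) (incBits r).reverse [])) := by
  have t0 : trNat 0 = [] := by simp [trNat, trNum]
  let m : DiagMem := {main := trList [0, Nat.pair i 0], n := un n, st := S, used := r.map bitLetter}
  have h1 := diag_clear (code := code) true m (S true)
  have h2 := diag_clear (code := code) false {m with st := Function.update S true []} (S false)
  have h3 := diag_copy (code := code) {m with st := fun _ => []} n 0 []
  let S' := Function.update (fun _ => []) true (encStack (List.replicate n 1))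
  have h4 := diag_uncopy (code := code) {m with st := S'} n 0
  have h5 := diag_inc (code := code) {m with st := S'} r []
  simp only [m, S', cond_true, cond_false, Function.update_eq_self, zero_add, List.append_nil,
    List.map_nil] at h1 h2 h3 h4 h5
  have e1 : Function.update (Function.update S true []) false (S false) =
    Function.update S true [] := by funext b; cases b <;> simp
  have e2 : Function.update (Function.update S true []) false [] =
    Function.update (fun _ => []) true [] := by funext b; cases b <;> simp
  rw [e1, e2] at h2
  have h := h1.trans (h2.trans (h3.trans (h4.trans h5)))
  have e3 : Function.update (fun _ => []) true (encStack (List.replicate n 1)) =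
      fun s => encStack ((tabInit n).st s) := by
    funext b; cases b <;> simp [tabInit, encStack_nil]
  rw [e3] at h
  exact Leads.mono h (by omega)

/-- The simulation of a table machine with a given coin sequence takes linear time, and it does not
increase the stacks of the simulated machine faster than that machine does. -/
theorem diag_tabRun {i N C : ℕ}
    (hN : ∀ b c c', TabCfg.Below N c → tabStep i b c = .inr c' → c'.Below N)
    (hC : ∀ n c b coin used, TabCfg.Below N c →
      (∀ a, tabStep i b c = .inl a →
        DLeads code C .inner (simMem n i c (b :: coin) used) (DAns code (!a))) ∧
      ∀ c', tabStep i b c = .inr c' → DLeads code C .inner (simMem n i c (b :: coin) used)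
        (DAt code .inner (simMem n i c' coin (b :: used))))
    (n : ℕ) (u used : List Bool) (c : TabCfg) (hc : c.Below N) :
    (∀ a, tabRun i u c = .inl a →
      DLeads code (C * u.length) .inner (simMem n i c u used) (DAns code (!a))) ∧
    ∀ c', tabRun i u c = .inr c' →
      DLeads code (C * u.length) .inner (simMem n i c u used)
        (DAt code .inner (simMem n i c' [] (u.reverse ++ used))) ∧
      c'.Below N ∧ (c'.st true).length + (c'.st false).length ≤
        (c.st true).length + (c.st false).length + u.length := by
  induction u generalizing c used with
  | nil =>
    refine ⟨fun a h => by simp [tabRun] at h, fun c' h => ?_⟩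
    obtain rfl : c = c' := by simpa [tabRun] using h
    exact ⟨.refl _ _, hc, by simp⟩
  | cons b u ih =>
    obtain ⟨h1, h2⟩ := hC n c b u used hc
    simp only [tabRun]
    rcases hs : tabStep i b c with a | c₁
    · refine ⟨fun a' h => ?_, fun c' h => by simp at h⟩
      obtain rfl : a = a' := by simpa using h
      exact Leads.mono (h1 a hs) (by simp [mul_add])
    · obtain ⟨ih1, ih2⟩ := ih (b :: used) c₁ (hN b c c₁ hc hs)
      have hl := length_tabStep hs
      refine ⟨fun a h => ?_, fun c' h => ?_⟩
      · exact Leads.mono ((h2 c₁ hs).trans (ih1 a h)) (by simp [mul_add, add_comm])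
      · obtain ⟨h3, h4, h5⟩ := ih2 c' h
        refine ⟨?_, h4, by simp only [List.length_cons]; omega⟩
        rw [show (b :: u).reverse ++ used = u.reverse ++ b :: used by simp]
        exact Leads.mono ((h2 c₁ hs).trans h3) (by simp [mul_add, add_comm])

theorem length_encStack_le {C : ℕ} (l : List ℕ) (h : ∀ y ∈ l, (trNat y).length ≤ C) :
    (encStack l).length ≤ (C + 1) * l.length := by
  induction l with
  | nil => simp [encStack_nil]
  | cons y l ih =>
    have h1 := h y List.mem_cons_self
    have h2 := ih fun z hz => h z (List.mem_cons_of_mem _ hz)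
    rw [encStack_cons, List.length_append, List.length_cons, List.length_cons, mul_add]
    simp only [List.length_reverse]
    omega

/-- The simulation with one coin sequence: either the simulated machine halts, or the simulation
starts again with the next coin sequence. -/
theorem diag_round (hctl : ∀ b p x, (code .ctl).eval [b, p, x] =
      pure (ctlOut x.unpair.1 (tabEntry x.unpair.1 b p x.unpair.2)))
    (hrst : ∀ b p x, (code .rst).eval [b, p, x] = pure [0, Nat.pair x.unpair.1 0]) (i : ℕ) :
    ∃ C, ∀ n r,
      (∀ a, tabRun i r.reverse (tabInit n) = .inl a →
        DLeads code (C * (r.length + n + 1)) .inner (simMem n i (tabInit n) r.reverse [])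
          (DAns code (!a))) ∧
      ∀ c', tabRun i r.reverse (tabInit n) = .inr c' →
        DLeads code (C * (r.length + n + 1)) .inner (simMem n i (tabInit n) r.reverse [])
          (DAt code .inner (simMem n i (tabInit n) (incBits r).reverse [])) := by
  obtain ⟨N, hN2, hN⟩ := exists_tab_bound i
  obtain ⟨C, hC⟩ := diag_inner hctl hN
  choose T hT using fun b p x => exists_evalsIn (hrst b p x)
  let D := (Finset.range N).sup fun y => (trNat y).length
  let E := (Finset.range N).sup fun p => (Finset.range N).sup fun q => T 0 p (Nat.pair i q)
  have hD : ∀ y < N, (trNat y).length ≤ D := fun y hy =>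
    Finset.le_sup (f := fun y => (trNat y).length) (Finset.mem_range.2 hy)
  have hE : ∀ p < N, ∀ q < N, T 0 p (Nat.pair i q) ≤ E := fun p hp q hq =>
    (Finset.le_sup (f := fun q => T 0 p (Nat.pair i q)) (Finset.mem_range.2 hq)).trans
      (Finset.le_sup (f := fun p => (Finset.range N).sup fun q => T 0 p (Nat.pair i q))
        (Finset.mem_range.2 hp))
  have hinit : ∀ n, (tabInit n).Below N := fun n => ⟨by simp [tabInit]; omega,
    by simp [tabInit]; omega, fun s y hy => by
      cases s
      · simp [tabInit] at hy
      · rw [List.eq_of_mem_replicate hy]; omega⟩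
  refine ⟨C + (D + 1) + E + 8, fun n r => ?_⟩
  obtain ⟨h1, h2⟩ := diag_tabRun hN hC n r.reverse [] (tabInit n) (hinit n)
  refine ⟨fun a ha => Leads.mono (h1 a ha) ?_, fun c' hc' => ?_⟩
  · rw [List.length_reverse]
    exact Nat.mul_le_mul (by omega) (by omega)
  · obtain ⟨h3, ⟨hq, hp, hst⟩, hl⟩ := h2 c' hc'
    have h4 := diag_restart (code := code) n i (fun s => encStack (c'.st s)) r
    have ht := hT 0 c'.p (Nat.pair i c'.q)
    rw [Nat.unpair_pair] at ht
    have h5 := DLeads.call (s := .rst) (by simp) (l := .inner)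
      (m₀ := simMem n i c' [] r) (m :=
        {n := un n, st := fun s => encStack (c'.st s), used := r.map bitLetter}) h4 ht
      fun x => ⟨x.2, by
        have t0 : trNat 0 = [] := by simp [trNat, trNum]
        simp [diagStmt, simMem, t0]⟩
    rw [List.reverse_reverse, List.append_nil] at h3
    refine Leads.mono (h3.trans h5) ?_
    have l1 := length_encStack_le (c'.st true) fun y hy => hD y (hst _ y hy)
    have l2 := length_encStack_le (c'.st false) fun y hy => hD y (hst _ y hy)
    have l3 := hE _ hp _ hq
    have l4 : (c'.st true).length + (c'.st false).length ≤ n + r.length := by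
      simpa [tabInit] using hl
    have l5 := Nat.mul_le_mul_left (D + 1) l4
    rw [List.length_reverse]
    nlinarith [Nat.zero_le (E * (r.length + n)), Nat.zero_le (C * n)]

/-- If some coin sequence makes the simulated machine halt, then a sequence of this kind is found.
-/
theorem diag_search (hctl : ∀ b p x, (code .ctl).eval [b, p, x] =
      pure (ctlOut x.unpair.1 (tabEntry x.unpair.1 b p x.unpair.2)))
    (hrst : ∀ b p x, (code .rst).eval [b, p, x] = pure [0, Nat.pair x.unpair.1 0]) (i : ℕ) :
    ∃ C, ∀ n u a₀, tabRun i u (tabInit n) = .inl a₀ →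
      ∃ a u', tabRun i u' (tabInit n) = .inl a ∧
        DLeads code (C * (2 ^ u.length * (u.length + n + 1))) (.clear true)
          {main := trList [0, Nat.pair i 0], n := un n} (DAns code (!a)) := by
  obtain ⟨C, hC⟩ := diag_round hctl hrst i
  refine ⟨2 * C + 5, fun n u a₀ hu => ?_⟩
  have key : ∀ d r, bitsVal r + d = bitsVal u.reverse → ∃ a u', tabRun i u' (tabInit n) = .inl a ∧
      DLeads code ((d + 1) * (C * (u.length + n + 1))) .inner
        (simMem n i (tabInit n) r.reverse []) (DAns code (!a)) := by
    intro d
    induction d with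
    | zero =>
      intro r hr
      obtain rfl := bitsVal_injective hr
      rw [List.reverse_reverse]
      have := (hC n u.reverse).1 a₀ (by rwa [List.reverse_reverse])
      rw [List.reverse_reverse, List.length_reverse] at this
      exact ⟨a₀, u, hu, Leads.mono this (by simp)⟩
    | succ d ih =>
      intro r hr
      have hl : r.length ≤ u.length := by
        simpa using length_le_of_bitsVal_le (r := r) (r' := u.reverse) (by omega)
      have hl' : C * (r.length + n + 1) ≤ C * (u.length + n + 1) :=
        Nat.mul_le_mul_left _ (by omega)
      rcases ha : tabRun i r.reverse (tabInit n) with a | c'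
      · exact ⟨a, _, ha, Leads.mono ((hC n r).1 a ha)
          (hl'.trans (Nat.le_mul_of_pos_left _ (Nat.succ_pos _)))⟩
      · obtain ⟨a, u', hu', h⟩ := ih (incBits r) (by rw [bitsVal_incBits]; omega)
        exact ⟨a, u', hu', Leads.mono (((hC n r).2 c' ha).trans h) (by nlinarith)⟩
  have hlt := bitsVal_lt_two_pow u.reverse
  rw [List.length_reverse, pow_succ] at hlt
  have hge : 2 ≤ bitsVal u.reverse := by
    rcases u with _ | ⟨b, u⟩
    · simp [tabRun] at hu
    · refine le_trans ?_ (two_pow_length_le_bitsVal _)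
      simp only [List.length_reverse, List.length_cons, pow_succ]
      have := Nat.two_pow_pos u.length
      omega
  obtain ⟨a, u', hu', h⟩ := key (bitsVal u.reverse - 2) [false] (by
    simp only [bitsVal, Bool.toNat_false]; omega)
  have h0 := diag_restart (code := code) n i (fun _ => []) []
  refine ⟨a, u', hu', Leads.mono (h0.trans h) ?_⟩
  have h1 : bitsVal u.reverse - 2 + 1 ≤ 2 * 2 ^ u.length := by omega
  have h2 := Nat.mul_le_mul_right (C * (u.length + n + 1)) h1
  have h3 : u.length + n + 1 ≤ 2 ^ u.length * (u.length + n + 1) :=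
    Nat.le_mul_of_pos_left _ (Nat.two_pow_pos _)
  simp only [List.length_nil]
  nlinarith

/-! ### The language of the diagonalizing machine -/

theorem length_trNat_le (n : ℕ) : (trNat n).length ≤ n := by
  have h : ∀ p : PosNum, (trPosNum p).length ≤ (p : ℕ) := by
    intro p
    induction p with
    | one => exact le_rfl
    | bit0 p ih =>
      have := PosNum.to_nat_pos p
      simp only [trPosNum, List.length_cons, PosNum.cast_bit0]; omega
    | bit1 p ih => simp only [trPosNum, List.length_cons, PosNum.cast_bit1]; omega
  rw [trNat]
  conv_rhs => rw [← Num.to_of_nat n]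
  rcases (n : Num) with _ | p
  · exact le_rfl
  · exact h p

/-- The last preparation before the search: the middle number on `main` is erased, and the
simulation is reset. -/
theorem diag_drop {m : DiagMem} {i B T : ℕ}
    {P : TM2.Cfg DiagΓ (DiagLab code) (Option Γ' × Bool) → Prop}
    (h' : DLeads code B (.clear true) {m with main := trList [0, Nat.pair i 0]} P)
    (hT : EvalsIn (code .rst) [0, 0, Nat.pair i 0] [0, Nat.pair i 0] T)
    (l : List Γ') (hl : ∀ a ∈ l, a ≠ .cons) :
    DLeads code (B + T + 1 + l.length) .drop
      {m with main := l ++ .cons :: trList [Nat.pair i 0]} P := by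
  have t0 : trNat 0 = [] := by simp [trNat, trNum]
  induction l with
  | nil => exact DLeads.call (s := .rst) (by simp) h' hT fun x => ⟨x.2, by simp [diagStmt, t0]⟩
  | cons a l ih =>
    have ha := hl a List.mem_cons_self
    exact (ih fun a' h => hl a' (List.mem_cons_of_mem _ h)).step fun v =>
      ⟨(some a, v.2), by simp [diagStmt, beq_false_of_ne ha]⟩

theorem diag_start (m : ℕ) : (diag code).start (ones m) =
    ⟨some (.inl (.start true)), (none, false), (logMem {} m 0 0 0).stk⟩ := by
  have h0 : (fun _ => [] : ∀ k, List (DiagΓ k)) = DiagMem.stk {} := by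
    funext k; rcases k with k | k <;> cases k <;> rfl
  have h1 : Function.update (fun _ => [] : ∀ k, List (DiagΓ k)) (.inr .x) (un m) =
      (logMem {} m 0 0 0).stk := by
    rw [h0]; exact DiagMem.update_x {} (un m)
  have h2 : (ones m).map (diag code).letter = un m := List.map_replicate
  refine congrArg (TM2.Cfg.mk _ _) (Eq.trans ?_ h1)
  exact congrArg (Function.update (fun _ => [] : ∀ k, List (DiagΓ k)) (.inr .x)) h2

/-- A run from the initial label is a run of the machine on an input `1^m`. -/
theorem exists_answers_run {B m : ℕ} {a : Bool}
    (h : DLeads code B (.start true) (logMem {} m 0 0 0) (DAns code a)) :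
    ∃ T ≤ B, ∀ ω, Answers (diag code).accept a ((diag code).run (ones m) ω T) := by
  obtain ⟨T, hT, c', hc', hP⟩ := h (none, false)
  refine ⟨T, hT, fun ω => ?_⟩
  have e : (diag code).run (ones m) ω T = c' := by
    rw [ProbTM.run_eq_coinRun, diag_start]; exact hc' ω
  rw [e]; exact hP

theorem ProbTM.answers_unique {M : ProbTM} {w : List Bool} {ω : ℕ → Bool} {s t : ℕ} {a b : Bool}
    (ha : Answers M.accept a (M.run w ω s)) (hb : Answers M.accept b (M.run w ω t)) : a = b := by
  rw [run_eq_coinRun] at ha hb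
  rcases le_total s t with h | h
  · rw [coinRun_stable _ h ha.1] at hb; exact ha.2.symm.trans hb.2
  · rw [coinRun_stable _ h hb.1] at ha; exact ha.2.symm.trans hb.2

/-- The diagonalizing machine accepts only the inputs whose length is `tower (t r)` where the flag
`fl r` is set. On such an input it contradicts the table machine that is assigned to `r`, in a time
that is governed by the number of coins after which that machine halts. -/
theorem diag_spec (hctl : ∀ b p x, (code .ctl).eval [b, p, x] =
      pure (ctlOut x.unpair.1 (tabEntry x.unpair.1 b p x.unpair.2)))
    (hrst : ∀ b p x, (code .rst).eval [b, p, x] = pure [0, Nat.pair x.unpair.1 0])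
    {fl x idx : ℕ → ℕ} (hfl : ∀ r, fl r = 0 ∨ fl r = 1) (hfl0 : fl 0 = 0) (hx0 : x 0 = 0)
    (hidx0 : idx 0 = 0)
    (hw : ∀ r, (code .nxt).eval [fl r, x r, Nat.pair (idx r) 0] =
      pure [fl (r + 1), x (r + 1), Nat.pair (idx (r + 1)) 0]) :
    ∃ t : ℕ → ℕ, StrictMono t ∧
      (∀ m ω T, Answers (diag code).accept true ((diag code).run (ones m) ω T) →
        ∃ r, m = tower (t r) ∧ fl r = 1) ∧
      ∀ i, ∃ C, ∀ r, fl r = 1 → idx r = i → ∀ u a₀,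
        tabRun i u (tabInit (firstLog (t r))) = .inl a₀ →
        ∃ a u', tabRun i u' (tabInit (firstLog (t r))) = .inl a ∧
          ∃ T ≤ 24 * tower (t r) + t r + x r +
            C * (2 ^ u.length * (u.length + firstLog (t r) + 1)), ∀ ω,
            Answers (diag code).accept (!a) ((diag code).run (ones (tower (t r))) ω T) := by
  obtain ⟨t, ht, hproc⟩ := diag_proc hw
  have t0 : trNat 0 = [] := by simp [trNat, trNum]
  have t1 : trNat 1 = [.bit1] := rfl
  have hb : (Γ'.bit1 == Γ'.cons) = false := rfl
  let mem : ℕ → DiagMem := fun s => {logMem {} 0 0 s (firstLog s) with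
    main := trList [fl 0, x 0, Nat.pair (idx 0) 0]}
  have htower : ∀ s, DLeads code (24 * tower s + 6) (.start true) (logMem {} (tower s) 0 0 0)
      (DAt code .beep (mem s)) := fun s => by
    have := (diag_tower (code := code) true {} (tower s) 0 0).1 s rfl
    have e : trList [fl 0, x 0, Nat.pair (idx 0) 0] = [.cons, .cons, .cons] := by
      simp [hfl0, hx0, hidx0, t0, Nat.pair]
    simp only [mem, e]
    simpa using this
  let mem' : ℕ → DiagMem := fun r =>
    {n := un (firstLog (t r)), main := trList [fl r, x r, Nat.pair (idx r) 0]}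
  have hflag : ∀ r, DLeads code (24 * tower (t r) + 6 + (t r + 2)) (.start true)
      (logMem {} (tower (t r)) 0 0 0) (DAt code .flag (mem' r)) := fun r =>
    (htower (t r)).trans ((hproc (logMem {} 0 0 (t r) (firstLog (t r))) (t r)).1 r rfl)
  refine ⟨t, ht, fun m ω T hT => ?_, fun i => ?_⟩
  · have hno : ∀ B, ¬ DLeads code B (.start true) (logMem {} m 0 0 0) (DAns code false) :=
      fun B h => by
        obtain ⟨T', -, hT'⟩ := exists_answers_run h
        exact absurd (ProbTM.answers_unique hT (hT' ω)) (by simp)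
    by_cases hm : ∃ s, m = tower s
    · obtain ⟨s, rfl⟩ := hm
      by_cases hs : ∃ r, s = t r
      · obtain ⟨r, rfl⟩ := hs
        refine ⟨r, rfl, (hfl r).resolve_left fun h0 => ?_⟩
        refine hno _ ((hflag r).trans (DLeads.ans (m := mem' r) fun v =>
          ⟨{mem' r with main := (mem' r).main.tail}.stk, ?_⟩))
        simp [diagStmt, mem', h0, t0]
      · push Not at hs
        exact absurd ((htower s).trans ((hproc (logMem {} 0 0 s (firstLog s)) s).2 hs)) (hno _)
    · push Not at hm
      obtain ⟨B, hB⟩ := (diag_tower (code := code) true {} m 0 0).2 hm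
      exact absurd hB (hno B)
  · obtain ⟨C, hC⟩ := diag_search hctl hrst i
    have hr := hrst 0 0 (Nat.pair i 0)
    rw [Nat.unpair_pair] at hr
    obtain ⟨T, hT⟩ := exists_evalsIn hr
    refine ⟨C + T + 10, fun r hr1 hri u a₀ hu => ?_⟩
    obtain ⟨a, u', hu', h⟩ := hC _ u a₀ hu
    refine ⟨a, u', hu', ?_⟩
    have h1 := diag_drop (m := {n := un (firstLog (t r))}) h hT (trNat (x r))
      fun b => ne_cons_of_mem_trNat
    have h2 := DLeads.step (l := .flag) (m := mem' r) h1 fun v => ⟨(some .cons, v.2), by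
      simp [diagStmt, mem', hr1, hri, t1, hb]⟩
    obtain ⟨T', hT', h3⟩ := exists_answers_run ((hflag r).trans h2)
    refine ⟨T', hT'.trans ?_, h3⟩
    have hl := length_trNat_le (x r)
    have hp : 1 ≤ 2 ^ u.length * (u.length + firstLog (t r) + 1) :=
      Nat.mul_pos (Nat.two_pow_pos _) (Nat.succ_pos _)
    have := Nat.mul_le_mul_left (T + 10) hp
    rw [show C + T + 10 = C + (T + 10) by ring, add_mul C]
    omega

end Diag

/-! ### Two-stack machines and their tables -/

/-- An action of a machine with two stacks, with states `Q` and symbols `Y`: halt with an answer,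
push a symbol or pop a symbol, and go on in a new state. -/
inductive StkAct (Q Y : Type)
  | halt (a : Bool)
  | push (s : Bool) (y : Y) (q : Q)
  | pop (s : Bool) (q : Q)

/-- The configurations of a machine with two stacks: the state, the symbol that the last step has
popped, and the stacks. -/
structure StkCfg (Q Y : Type) where
  q : Q
  p : Option Y
  st : Bool → List Y

section StkMachine

variable {Q Y : Type}

/-- The state after an action, if there is one, lies in `S`. -/
def StkAct.NextIn (S : Set Q) : StkAct Q Y → Prop
  | .halt _ => True
  | .push _ _ q => q ∈ S
  | .pop _ q => q ∈ S

/-- Carry out an action. -/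
def StkCfg.act (c : StkCfg Q Y) : StkAct Q Y → Bool ⊕ StkCfg Q Y
  | .halt a => .inl a
  | .push s y q => .inr ⟨q, none, Function.update c.st s (y :: c.st s)⟩
  | .pop s q => .inr ⟨q, (c.st s).head?, Function.update c.st s (c.st s).tail⟩

/-- The run of a machine with two stacks on a finite sequence of coins: its answer, or the
configuration that it has reached. -/
def stkRun (δ : Bool → Option Y → Q → StkAct Q Y) : List Bool → StkCfg Q Y → Bool ⊕ StkCfg Q Y
  | [], c => .inr c
  | b :: u, c => match c.act (δ b c.p c.q) with
    | .inl a => .inl a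
    | .inr c' => stkRun δ u c'

/-- A finite set can be numbered such that a given element gets the number `0`. -/
theorem exists_injOn_nat {α : Type} {S : Set α} (hS : S.Finite) (a₀ : α) :
    ∃ f : α → ℕ, Set.InjOn f S ∧ f a₀ = 0 := by
  obtain ⟨f, hf⟩ := Set.countable_iff_exists_injOn.1 hS.countable
  refine ⟨fun a => Equiv.swap (f a₀) 0 (f a), fun a ha b hb h => ?_, Equiv.swap_apply_left _ _⟩
  exact hf ha hb ((Equiv.swap (f a₀) 0).injective h)

/-- A machine with two stacks and with finitely many symbols and reachable states is represented by
a table. -/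
theorem exists_table [Finite Y] (δ : Bool → Option Y → Q → StkAct Q Y) {S : Set Q} (hS : S.Finite)
    (hδ : ∀ b p, ∀ q ∈ S, (δ b p q).NextIn S) (q₀ : Q) (h₀ : q₀ ∈ S) (y₁ : Y) :
    ∃ i, ∀ u n a, tabRun i u (tabInit n) = .inl a ↔
      stkRun δ u ⟨q₀, none, fun s => cond s (List.replicate n y₁) []⟩ = .inl a := by
  obtain ⟨f, hf, hf0⟩ := exists_injOn_nat hS q₀
  obtain ⟨g, hg, hg0⟩ := exists_injOn_nat (Set.finite_univ (α := Y)) y₁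
  have hginj : Function.Injective g := fun a b => hg trivial trivial
  let o : Option Y → ℕ := fun p => (p.map fun y => g y + 1).getD 0
  have ho : Function.Injective o := by
    rintro (_ | a) (_ | b) h <;> simp [o] at h ⊢
    exact hginj h
  let e : StkAct Q Y → TabAct
    | .halt a => .halt a
    | .push s y q => .push s (g y + 1) (f q)
    | .pop s q => .pop s (f q)
  let key : Bool × Option Y × S → ℕ := fun x =>
    Nat.pair x.1.toNat (Nat.pair (o x.2.1) (f x.2.2))
  have hkey : Function.Injective key := by
    rintro ⟨b, p, q⟩ ⟨b', p', q'⟩ h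
    simp only [key, Nat.pair_eq_pair] at h
    obtain ⟨h1, h2, h3⟩ := h
    have hb : b = b' := by cases b <;> cases b' <;> simp at h1 ⊢
    rw [hb, ho h2, Subtype.ext (hf q.2 q'.2 h3)]
  have : Finite S := hS
  obtain ⟨K, hK⟩ := (Set.finite_range key).bddAbove
  let F := Function.extend key (fun x => (e (δ x.1 x.2.1 x.2.2)).toNat) 0
  refine ⟨Encodable.encode ((List.range (K + 1)).map F), fun u n a => ?_⟩
  set i := Encodable.encode ((List.range (K + 1)).map F)
  have hent : ∀ b p q, q ∈ S → TabAct.ofNat (tabEntry i b.toNat (o p) (f q)) = e (δ b p q) := by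
    intro b p q hq
    have hlt : key (b, p, ⟨q, hq⟩) < K + 1 := Nat.lt_succ_of_le (hK ⟨_, rfl⟩)
    have h1 : tabEntry i b.toNat (o p) (f q) = F (key (b, p, ⟨q, hq⟩)) := by
      rw [tabEntry, Denumerable.ofNat_encode, List.getD_eq_getElem?_getD]
      change (((List.range (K + 1)).map F)[key (b, p, ⟨q, hq⟩)]?).getD 0 = _
      rw [List.getElem?_map, List.getElem?_range hlt]
      rfl
    rw [h1, show F (key (b, p, ⟨q, hq⟩)) = _ from hkey.extend_apply _ _ _, TabAct.ofNat_toNat]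
  let E : StkCfg Q Y → TabCfg := fun c => ⟨f c.q, o c.p, fun s => (c.st s).map fun y => g y + 1⟩
  have hrun : ∀ c : StkCfg Q Y, c.q ∈ S → (tabRun i u (E c) = .inl a ↔ stkRun δ u c = .inl a) := by
    induction u with
    | nil => intro c _; simp [tabRun, stkRun]
    | cons b u ih =>
      intro c hc
      have hnext := hδ b c.p c.q hc
      have hstep : tabStep i b (E c) = (E c).act (e (δ b c.p c.q)) :=
        congrArg _ (hent b c.p c.q hc)
      simp only [tabRun, stkRun, hstep]
      rcases hd : δ b c.p c.q with a' | ⟨s, y, q⟩ | ⟨s, q⟩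
      · simp [e, TabCfg.act, StkCfg.act]
      · rw [hd] at hnext
        have h := ih ⟨q, none, Function.update c.st s (y :: c.st s)⟩ hnext
        simp only [e, TabCfg.act, StkCfg.act]
        rw [← h]
        have : E ⟨q, none, Function.update c.st s (y :: c.st s)⟩ = ⟨f q, 0,
            Function.update (E c).st s ((g y + 1) :: (E c).st s)⟩ := by
          ext1
          · rfl
          · rfl
          · funext s'
            by_cases hs : s' = s
            · subst hs; simp [E]
            · simp [E, hs]
        rw [this]
      · rw [hd] at hnext
        have h := ih ⟨q, (c.st s).head?, Function.update c.st s (c.st s).tail⟩ hnext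
        simp only [e, TabCfg.act, StkCfg.act]
        rw [← h]
        have : E ⟨q, (c.st s).head?, Function.update c.st s (c.st s).tail⟩ = ⟨f q,
            ((E c).st s).headD 0, Function.update (E c).st s ((E c).st s).tail⟩ := by
          ext1
          · rfl
          · simp only [E]
            rcases c.st s with _ | ⟨y, l⟩ <;> rfl
          · funext s'
            by_cases hs : s' = s
            · subst hs; simp [E]
            · simp [E, hs]
        rw [this]
  have hinit : E ⟨q₀, none, fun s => cond s (List.replicate n y₁) []⟩ = tabInit n := by
    ext1
    · exact hf0
    · rfl
    · funext s
      cases s <;> simp [E, tabInit, hg0]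
  rw [← hinit]
  exact hrun _ h₀

theorem stkRun_append (δ : Bool → Option Y → Q → StkAct Q Y) (u v : List Bool) (c : StkCfg Q Y) :
    stkRun δ (u ++ v) c = match stkRun δ u c with
      | .inl a => .inl a
      | .inr c' => stkRun δ v c' := by
  induction u generalizing c with
  | nil => rfl
  | cons b u ih =>
    simp only [List.cons_append, stkRun]
    rcases c.act (δ b c.p c.q) with a | c'
    · rfl
    · exact ih c'

end StkMachine

/-! ### Two stacks suffice -/

section TwoStacks

variable {K : Type} {Γ : K → Type} {Λ σ : Type}

/-- The letters of all stacks. -/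
abbrev AllΓ (Γ : K → Type) : Type := Σ k, Γ k

/-- The stacks of the simulation. -/
def simStk (B A : List (AllΓ Γ)) : Bool → List (AllΓ Γ) := fun s => cond s B A

@[simp] theorem update_simStk_true (B A B' : List (AllΓ Γ)) :
    Function.update (simStk B A) true B' = simStk B' A := by
  funext s; cases s <;> simp [simStk]

@[simp] theorem update_simStk_false (B A A' : List (AllΓ Γ)) :
    Function.update (simStk B A) false A' = simStk B A' := by
  funext s; cases s <;> simp [simStk]

@[simp] theorem simStk_true (B A : List (AllΓ Γ)) : simStk B A true = B := rfl
@[simp] theorem simStk_false (B A : List (AllΓ Γ)) : simStk B A false = A := rfl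

variable [DecidableEq K]

/-- The letter, if it belongs to stack `k`. -/
def projΓ (k : K) (x : AllΓ Γ) : Option (Γ k) :=
  if h : x.1 = k then some (h ▸ x.2) else none

/-- The stacks that are interleaved in a list. -/
def splitStk (B : List (AllΓ Γ)) (k : K) : List (Γ k) := B.filterMap (projΓ k)

/-- The control states of the two-stack simulation, where `stk true` holds the interleaved stacks:
execute a statement; look for the topmost letter of the stack that the statement reads, while the
letters above it are moved to `stk false`; move these letters back, in two alternating states. -/
inductive SimState (Γ : K → Type) (Λ σ : Type)
  | exec (q : TM2.Stmt Γ Λ σ) (v : σ)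
  | seek (q : TM2.Stmt Γ Λ σ) (v : σ)
  | back (q : TM2.Stmt Γ Λ σ) (v : σ)
  | back' (q : TM2.Stmt Γ Λ σ) (v : σ)

open SimState

/-- The control of the two-stack simulation. The other stack is empty in the states in which a pop
from it is used as a step without effect. The coin is used at `goto` only. -/
def simStep (prog : Bool → Λ → TM2.Stmt Γ Λ σ) (acc : σ → Bool) (b : Bool) (p : Option (AllΓ Γ)) :
    SimState Γ Λ σ → StkAct (SimState Γ Λ σ) (AllΓ Γ)
  | exec (.push k f q) v => .push true ⟨k, f v⟩ (exec q v)
  | exec (.load f q) v => .pop false (exec q (f v))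
  | exec (.branch f q q') v => .pop false (exec (cond (f v) q q') v)
  | exec (.goto l) v => .pop false (exec (prog b (l v)) v)
  | exec .halt v => .halt (acc v)
  | exec (.peek k f q) v => .pop true (seek (.peek k f q) v)
  | exec (.pop k f q) v => .pop true (seek (.pop k f q) v)
  | seek (.peek k f q) v => match p with
    | none => .pop false (back' q (f v none))
    | some y => match projΓ k y with
      | none => .push false y (exec (.peek k f q) v)
      | some a => .push true y (back q (f v (some a)))
  | seek (.pop k f q) v => match p with
    | none => .pop false (back' q (f v none))
    | some y => match projΓ k y with
      | none => .push false y (exec (.pop k f q) v)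
      | some a => .pop false (back' q (f v (some a)))
  | seek q v => .pop false (exec q v)
  | back q v => .pop false (back' q v)
  | back' q v => match p with
    | none => .pop false (exec q v)
    | some y => .push true y (back q v)

variable (prog : Bool → Λ → TM2.Stmt Γ Λ σ) (acc : σ → Bool)

/-- In `j` steps, whatever the coins, the simulation gets from one configuration to another. -/
def SimLeads (j : ℕ) (c c' : StkCfg (SimState Γ Λ σ) (AllΓ Γ)) : Prop :=
  ∀ u : List Bool, u.length = j → stkRun (simStep prog acc) u c = .inr c'

variable {prog acc}

theorem SimLeads.refl (c : StkCfg (SimState Γ Λ σ) (AllΓ Γ)) : SimLeads prog acc 0 c c :=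
  fun u h => by
  rw [List.length_eq_zero_iff.1 h]; rfl

theorem SimLeads.trans {i j : ℕ} {c c' c'' : StkCfg (SimState Γ Λ σ) (AllΓ Γ)}
    (h : SimLeads prog acc i c c') (h' : SimLeads prog acc j c' c'') :
    SimLeads prog acc (i + j) c c'' := fun u hu => by
  rw [← List.take_append_drop i u, stkRun_append, h _ (by simp [hu])]
  exact h' _ (by simp [hu])

theorem SimLeads.head {j : ℕ} {c c' c'' : StkCfg (SimState Γ Λ σ) (AllΓ Γ)}
    (h : ∀ b, c.act (simStep prog acc b c.p c.q) = .inr c') (h' : SimLeads prog acc j c' c'') :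
    SimLeads prog acc (j + 1) c c'' := fun u hu => by
  rcases u with _ | ⟨b, u⟩
  · simp at hu
  · simp only [stkRun, h b]
    exact h' u (by simpa using hu)

/-- The letters that were moved to `stk false` are moved back. -/
theorem sim_back' (q : TM2.Stmt Γ Λ σ) (v : σ) (B A : List (AllΓ Γ)) :
    SimLeads prog acc (2 * A.length + 1) ⟨back' q v, A.head?, simStk B A.tail⟩
      ⟨exec q v, none, simStk (A.reverse ++ B) []⟩ := by
  induction A generalizing B with
  | nil => exact .head (fun b => by simp [simStep, StkCfg.act]) (.refl _)
  | cons y A ih =>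
    have := ih (y :: B)
    rw [show A.reverse ++ y :: B = (y :: A).reverse ++ B by simp] at this
    refine .head (c' := ⟨back q v, none, simStk (y :: B) A⟩)
      (fun b => by simp [simStep, StkCfg.act]) (.head (fun b => ?_) this)
    simp [simStep, StkCfg.act]

theorem splitStk_update_push (B : List (AllΓ Γ)) (k : K) (a : Γ k) :
    splitStk (⟨k, a⟩ :: B) = Function.update (splitStk B) k (a :: splitStk B k) := by
  funext k'
  by_cases h : k' = k
  · subst h; simp [splitStk, projΓ]
  · rw [Function.update_of_ne h, splitStk, List.filterMap_cons_none]
    · rfl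
    · simp [projΓ, Ne.symm h]

theorem projΓ_eq_some {k : K} {y : AllΓ Γ} {a : Γ k} (h : projΓ k y = some a) : y = ⟨k, a⟩ := by
  obtain ⟨k', b⟩ := y
  rw [projΓ] at h
  split_ifs at h with hk
  obtain rfl : k' = k := hk
  cases h; rfl

theorem projΓ_eq_none {k : K} {y : AllΓ Γ} (h : projΓ k y = none) : y.1 ≠ k := by
  intro hk
  simp [projΓ, hk] at h

/-- A statement that reads from a stack: the topmost letter of this stack is searched, and the
letters above it are moved to the other stack and back. -/
theorem sim_seek (q : TM2.Stmt Γ Λ σ) (k : K) (f : σ → Option (Γ k) → σ) (v : σ)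
    (B A : List (AllΓ Γ)) (p : Option (AllΓ Γ)) :
    (∃ j ≤ 4 * B.length + 2 * A.length + 5, SimLeads prog acc j
      ⟨exec (.peek k f q) v, p, simStk B A⟩
      ⟨exec q (f v (splitStk B k).head?), none, simStk (A.reverse ++ B) []⟩) ∧
    ∃ j ≤ 4 * B.length + 2 * A.length + 5, ∃ B', B'.length ≤ B.length ∧
      splitStk B' = Function.update (splitStk B) k (splitStk B k).tail ∧
      SimLeads prog acc j ⟨exec (.pop k f q) v, p, simStk B A⟩
        ⟨exec q (f v (splitStk B k).head?), none, simStk (A.reverse ++ B') []⟩ := by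
  induction B generalizing A p with
  | nil =>
    have h := sim_back' (prog := prog) (acc := acc) q (f v none) [] A
    refine ⟨⟨2 * A.length + 1 + 1 + 1, by omega, ?_⟩, 2 * A.length + 1 + 1 + 1, by omega, [],
      le_rfl, by simp [splitStk], ?_⟩
    · refine .head (c' := ⟨seek (.peek k f q) v, none, simStk [] A⟩) (fun b => ?_)
        (.head (fun b => ?_) h) <;> simp [simStep, StkCfg.act]
    · refine .head (c' := ⟨seek (.pop k f q) v, none, simStk [] A⟩) (fun b => ?_)
        (.head (fun b => ?_) h) <;> simp [simStep, StkCfg.act]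
  | cons y B ih =>
    rcases hy : projΓ k y with _ | a
    · obtain ⟨⟨j, hj, h⟩, j', hj', B', hB', hs, h'⟩ := ih (y :: A) none
      have e : splitStk (y :: B) k = splitStk B k := List.filterMap_cons_none hy
      rw [List.reverse_cons, List.append_assoc] at h h'
      rw [e]
      refine ⟨⟨j + 1 + 1, by simp at hj ⊢; omega, ?_⟩, j' + 1 + 1, by simp at hj' ⊢; omega,
        y :: B', by simpa using hB', ?_, ?_⟩
      · refine .head (c' := ⟨seek (.peek k f q) v, some y, simStk B A⟩) (fun b => ?_)
          (.head (fun b => ?_) h) <;> simp [simStep, StkCfg.act, hy]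
      · have hk := projΓ_eq_none hy
        obtain ⟨k', b⟩ := y
        rw [splitStk_update_push, splitStk_update_push, hs, Function.update_comm hk,
          Function.update_of_ne hk]
      · refine .head (c' := ⟨seek (.pop k f q) v, some y, simStk B A⟩) (fun b => ?_)
          (.head (fun b => ?_) h') <;> simp [simStep, StkCfg.act, hy]
    · have e : splitStk (y :: B) k = a :: splitStk B k := List.filterMap_cons_some hy
      have h := sim_back' (prog := prog) (acc := acc) q (f v (some a)) (y :: B) A
      have h' := sim_back' (prog := prog) (acc := acc) q (f v (some a)) B A
      rw [e]
      refine ⟨⟨2 * A.length + 1 + 1 + 1 + 1, by omega, ?_⟩, 2 * A.length + 1 + 1 + 1, by omega, B,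
        by simp, ?_, ?_⟩
      · refine .head (c' := ⟨seek (.peek k f q) v, some y, simStk B A⟩) (fun b => ?_)
          (.head (c' := ⟨back q (f v (some a)), none, simStk (y :: B) A⟩) (fun b => ?_)
            (.head (fun b => ?_) h)) <;> simp [simStep, StkCfg.act, hy]
      · obtain rfl := projΓ_eq_some hy
        rw [splitStk_update_push]
        simp
      · refine .head (c' := ⟨seek (.pop k f q) v, some y, simStk B A⟩) (fun b => ?_)
          (.head (fun b => ?_) h') <;> simp [simStep, StkCfg.act, hy]

/-- A bound for the number of steps of a statement. -/
def stmtSize : TM2.Stmt Γ Λ σ → ℕ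
  | .push _ _ q => stmtSize q + 1
  | .peek _ _ q => stmtSize q + 1
  | .pop _ _ q => stmtSize q + 1
  | .load _ q => stmtSize q + 1
  | .branch _ q q' => stmtSize q + stmtSize q' + 1
  | .goto _ => 0
  | .halt => 0

/-- The simulation is at the end of a step of the simulated machine. -/
def SimAt (c : TM2.Cfg Γ Λ σ) (B : List (AllΓ Γ)) (g : StkCfg (SimState Γ Λ σ) (AllΓ Γ)) : Prop :=
  splitStk B = c.stk ∧ g.st = simStk B [] ∧
    match c.l with
    | some l => ∃ f : σ → Λ, f c.var = l ∧ g.q = exec (.goto f) c.var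
    | none => g.q = exec .halt c.var

/-- The simulation of a statement. -/
theorem sim_exec (q : TM2.Stmt Γ Λ σ) (v : σ) (B : List (AllΓ Γ)) (p : Option (AllΓ Γ)) :
    ∃ j ≤ stmtSize q * (4 * (B.length + stmtSize q) + 5), ∃ B' g,
      B'.length ≤ B.length + stmtSize q ∧ SimAt (TM2.stepAux q v (splitStk B)) B' g ∧
      SimLeads prog acc j ⟨exec q v, p, simStk B []⟩ g := by
  induction q generalizing v B p with
  | push k f q ih =>
    obtain ⟨j, hj, B', g, hB', hg, h⟩ := ih v (⟨k, f v⟩ :: B) none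
    rw [splitStk_update_push] at hg
    simp only [List.length_cons, stmtSize] at *
    refine ⟨j + 1, by nlinarith, B', g, by omega, hg, .head (fun b => ?_) h⟩
    simp [simStep, StkCfg.act]
  | peek k f q ih =>
    obtain ⟨⟨i, hi, h'⟩, -⟩ := sim_seek (prog := prog) (acc := acc) q k f v B [] p
    obtain ⟨j, hj, B', g, hB', hg, h⟩ := ih (f v (splitStk B k).head?) B none
    simp only [stmtSize, List.length_nil, List.reverse_nil, List.nil_append] at *
    exact ⟨i + j, by nlinarith, B', g, by omega, hg, h'.trans h⟩
  | pop k f q ih =>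
    obtain ⟨-, i, hi, B₁, hB₁, hs, h'⟩ := sim_seek (prog := prog) (acc := acc) q k f v B [] p
    obtain ⟨j, hj, B', g, hB', hg, h⟩ := ih (f v (splitStk B k).head?) B₁ none
    rw [hs] at hg
    simp only [stmtSize, List.length_nil, List.reverse_nil, List.nil_append] at *
    exact ⟨i + j, by nlinarith, B', g, by omega, hg, h'.trans h⟩
  | load f q ih =>
    obtain ⟨j, hj, B', g, hB', hg, h⟩ := ih (f v) B none
    simp only [stmtSize] at *
    refine ⟨j + 1, by nlinarith, B', g, by omega, hg, .head (fun b => ?_) h⟩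
    simp [simStep, StkCfg.act]
  | branch f q q' ih ih' =>
    have key : ∀ q₁, stmtSize q₁ ≤ stmtSize q + stmtSize q' → cond (f v) q q' = q₁ →
        TM2.stepAux (.branch f q q') v (splitStk B) = TM2.stepAux q₁ v (splitStk B) →
        (∃ j ≤ stmtSize q₁ * (4 * (B.length + stmtSize q₁) + 5), ∃ B' g,
          B'.length ≤ B.length + stmtSize q₁ ∧ SimAt (TM2.stepAux q₁ v (splitStk B)) B' g ∧
          SimLeads prog acc j ⟨exec q₁ v, none, simStk B []⟩ g) →
        ∃ j ≤ stmtSize (.branch f q q') * (4 * (B.length + stmtSize (.branch f q q')) + 5), ∃ B' g,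
          B'.length ≤ B.length + stmtSize (.branch f q q') ∧
          SimAt (TM2.stepAux (.branch f q q') v (splitStk B)) B' g ∧
          SimLeads prog acc j ⟨exec (.branch f q q') v, p, simStk B []⟩ g := by
      rintro q₁ hq hc he ⟨j, hj, B', g, hB', hg, h⟩
      rw [he]
      simp only [stmtSize]
      refine ⟨j + 1, ?_, B', g, by omega, hg, .head (fun b => ?_) h⟩
      · have := Nat.mul_le_mul hq (show 4 * (B.length + stmtSize q₁) + 5 ≤
          4 * (B.length + (stmtSize q + stmtSize q' + 1)) + 5 by omega)
        nlinarith
      · simp [simStep, StkCfg.act, hc]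
    cases hf : f v
    · exact key q' (by omega) (by rw [hf]; rfl) (by simp [TM2.stepAux, hf]) (ih' v B none)
    · exact key q (by omega) (by rw [hf]; rfl) (by simp [TM2.stepAux, hf]) (ih v B none)
  | goto l =>
    exact ⟨0, by simp, B, _, by simp, ⟨rfl, rfl, l, rfl, rfl⟩, .refl _⟩
  | halt =>
    exact ⟨0, by simp, B, ⟨exec .halt v, p, simStk B []⟩, by simp, ⟨rfl, rfl, rfl⟩, .refl _⟩

/-- The simulation of a halted machine needs one more step to give the answer. -/
theorem sim_halted {c : TM2.Cfg Γ Λ σ} {B : List (AllΓ Γ)}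
    {g : StkCfg (SimState Γ Λ σ) (AllΓ Γ)} (hg : SimAt c B g) (hc : c.l = none) (b : Bool)
    (u : List Bool) : stkRun (simStep prog acc) (b :: u) g = .inl (acc c.var) := by
  obtain ⟨-, -, h⟩ := hg
  rw [hc] at h
  simp only [stkRun, show g.q = exec .halt c.var from h]
  rfl

/-- The simulation of a step. -/
theorem sim_step {R : ℕ} (hR : ∀ b l, stmtSize (prog b l) ≤ R) {c : TM2.Cfg Γ Λ σ}
    {B : List (AllΓ Γ)} {g : StkCfg (SimState Γ Λ σ) (AllΓ Γ)} (hg : SimAt c B g) (hc : c.l ≠ none)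
    (b : Bool) : ∃ j ≤ R * (4 * (B.length + R) + 5), ∃ B' g', B'.length ≤ B.length + R ∧
      SimAt (coinStep prog b c) B' g' ∧
      ∀ u : List Bool, u.length = j → stkRun (simStep prog acc) (b :: u) g = .inr g' := by
  obtain ⟨_ | l, v, S⟩ := c
  · exact absurd rfl hc
  obtain ⟨q, p, st⟩ := g
  obtain ⟨rfl, hst, f, hf, hq⟩ := hg
  obtain rfl : st = simStk B [] := hst
  obtain rfl : q = exec (.goto f) v := hq
  obtain rfl : f v = l := hf
  obtain ⟨j, hj, B', g, hB', hg, h⟩ :=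
    sim_exec (prog := prog) (acc := acc) (prog b (f v)) v B none
  have hR' := hR b (f v)
  refine ⟨j, hj.trans (Nat.mul_le_mul hR' (by omega)), B', g, by omega, hg, fun u hu => ?_⟩
  have e := h u hu
  simp only [stkRun, simStep, StkCfg.act, simStk_false, List.head?_nil, List.tail_nil,
    update_simStk_false]
  exact e

/-- Every answer of the two-stack simulation is an answer of the simulated machine for some coins.
-/
theorem sim_sound {R : ℕ} (hR : ∀ b l, stmtSize (prog b l) ≤ R) (N : ℕ) (u : List Bool)
    (hu : u.length ≤ N) {c : TM2.Cfg Γ Λ σ} {B : List (AllΓ Γ)}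
    {g : StkCfg (SimState Γ Λ σ) (AllΓ Γ)} (hg : SimAt c B g) {a : Bool}
    (h : stkRun (simStep prog acc) u g = .inl a) :
    ∃ ω T, Answers acc a (coinRun prog c ω T) := by
  induction N generalizing u c B g with
  | zero =>
    rw [List.length_eq_zero_iff.1 (Nat.le_zero.1 hu)] at h
    simp [stkRun] at h
  | succ N ih =>
    rcases u with _ | ⟨b, u⟩
    · simp [stkRun] at h
    by_cases hc : c.l = none
    · rw [sim_halted hg hc] at h
      exact ⟨fun _ => false, 0, hc, Sum.inl.inj h⟩
    · obtain ⟨j, -, B', g', -, hg', hj⟩ := sim_step (acc := acc) hR hg hc b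
      by_cases hju : u.length < j
      · -- the answer cannot come in the middle of the simulation of a step
        have := hj (u ++ List.replicate (j - u.length) false) (by simp; omega)
        rw [← List.cons_append, stkRun_append, h] at this
        simp at this
      · rw [← List.take_append_drop j u, ← List.cons_append, stkRun_append,
          hj (u.take j) (by simp; omega)] at h
        obtain ⟨ω, T, hT⟩ := ih (u.drop j) (by simp at hu ⊢; omega) hg' h
        refine ⟨fun i => Nat.casesOn i b ω, T + 1, ?_⟩
        rw [coinRun_succ']
        exact hT

/-- If the simulated machine halts within `T` steps for some coins, then for some coin sequence the
simulation gives an answer. The stacks grow by at most `R` letters per step, and the simulation of a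
step takes a time that is linear in their size, so that the loss is quadratic. -/
theorem sim_complete {R : ℕ} (hR : ∀ b l, stmtSize (prog b l) ≤ R) (N T : ℕ) (ω : ℕ → Bool)
    {c : TM2.Cfg Γ Λ σ} {B : List (AllΓ Γ)} {g : StkCfg (SimState Γ Λ σ) (AllΓ Γ)}
    (hg : SimAt c B g) (hN : B.length + R * T ≤ N) (h : (coinRun prog c ω T).l = none) :
    ∃ u a, u.length ≤ T * (R * (4 * (N + R) + 5) + 1) + 1 ∧
      stkRun (simStep prog acc) u g = .inl a := by
  induction T generalizing c B g ω with
  | zero => exact ⟨[false], _, by simp, sim_halted hg h false []⟩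
  | succ T ih =>
    by_cases hc : c.l = none
    · exact ⟨[false], _, by simp, sim_halted hg hc false []⟩
    · obtain ⟨j, hj, B', g', hB', hg', hj'⟩ := sim_step (acc := acc) hR hg hc (ω 0)
      rw [coinRun_succ'] at h
      rw [mul_add] at hN
      obtain ⟨u, a, hu, ha⟩ := ih (fun i => ω (i + 1)) hg' (by omega) h
      refine ⟨ω 0 :: List.replicate j false ++ u, a, ?_, ?_⟩
      · have : R * (4 * (B.length + R) + 5) ≤ R * (4 * (N + R) + 5) :=
          Nat.mul_le_mul_left _ (by omega)
        simp only [List.cons_append, List.length_cons, List.length_append, List.length_replicate]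
        rw [add_mul]
        omega
      · rw [stkRun_append, hj' _ (by simp)]
        exact ha

/-- The statement of a control state. -/
def SimState.stmt : SimState Γ Λ σ → TM2.Stmt Γ Λ σ
  | exec q _ => q
  | seek q _ => q
  | back q _ => q
  | back' q _ => q

/-- The control states whose statements are substatements of the program are closed under the
transitions of the simulation. There are finitely many of them. -/
theorem simStep_nextIn {Q : Set (TM2.Stmt Γ Λ σ)} (hQ : ∀ b l, prog b l ∈ Q)
    (hQ' : ∀ q ∈ Q, ∀ q' ∈ TM2.stmts₁ q, q' ∈ Q) (b : Bool) (p : Option (AllΓ Γ))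
    (s : SimState Γ Λ σ) (hs : s.stmt ∈ Q) :
    (simStep prog acc b p s).NextIn {s | s.stmt ∈ Q} := by
  have hself := fun q : TM2.Stmt Γ Λ σ => TM2.stmts₁_self (q := q)
  rcases s with ⟨q, v⟩ | ⟨q, v⟩ | ⟨q, v⟩ | ⟨q, v⟩
  · have h := hQ' q hs
    cases q with
    | branch f q q' =>
      simp only [simStep, StkAct.NextIn, Set.mem_ofPred_eq, SimState.stmt]
      cases f v
      · exact h q' (by simp [TM2.stmts₁, hself])
      · exact h q (by simp [TM2.stmts₁, hself])
    | goto l => exact hQ _ _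
    | halt => trivial
    | peek k f q => exact hs
    | pop k f q => exact hs
    | push k f q => exact h q (by simp [TM2.stmts₁, hself])
    | load f q => exact h q (by simp [TM2.stmts₁, hself])
  · have h := hQ' q hs
    cases q with
    | peek k f q =>
      have hq : q ∈ Q := h q (by simp [TM2.stmts₁, hself])
      rcases p with _ | y
      · exact hq
      · simp only [simStep]
        rcases projΓ k y with _ | a
        · exact hs
        · exact hq
    | pop k f q =>
      have hq : q ∈ Q := h q (by simp [TM2.stmts₁, hself])
      rcases p with _ | y
      · exact hq
      · simp only [simStep]
        rcases projΓ k y with _ | a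
        · exact hs
        · exact hq
    | branch f q q' => exact hs
    | goto l => exact hs
    | halt => exact hs
    | push k f q => exact hs
    | load f q => exact hs
  · exact hs
  · rcases p with _ | y <;> exact hs

end TwoStacks

/-- The input on the stack `true` represents the initial stacks of the simulated machine. -/
theorem splitStk_input (M : ProbTM) (n : ℕ) :
    splitStk (List.replicate n ⟨M.input, M.letter true⟩) = (M.start (ones n)).stk := by
  funext k
  by_cases h : k = M.input
  · subst h
    simp [ProbTM.start, ones, splitStk, projΓ]
  · simp [ProbTM.start, h, splitStk, projΓ, Ne.symm h]

/-- For every probabilistic machine there is a table machine that gives on `n` the answers which the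
probabilistic machine may give on `1 ^ n`, with a quadratic loss of time. -/
theorem ProbTM.exists_table (M : ProbTM) : ∃ i C, ∀ n,
    (∀ u a, tabRun i u (tabInit n) = .inl a →
      ∃ ω T, Answers M.accept a (M.run (ones n) ω T)) ∧
    ∀ ω T, M.HaltedAt (ones n) ω T →
      ∃ u a, tabRun i u (tabInit n) = .inl a ∧ u.length ≤ C * (n + T + 1) ^ 2 := by
  let q₀ : TM2.Stmt M.Γ M.Λ M.σ := .goto fun _ => M.main
  let Q : Set (TM2.Stmt M.Γ M.Λ M.σ) := {q₀} ∪ ⋃ x : Bool × M.Λ, ↑(TM2.stmts₁ (M.prog x.1 x.2))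
  have hQfin : Q.Finite := (Set.finite_singleton _).union
    (Set.finite_iUnion fun x => Finset.finite_toSet _)
  have hQ : ∀ b l, M.prog b l ∈ Q := fun b l =>
    .inr (Set.mem_iUnion.2 ⟨(b, l), TM2.stmts₁_self⟩)
  have hQ' : ∀ q ∈ Q, ∀ q' ∈ TM2.stmts₁ q, q' ∈ Q := by
    rintro q (rfl | hq) q' hq'
    · left
      simpa [q₀, TM2.stmts₁] using hq'
    · obtain ⟨x, hx⟩ := Set.mem_iUnion.1 hq
      exact .inr (Set.mem_iUnion.2 ⟨x, TM2.stmts₁_trans hx hq'⟩)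
  have hS : {s : SimState M.Γ M.Λ M.σ | s.stmt ∈ Q}.Finite := by
    have hf := fun f : TM2.Stmt M.Γ M.Λ M.σ → M.σ → SimState M.Γ M.Λ M.σ =>
      hQfin.image2 f (Set.finite_univ (α := M.σ))
    refine ((hf .exec).union ((hf .seek).union ((hf .back).union (hf .back')))).subset ?_
    rintro (⟨q, v⟩ | ⟨q, v⟩ | ⟨q, v⟩ | ⟨q, v⟩) hs
    · exact .inl ⟨q, hs, v, trivial, rfl⟩
    · exact .inr (.inl ⟨q, hs, v, trivial, rfl⟩)
    · exact .inr (.inr (.inl ⟨q, hs, v, trivial, rfl⟩))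
    · exact .inr (.inr (.inr ⟨q, hs, v, trivial, rfl⟩))
  obtain ⟨i, hi⟩ := _root_.exists_table (simStep M.prog M.accept) hS
    (fun b p => simStep_nextIn hQ hQ' b p) (.exec q₀ M.init) (.inl rfl)
    ⟨M.input, M.letter true⟩
  obtain ⟨R, hR⟩ := (Set.finite_range fun x : Bool × M.Λ => stmtSize (M.prog x.1 x.2)).bddAbove
  have hR : ∀ b l, stmtSize (M.prog b l) ≤ R := fun b l => hR ⟨(b, l), rfl⟩
  refine ⟨i, 4 * R * (R + 1) + 5 * R + 2, fun n => ?_⟩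
  have hstart : SimAt (M.start (ones n)) (List.replicate n ⟨M.input, M.letter true⟩)
      ⟨.exec q₀ M.init, none,
        fun s => cond s (List.replicate n ⟨M.input, M.letter true⟩) []⟩ :=
    ⟨splitStk_input M n, rfl, fun _ => M.main, rfl, rfl⟩
  constructor
  · intro u a h
    obtain ⟨ω, T, hT⟩ := sim_sound hR _ u le_rfl hstart ((hi u n a).1 h)
    exact ⟨ω, T, by rwa [M.run_eq_coinRun]⟩
  · intro ω T hT
    rw [HaltedAt, M.run_eq_coinRun] at hT
    obtain ⟨u, a, hu, ha⟩ := sim_complete (acc := M.accept) hR (n + R * T) T ω hstart (by simp) hT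
    refine ⟨u, a, (hi u n a).2 ha, hu.trans ?_⟩
    have h1 : n + R * T + R ≤ (R + 1) * (n + T + 1) := by nlinarith
    have h2 : T ≤ n + T + 1 := by omega
    have h3 := Nat.mul_le_mul_left (4 * R) (Nat.mul_le_mul h2 h1)
    have h4 : 1 ≤ n + T + 1 := by omega
    generalize n + T + 1 = s at *
    have h5 : s ≤ s ^ 2 := by nlinarith
    have h6 : 5 * R * T ≤ 5 * R * s ^ 2 := Nat.mul_le_mul_left _ (h2.trans h5)
    nlinarith

/-! ### Padding stable functions and the tower function -/

theorem tower_strictMono : StrictMono tower :=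
  strictMono_nat_of_lt_succ fun _ => Nat.lt_two_pow_self

/-- A padding stable function lags behind the tower function by a constant number of steps. -/
theorem PaddingStable.exists_tower {g : ℕ → ℕ} (hg : PaddingStable g) (hmono : Monotone g) :
    ∃ c, 0 < c ∧ ∀ a, g (tower a) < tower (a + c) := by
  -- compare both with the iterates of the padding function `n ↦ 2 ^ n + n`
  have h : ∀ k, ∃ a, 1 < a ∧ tower k ≤ a ∧ g a + 1 ≤ tower (k + (g 2 + 1)) := by
    intro k
    induction k with
    | zero => exact ⟨2, one_lt_two, Nat.zero_le _, by rw [zero_add]; exact tower_strictMono.id_le _⟩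
    | succ k ih =>
      obtain ⟨a, ha, hka, hga⟩ := ih
      refine ⟨2 ^ a + a, ha.trans_le (Nat.le_add_left _ _), ?_, ?_⟩
      · exact (Nat.pow_le_pow_right two_pos hka).trans (Nat.le_add_right _ _)
      · have h1 := hg a ha
        have h2 : g a < 2 ^ g a := Nat.lt_two_pow_self
        have h3 : 2 ^ (g a + 1) ≤ 2 ^ tower (k + (g 2 + 1)) := Nat.pow_le_pow_right two_pos hga
        rw [show k + 1 + (g 2 + 1) = k + (g 2 + 1) + 1 by ring, tower]
        rw [pow_succ] at h3
        omega
  refine ⟨g 2 + 1, Nat.succ_pos _, fun k => ?_⟩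
  obtain ⟨a, -, hka, hga⟩ := h k
  exact (hmono hka).trans_lt hga

/-! ### The active ranks -/

section Ranks

variable (c : ℕ) (d : ℕ → ℕ)

/-- The test for rank `r`, if `e` ranks have become active before: this is `1` if `r` is a multiple
of `c` and `e < d r`, and `0` otherwise. -/
def isActive (r e : ℕ) : ℕ := 1 - (r % c + (e + 1 - d r))

/-- The number of active ranks below `r`. -/
def numActive : ℕ → ℕ
  | 0 => 0
  | r + 1 => numActive r + isActive c d r (numActive r)

/-- Rank `r` is active if `activeFlag (r + 1) = 1`. The shift by one makes room for the initial
state of the process, in which all data are zero. -/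
def activeFlag : ℕ → ℕ
  | 0 => 0
  | r + 1 => isActive c d r (numActive c d r)

variable {c d}

theorem isActive_eq_one {r e : ℕ} : isActive c d r e = 1 ↔ c ∣ r ∧ e + 1 ≤ d r := by
  rw [isActive, Nat.dvd_iff_mod_eq_zero]; omega

theorem isActive_eq (r e : ℕ) : isActive c d r e = 0 ∨ isActive c d r e = 1 := by
  rw [isActive]; omega

theorem numActive_mono : Monotone (numActive c d) :=
  monotone_nat_of_le_succ fun _ => Nat.le_add_right _ _

theorem numActive_le_self (r : ℕ) : numActive c d r ≤ r := by
  induction r with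
  | zero => exact le_rfl
  | succ r ih =>
    have := isActive_eq (c := c) (d := d) r (numActive c d r)
    rw [numActive]; omega

/-- As `d` is monotone, the test that `isActive` makes bounds the number of active ranks. -/
theorem numActive_le (hd : Monotone d) (r : ℕ) : numActive c d (r + 1) ≤ d r := by
  induction r with
  | zero =>
    rw [numActive]
    rcases isActive_eq (c := c) (d := d) 0 (numActive c d 0) with h | h
    · rw [h]; exact Nat.zero_le _
    · rw [h]; exact (isActive_eq_one.1 h).2
  | succ r ih =>
    rw [numActive]
    rcases isActive_eq (c := c) (d := d) (r + 1) (numActive c d (r + 1)) with h | h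
    · rw [h]; exact ih.trans (hd (Nat.le_succ r))
    · rw [h]; exact (isActive_eq_one.1 h).2

theorem numActive_eq_card (r : ℕ) : numActive c d r =
    ((Finset.range r).filter fun s => activeFlag c d (s + 1) = 1).card := by
  induction r with
  | zero => rfl
  | succ r ih =>
    rw [numActive, Finset.range_add_one, Finset.filter_insert, ih]
    rcases isActive_eq (c := c) (d := d) r (numActive c d r) with h | h
    · rw [activeFlag, if_neg (by omega), ← ih, h]; rfl
    · rw [activeFlag, if_pos h, Finset.card_insert_of_notMem (by simp), ← ih, h]

/-- As `d` is unbounded, every positive value of `numActive` is reached, at an active rank. -/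
theorem exists_numActive_eq (hc : 0 < c) (hd : Monotone d) (hd' : ¬ BddAbove (Set.range d))
    (v : ℕ) : ∃ r, activeFlag c d (r + 1) = 1 ∧ numActive c d (r + 1) = v + 1 := by
  have hunb : ∀ v, ∃ r, v ≤ numActive c d r := by
    intro v
    induction v with
    | zero => exact ⟨0, Nat.zero_le _⟩
    | succ v ih =>
      obtain ⟨r₀, h₀⟩ := ih
      obtain ⟨r₁, h₁⟩ : ∃ r₁, v + 1 ≤ d r₁ := by
        by_contra! h
        exact hd' ⟨v + 1, by rintro _ ⟨r, rfl⟩; exact (h r).le⟩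
      have hr : r₀ + r₁ ≤ c * (r₀ + r₁) := Nat.le_mul_of_pos_left _ hc
      have h2 := numActive_mono (c := c) (d := d) (show r₀ ≤ c * (r₀ + r₁) by omega)
      by_cases h3 : v + 1 ≤ numActive c d (c * (r₀ + r₁))
      · exact ⟨_, h3⟩
      · refine ⟨c * (r₀ + r₁) + 1, ?_⟩
        rw [numActive, isActive_eq_one.2 ⟨Nat.dvd_mul_right _ _, ?_⟩]
        · omega
        · exact le_trans (by omega) (h₁.trans (hd (show r₁ ≤ c * (r₀ + r₁) by omega)))
  have hex := hunb (v + 1)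
  classical
  have hspec := Nat.find_spec hex
  have hmin : ∀ s < Nat.find hex, ¬ v + 1 ≤ numActive c d s := fun s => Nat.find_min hex
  rcases hf : Nat.find hex with _ | r
  · rw [hf] at hspec; simp [numActive] at hspec
  · rw [hf] at hspec hmin
    have h1 := hmin r (Nat.lt_succ_self r)
    have h2 := isActive_eq (c := c) (d := d) r (numActive c d r)
    simp only [numActive] at hspec
    refine ⟨r, ?_, ?_⟩
    · rw [activeFlag]; omega
    · rw [numActive]; omega

/-- A language of strings whose lengths are taken from an increasing sequence of towers, at active
ranks only, is sparse. -/
theorem mem_TALLY_of_active {g : ℕ → ℕ} (hd : Monotone d)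
    (hg : ∀ a, g (tower a) < tower (a + c)) {s : ℕ → ℕ} (hs : StrictMono s) {A : Language Bool}
    (hA : ∀ w ∈ A, ∃ r, activeFlag c d (r + 1) = 1 ∧ w = ones (tower (s r))) :
    A ∈ TALLY d g := by
  refine ⟨fun w hw => ?_, fun N => ?_, fun n m hn hm hnm => ?_⟩
  · obtain ⟨r, -, rfl⟩ := hA w hw
    exact ⟨_, rfl⟩
  · let F := (Finset.range (N + 1)).filter fun r => activeFlag c d (r + 1) = 1
    have hsub : {w : List Bool | w ∈ A ∧ w.length ≤ N} ⊆
        ↑(F.image fun r => ones (tower (s r))) := by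
      rintro w ⟨hw, hl⟩
      obtain ⟨r, hr, rfl⟩ := hA w hw
      have : r ≤ tower (s r) := (hs.id_le r).trans (tower_strictMono.id_le _)
      rw [ProbTM.length_ones] at hl
      exact Finset.mem_coe.2 (Finset.mem_image.2
        ⟨r, Finset.mem_filter.2 ⟨Finset.mem_range.2 (by omega), hr⟩, rfl⟩)
    refine (Set.encard_le_encard hsub).trans ?_
    rw [Set.encard_coe_eq_coe_finsetCard]
    have hF : F.card ≤ d N := by
      rw [← numActive_eq_card]; exact numActive_le hd N
    exact_mod_cast Finset.card_image_le.trans hF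
  · obtain ⟨r, hr, hnr⟩ := hA _ hn
    obtain ⟨r', hr', hmr⟩ := hA _ hm
    obtain rfl := ProbTM.ones_injective hnr
    obtain rfl := ProbTM.ones_injective hmr
    have hlt : r < r' := (tower_strictMono.comp hs).lt_iff_lt.1 hnm
    obtain ⟨k, rfl⟩ := (isActive_eq_one.1 hr).1
    obtain ⟨k', rfl⟩ := (isActive_eq_one.1 hr').1
    have hk : k < k' := lt_of_mul_lt_mul_left hlt (Nat.zero_le c)
    have h1 : c * k + c ≤ c * k' := by
      calc c * k + c = c * (k + 1) := by ring
        _ ≤ c * k' := Nat.mul_le_mul_left _ hk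
    have h2 : s (c * k) + c ≤ s (c * k') := by
      have h3 : ∀ j, s (c * k) + j ≤ s (c * k + j) := fun j => by
        induction j with
        | zero => exact le_rfl
        | succ j ih => exact Nat.succ_le_of_lt (ih.trans_lt (hs (Nat.lt_succ_self _)))
      exact (h3 c).trans (hs.monotone h1)
    exact (hg _).trans_le (tower_strictMono.monotone h2)

end Ranks

/-! ### The subroutines -/

section Codes

open ToPartrec

/-- The step of the process that produces the valid lengths: from rank to rank. The table machine
`i` is assigned to a rank at which the number of active ranks encodes a pair with first component
`i`. -/
theorem exists_nxt_code {c : ℕ} {d : ℕ → ℕ} (hd : Computable d) : ∃ code : Code, ∀ r,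
    code.eval [activeFlag c d r, Nat.pair r (numActive c d r),
        Nat.pair (numActive c d r).unpair.1 0] =
      pure [activeFlag c d (r + 1), Nat.pair (r + 1) (numActive c d (r + 1)),
        Nat.pair (numActive c d (r + 1)).unpair.1 0] := by
  have hx : Computable fun x : ℕ × ℕ × ℕ => x.2.1.unpair :=
    (Primrec.unpair.comp (Primrec.fst.comp .snd)).to_comp
  have hr : Computable fun x : ℕ × ℕ × ℕ => x.2.1.unpair.1 := Computable.fst.comp hx
  have he : Computable fun x : ℕ × ℕ × ℕ => x.2.1.unpair.2 := Computable.snd.comp hx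
  have hadd : Computable₂ fun a b : ℕ => a + b := Primrec.nat_add.to_comp
  have hsub : Computable₂ fun a b : ℕ => a - b := Primrec.nat_sub.to_comp
  have hmod : Computable₂ fun a b : ℕ => a % b := Primrec.nat_mod.to_comp
  have hpair : Computable₂ Nat.pair := Primrec₂.natPair.to_comp
  have h1 : Computable fun x : ℕ × ℕ × ℕ => isActive c d x.2.1.unpair.1 x.2.1.unpair.2 :=
    hsub.comp (.const 1) (hadd.comp (hmod.comp hr (.const c))
      (hsub.comp (hadd.comp he (.const 1)) (hd.comp hr)))
  have h2 : Computable fun x : ℕ × ℕ × ℕ =>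
      x.2.1.unpair.2 + isActive c d x.2.1.unpair.1 x.2.1.unpair.2 := hadd.comp he h1
  obtain ⟨code, h⟩ := exists_code₃
    [fun _ x _ => isActive c d x.unpair.1 x.unpair.2,
      fun _ x _ => Nat.pair (x.unpair.1 + 1) (x.unpair.2 + isActive c d x.unpair.1 x.unpair.2),
      fun _ x _ => Nat.pair (x.unpair.2 + isActive c d x.unpair.1 x.unpair.2).unpair.1 0] (by
    simp only [List.mem_cons, List.not_mem_nil, or_false, forall_eq_or_imp, forall_eq]
    exact ⟨h1, hpair.comp (hadd.comp hr (.const 1)) h2,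
      hpair.comp (Computable.fst.comp (Primrec.unpair.to_comp.comp h2)) (.const 0)⟩)
  exact ⟨code, fun r => by rw [h]; simp [activeFlag, numActive]⟩

/-- The control of the simulated table machine: look up and decode the entry of the table. -/
theorem exists_ctl_code : ∃ code : Code, ∀ b p x, code.eval [b, p, x] =
    pure (ctlOut x.unpair.1 (tabEntry x.unpair.1 b p x.unpair.2)) := by
  have hb : Primrec fun x : ℕ × ℕ × ℕ => x.1 := .fst
  have hp : Primrec fun x : ℕ × ℕ × ℕ => x.2.1 := Primrec.fst.comp .snd
  have hx : Primrec fun x : ℕ × ℕ × ℕ => x.2.2.unpair :=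
    Primrec.unpair.comp (Primrec.snd.comp .snd)
  have hi : Primrec fun x : ℕ × ℕ × ℕ => x.2.2.unpair.1 := Primrec.fst.comp hx
  have hq : Primrec fun x : ℕ × ℕ × ℕ => x.2.2.unpair.2 := Primrec.snd.comp hx
  have he : Primrec fun x : ℕ × ℕ × ℕ =>
      (tabEntry x.2.2.unpair.1 x.1 x.2.1 x.2.2.unpair.2).unpair :=
    Primrec.unpair.comp ((Primrec.list_getD 0).comp ((Primrec.ofNat (List ℕ)).comp hi)
      (Primrec₂.natPair.comp hb (Primrec₂.natPair.comp hp hq)))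
  have hk := Primrec.fst.comp he
  have he2 := Primrec.unpair.comp (Primrec.snd.comp he)
  have hbit : ∀ j, Primrec fun x : ℕ × ℕ × ℕ =>
      (tabEntry x.2.2.unpair.1 x.1 x.2.1 x.2.2.unpair.2).unpair.1 / j % 2 := fun j =>
    Primrec.nat_mod.comp (Primrec.nat_div.comp hk (.const j)) (.const 2)
  obtain ⟨code, h⟩ := exists_code₃
    [fun b p x => (tabEntry x.unpair.1 b p x.unpair.2).unpair.1 / 1 % 2,
      fun b p x => (tabEntry x.unpair.1 b p x.unpair.2).unpair.1 / 2 % 2,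
      fun b p x => (tabEntry x.unpair.1 b p x.unpair.2).unpair.1 / 4 % 2,
      fun b p x => if (tabEntry x.unpair.1 b p x.unpair.2).unpair.1 / 2 % 2 = 1 then 0 else
        (tabEntry x.unpair.1 b p x.unpair.2).unpair.2.unpair.1,
      fun b p x => Nat.pair x.unpair.1 (tabEntry x.unpair.1 b p x.unpair.2).unpair.2.unpair.2] (by
    simp only [List.mem_cons, List.not_mem_nil, or_false, forall_eq_or_imp, forall_eq]
    exact ⟨(hbit 1).to_comp, (hbit 2).to_comp, (hbit 4).to_comp,
      (Primrec.ite (Primrec.eq.comp (hbit 2) (.const 1)) (.const 0)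
        (Primrec.fst.comp he2)).to_comp,
      (Primrec₂.natPair.comp hi (Primrec.snd.comp he2)).to_comp⟩)
  exact ⟨code, fun b p x => by rw [h]; simp [ctlOut]⟩

/-- The reset of the simulated table machine to its initial state. -/
theorem exists_rst_code : ∃ code : Code, ∀ b p x, code.eval [b, p, x] =
    pure [0, Nat.pair x.unpair.1 0] := by
  obtain ⟨code, h⟩ := exists_code₃ [fun _ _ _ => 0, fun _ _ x => Nat.pair x.unpair.1 0] (by
    simp only [List.mem_cons, List.not_mem_nil, or_false, forall_eq_or_imp, forall_eq]
    exact ⟨.const 0, (Primrec₂.natPair.comp (Primrec.fst.comp (Primrec.unpair.comp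
      (Primrec.snd.comp .snd))) (.const 0)).to_comp⟩)
  exact ⟨code, fun b p x => by rw [h]; rfl⟩

end Codes

/-! ### The conclusion -/

theorem exists_mul_pow_le_two_pow (K p : ℕ) : ∃ N, ∀ n ≥ N, K * n ^ p ≤ 2 ^ n := by
  have h := (isLittleO_pow_const_const_pow_of_one_lt (R := ℝ) p one_lt_two).bound
    (show (0 : ℝ) < 1 / (K + 1) by positivity)
  obtain ⟨N, hN⟩ := Filter.eventually_atTop.1 h
  refine ⟨N, fun n hn => ?_⟩
  have h1 := hN n hn
  rw [Real.norm_of_nonneg (by positivity), Real.norm_of_nonneg (by positivity), div_mul_eq_mul_div,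
    one_mul, le_div_iff₀ (by positivity)] at h1
  have h2 : (n : ℝ) ^ p * K ≤ (n : ℝ) ^ p * (K + 1) :=
    mul_le_mul_of_nonneg_left (by linarith) (by positivity)
  have h3 : ((K * n ^ p : ℕ) : ℝ) ≤ ((2 ^ n : ℕ) : ℝ) := by
    push_cast; linarith [mul_comm (K : ℝ) ((n : ℝ) ^ p)]
  exact_mod_cast h3

/-- Doubly exponential time suffices to try all coin sequences of polynomial length. -/
theorem exists_search_time_le (C C' C₀ k : ℕ) : ∃ N, ∀ n ≥ N, ∀ L ≤ C * (n + C₀ * n ^ k + 1) ^ 2,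
    25 * 2 ^ n + (2 ^ n + 1) ^ 2 + C' * (2 ^ L * (L + n + 1)) ≤ 2 ^ 2 ^ n := by
  obtain ⟨N₁, hN₁⟩ := exists_mul_pow_le_two_pow (C' + 2 * (C * (C₀ + 2) ^ 2) + 2) (2 * (k + 1))
  obtain ⟨N₂, hN₂⟩ := exists_mul_pow_le_two_pow 58 2
  refine ⟨N₁ + N₂ + 1, fun n hn L hL => ?_⟩
  have hn0 : 0 < n := by omega
  have h1 : 1 ≤ n ^ (k + 1) := Nat.one_le_pow _ _ hn0
  have h2 : n ≤ n ^ (k + 1) := Nat.le_self_pow (Nat.succ_ne_zero k) n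
  have h3 : n ^ k ≤ n ^ (k + 1) := Nat.pow_le_pow_right hn0 (Nat.le_succ k)
  have h4 : n + C₀ * n ^ k + 1 ≤ (C₀ + 2) * n ^ (k + 1) := by nlinarith
  have h5 : L ≤ C * (C₀ + 2) ^ 2 * (n ^ (k + 1)) ^ 2 := by
    refine hL.trans ((Nat.mul_le_mul_left C (Nat.pow_le_pow_left h4 2)).trans (le_of_eq ?_))
    ring
  have h6 : n ^ (k + 1) ≤ (n ^ (k + 1)) ^ 2 := Nat.le_self_pow two_ne_zero _
  have h7 := hN₁ n (by omega)
  rw [mul_comm 2 (k + 1), pow_mul] at h7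
  have h8 : C' + L + (L + n) + 1 ≤ 2 ^ n := by
    generalize n ^ (k + 1) = z at *
    nlinarith
  have h9 : L + n + 1 ≤ 2 ^ (L + n) := Nat.lt_two_pow_self
  have h10 : C' ≤ 2 ^ C' := Nat.lt_two_pow_self.le
  have h11 : 2 * (C' * (2 ^ L * (L + n + 1))) ≤ 2 ^ 2 ^ n := by
    calc 2 * (C' * (2 ^ L * (L + n + 1))) ≤ 2 * (2 ^ C' * (2 ^ L * 2 ^ (L + n))) := by gcongr
      _ = 2 ^ (C' + L + (L + n) + 1) := by ring
      _ ≤ 2 ^ 2 ^ n := Nat.pow_le_pow_right two_pos h8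
  have hm : n < 2 ^ n := Nat.lt_two_pow_self
  have h12 := hN₂ (2 ^ n) (by omega)
  generalize 2 ^ 2 ^ n = M at *
  generalize 2 ^ n = m at *
  nlinarith

theorem ProbTM.mem_iff_of_answers {M : ProbTM} {L : Language Bool} (hM : M.ZeroError L)
    {w : List Bool} {ω : ℕ → Bool} {T : ℕ} {a : Bool} (h : Answers M.accept a (M.run w ω T)) :
    w ∈ L ↔ a = true := by
  rw [← hM w ω T h.1, h.2]

/-- If a machine contradicts every table machine at infinitely many places, then the language that
it defines is not in `ZPP`. -/
theorem notMem_ZPP_of_diagonal {A : Language Bool} {Q : ℕ → Bool → ℕ → Prop}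
    (hQ : ∀ n a T, Q n a T → T ≤ 2 ^ 2 ^ n → (ones n ∈ A ↔ a = true))
    (hdiag : ∀ i, ∃ C, ∀ N, ∃ n ≥ N, ∀ u a₀, tabRun i u (tabInit n) = .inl a₀ →
      ∃ a u', tabRun i u' (tabInit n) = .inl a ∧
        ∃ T ≤ 25 * 2 ^ n + (2 ^ n + 1) ^ 2 + C * (2 ^ u.length * (u.length + n + 1)),
          Q n (!a) T) : A ∉ ZPP := by
  intro hA
  obtain ⟨k, -, M, τ, hM, hτ, hO⟩ := Set.mem_iUnion₂.1 hA
  obtain ⟨C₁, hC₁⟩ := hO.bound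
  obtain ⟨N₁, hN₁⟩ := Filter.eventually_atTop.1 hC₁
  have hτ' : ∀ n ≥ N₁, τ n ≤ ⌈C₁⌉₊ * n ^ k := fun n hn => by
    have h := hN₁ n hn
    rw [Real.norm_of_nonneg (by positivity), Real.norm_of_nonneg (by positivity)] at h
    have h2 : C₁ * ((n ^ k : ℕ) : ℝ) ≤ ⌈C₁⌉₊ * ((n ^ k : ℕ) : ℝ) :=
      mul_le_mul_of_nonneg_right (Nat.le_ceil _) (by positivity)
    exact_mod_cast h.trans h2
  obtain ⟨i, C, hi⟩ := M.exists_table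
  obtain ⟨C', hC'⟩ := hdiag i
  obtain ⟨N₂, hN₂⟩ := exists_search_time_le C C' ⌈C₁⌉₊ k
  obtain ⟨n, hn, hrun⟩ := hC' (N₁ + N₂)
  obtain ⟨ω, T₀, hT₀, hhalt⟩ := ProbTM.exists_haltedAt (hτ (ones n))
  rw [ProbTM.length_ones] at hT₀
  obtain ⟨u, a₀, hu, hlen⟩ := (hi n).2 ω T₀ hhalt
  obtain ⟨a, u', hu', T, hT, hans⟩ := hrun u a₀ hu
  have hT₁ := hT₀.trans (hτ' n (by omega))
  have hlen' : u.length ≤ C * (n + ⌈C₁⌉₊ * n ^ k + 1) ^ 2 :=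
    hlen.trans (Nat.mul_le_mul_left _ (Nat.pow_le_pow_left (by omega) 2))
  have h1 := hQ n (!a) T hans (hT.trans (hN₂ n (by omega) _ hlen'))
  obtain ⟨ω', T', h'⟩ := (hi n).1 u' a hu'
  have h2 := ProbTM.mem_iff_of_answers hM h'
  rw [h1] at h2
  cases a <;> simp at h2

theorem mainTheorem5 (d g : ℕ → ℕ) (hd : Monotone d) (hg : Monotone g)
    (hd_unbdd : ¬ BddAbove (Set.range d)) (hg_unbdd : ¬ BddAbove (Set.range g))
    (hd_comp : Computable d) (hg_pad : PaddingStable g) :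
    ∃ A : Language Bool, A ∈ ZTIMEExpLinear ∧ A ∈ TALLY d g ∧ A ∉ ZPP := by
  obtain ⟨c, hc, hgc⟩ := hg_pad.exists_tower hg
  obtain ⟨nxt, hnxt⟩ := exists_nxt_code (c := c) hd_comp
  obtain ⟨ctl, hctl⟩ := exists_ctl_code
  obtain ⟨rst, hrst⟩ := exists_rst_code
  let code : Site → ToPartrec.Code := fun s => match s with
    | .nxt => nxt
    | .ctl => ctl
    | .rst => rst
  have hfl : ∀ r, activeFlag c d r = 0 ∨ activeFlag c d r = 1 := by
    rintro (_ | r)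
    · exact .inl rfl
    · exact isActive_eq r _
  obtain ⟨t, ht, hneg, hpos⟩ := diag_spec (code := code) hctl hrst
    (fl := activeFlag c d) (x := fun r => Nat.pair r (numActive c d r))
    (idx := fun r => (numActive c d r).unpair.1) hfl rfl rfl rfl hnxt
  have htpos : ∀ r, 0 < t (r + 1) := fun r => (Nat.zero_le _).trans_lt (ht (Nat.succ_pos r))
  let A₁ : Language Bool := {w | ∃ n, w = ones n ∧ ∃ T ≤ 2 ^ n,
    Answers (diag code).accept true ((diag code).run w (fun _ => false) T)}
  let A₀ : Language Bool := {w | ∃ n, w = ones n ∧ ones (2 ^ n) ∈ A₁}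
  have hA₁ : A₁ ∈ ZTIMEExpLinear := ProbTM.clocked_mem_ZTIMEExpLinear fun _ => rfl
  have hA₁' : ∀ w ∈ A₁, ∃ r, activeFlag c d (r + 1) = 1 ∧ w = ones (tower (t (r + 1))) := by
    rintro w ⟨n, rfl, T, -, hT⟩
    obtain ⟨r, rfl, hr⟩ := hneg n _ T hT
    rcases r with _ | r
    · simp [activeFlag] at hr
    · exact ⟨r, hr, rfl⟩
  have hA₀' : ∀ w ∈ A₀, ∃ r, activeFlag c d (r + 1) = 1 ∧ w = ones (tower (t (r + 1) - 1)) := by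
    rintro w ⟨n, rfl, hn⟩
    obtain ⟨r, hr, h⟩ := hA₁' _ hn
    obtain ⟨s, hs⟩ := Nat.exists_eq_succ_of_ne_zero (htpos r).ne'
    refine ⟨r, hr, congrArg ones ?_⟩
    rw [hs] at h ⊢
    exact Nat.pow_right_injective le_rfl (ProbTM.ones_injective h)
  have hmem : ∀ n, ones n ∈ A₀ ↔ ones (2 ^ n) ∈ A₁ := fun n =>
    ⟨fun ⟨m, h, hm⟩ => by rwa [ProbTM.ones_injective h], fun h => ⟨n, rfl, h⟩⟩
  have hA₀ : A₀ ∉ ZPP := by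
    refine notMem_ZPP_of_diagonal (Q := fun n a T => Answers (diag code).accept a
      ((diag code).run (ones (2 ^ n)) (fun _ => false) T)) (fun n a T hans hT => ?_) fun i => ?_
    · rw [hmem]
      constructor
      · rintro ⟨m, hm, T', -, hT'⟩
        exact ProbTM.answers_unique hans hT'
      · rintro rfl
        exact ⟨_, rfl, T, hT, hans⟩
    · obtain ⟨C, hC⟩ := hpos i
      refine ⟨C, fun N => ?_⟩
      obtain ⟨r, hr, hv⟩ := exists_numActive_eq (c := c) hc hd hd_unbdd (Nat.pair i (N + 1) - 1)
      have hN : N + 1 ≤ Nat.pair i (N + 1) := Nat.right_le_pair i (N + 1)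
      rw [Nat.sub_add_cancel (by omega)] at hv
      obtain ⟨s, hs⟩ := Nat.exists_eq_succ_of_ne_zero (htpos r).ne'
      have hrs : r + 1 ≤ s + 1 := (ht.id_le (r + 1)).trans hs.le
      have hst : s ≤ tower s := tower_strictMono.id_le s
      have hst' : s + 1 ≤ 2 ^ tower s := tower_strictMono.id_le (s + 1)
      have hle := numActive_le_self (c := c) (d := d) (r + 1)
      refine ⟨tower s, by omega, fun u a₀ hu => ?_⟩
      have h := hC (r + 1) hr (by rw [hv, Nat.unpair_pair]) u a₀
      rw [hs] at h
      obtain ⟨a, u', hu', T, hT, hans⟩ := h hu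
      refine ⟨a, u', hu', T, hT.trans (Nat.add_le_add_right ?_ _), hans _⟩
      have hx := (Nat.pair_lt_max_add_one_sq (r + 1) (numActive c d (r + 1))).le.trans
        (Nat.pow_le_pow_left (show _ ≤ 2 ^ tower s + 1 by omega) 2)
      have : tower (s + 1) = 2 ^ tower s := rfl
      simp only [Nat.succ_eq_add_one]
      omega
  by_cases h : A₀ ∈ ZTIMEExpLinear
  · refine ⟨A₀, h, mem_TALLY_of_active hd hgc (s := fun r => t (r + 1) - 1)
      (strictMono_nat_of_lt_succ fun r => ?_) hA₀', hA₀⟩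
    have := ht (show r + 1 < r + 1 + 1 by omega)
    have := htpos r
    omega
  · exact ⟨A₁, hA₁, mem_TALLY_of_active hd hgc (ht.comp fun _ _ => Nat.succ_lt_succ) hA₁',
      fun h' => h (ProbTM.unpad_mem_ZTIMEExpLinear h')⟩
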